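/- Let $\mathbb{B}$ be a separable (real) Banach space and $\mu\ge 0$ a finite Borel measure on $\mathbb{B}$. Notation. For a real-valued function $f$ defined on an open set containing $x$, ${\rm lip}_a(f)(x):=\inf_{r>0}{\rm Lip}(f;B_r(x))$, where ${\rm Lip}(f;E)$ is the Lipschitz constant of $f$ on $E$ and $B_r(x)$ the open ball. ${\rm LIP}_b(\mathbb{B})$ denotes the bounded Lipschitz functions $\mathbb{B}\to\mathbb{R}$, and ${\rm LIP}_{loc}(\Omega)$ the locally Lipschitz functions $\Omega\to\mathbb{R}$. ${\rm Cyl}(\mathbb{B})$ is the set of functions $g\circ T$ with $T:\mathbb{B}\to\mathbb{V}$ bounded linear, $\mathbb{V}$ a finite-dimensional Banach space and $g\in C^\infty(\mathbb{V})$ bounded and Lipschitz; $d_xf\in\mathbb{B}^*$ is the Fréchet differential. For $p\in[1,\infty)$, a function $f\in L^p(\mu)$ belongs to $W^{1,p}(\mathbb{B},\mu)$ if there are $(u_n)_n\subseteq{\rm LIP}_b(\mathbb{B})$ and $G\in L^p(\mu)$, $G\ge0$, with $u_n\to f$ and ${\rm lip}_a(u_n)\to G$ in $L^p(\mu)$;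 such a $G$ is called a relaxed slope of $f$, and the minimal relaxed slope $|{\rm D}f|$ is the $\mu$-a.e. smallest one. A function $f\in L^1(\mu)$ belongs to $BV(\mathbb{B},\mu)$ if there is $(u_n)_n\subseteq{\rm LIP}_b(\mathbb{B})$ with $u_n\to f$ in $L^1(\mu)$ and $\liminf_n\int_{\mathbb{B}}{\rm lip}_a(u_n)\,d\mu<\infty$; its total variation measure $|{\bf D}f|$ is the finite Borel measure on $\mathbb{B}$ with $$|{\bf D}f|(\Omega)=\inf\Big\{\liminf_n\int_\Omega{\rm lip}_a(u_n)\,d\mu\;\Big|\;u_n\in{\rm LIP}_{loc}(\Omega)\cap L^1(\mu|_\Omega),\ u_n\to f|_\Omega\text{ in }L^1(\mu|_\Omega)\Big\}$$ for every open set $\Omega\subseteq\mathbb{B}$. Theorem. (i) Let $p\in[1,\infty)$ and $f\in W^{1,p}(\mathbb{B},\mu)$. Then the minimal relaxed slope $|{\rm D}f|$ exists, and there is a sequence $(f_n)_n\subseteq{\rm Cyl}(\mathbb{B})$ such that $f_n\to f$ and $\|d_\cdot f_n\|_{\mathbb{B}^*}\to|{\rm D}f|$ in $L^p(\mu)$.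 (ii) Let $f\in BV(\mathbb{B},\mu)$. Then the measure $|{\bf D}f|$ exists and is unique, and there is a sequence $(f_n)_n\subseteq{\rm Cyl}(\mathbb{B})$ such that $f_n\to f$ in $L^1(\mu)$ and $\int_{\mathbb{B}}\|d_\cdot f_n\|_{\mathbb{B}^*}\,d\mu\to|{\bf D}f|(\mathbb{B})$. Moreover, for every such sequence, $\|d_\cdot f_n\|_{\mathbb{B}^*}\,\mu$ converges weakly to $|{\bf D}f|$, i.e. $\int\varphi\,\|d_\cdot f_n\|_{\mathbb{B}^*}\,d\mu\to\int\varphi\,d|{\bf D}f|$ for every bounded continuous $\varphi:\mathbb{B}\to\mathbb{R}$. -/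

import Mathlib

open MeasureTheory Filter Topology
open scoped ENNReal NNReal ContDiff BoundedContinuousFunction

noncomputable section

namespace DensityInEnergy

/-- The Lipschitz constant `Lip(f; E)` of `f` on `E` (equal to `∞` if `f` is not Lipschitz
on `E`). -/
def lipConst {X : Type*} [PseudoMetricSpace X] (f : X → ℝ) (E : Set X) : ℝ≥0∞ :=
  ⨅ (K : ℝ≥0) (_ : LipschitzOnWith K f E), (K : ℝ≥0∞)

/-- The asymptotic slope `lip_a(f)(x) = inf_{r > 0} Lip(f; B_r(x))`. -/
def asympSlope {X : Type*} [PseudoMetricSpace X] (f : X → ℝ) (x : X) : ℝ≥0∞ :=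
  ⨅ (r : ℝ) (_ : 0 < r), lipConst f (Metric.ball x r)

/-- `f ∈ LIP_b(X)`: `f` is a bounded real-valued Lipschitz function. -/
def IsBddLipschitz {X : Type*} [PseudoMetricSpace X] (f : X → ℝ) : Prop :=
  (∃ K : ℝ≥0, LipschitzWith K f) ∧ ∃ C : ℝ, ∀ x, |f x| ≤ C

/-- `f ∈ Cyl(B)`: `f = g ∘ T` with `T : B → V` bounded linear, `V` a finite-dimensional Banach
space and `g : V → ℝ` smooth, bounded and Lipschitz. (Every finite-dimensional Banach space is
isometrically isomorphic to one whose underlying type lies in `Type`.) -/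
def IsCylindrical {B : Type*} [NormedAddCommGroup B] [NormedSpace ℝ B] (f : B → ℝ) : Prop :=
  ∃ (V : Type) (_ : NormedAddCommGroup V) (_ : NormedSpace ℝ V) (_ : FiniteDimensional ℝ V)
    (T : B →L[ℝ] V) (g : V → ℝ), ContDiff ℝ ∞ g ∧ IsBddLipschitz g ∧ f = g ∘ T

/-- `u n → f` in `L^p(μ)`. -/
def TendstoLp {X : Type*} [MeasurableSpace X] (p : ℝ≥0∞) (μ : Measure X)
    (u : ℕ → X → ℝ) (f : X → ℝ) : Prop :=
  Tendsto (fun n => eLpNorm (fun x => u n x - f x) p μ) atTop (𝓝 0)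

/-- `G ∈ L^p(μ)⁺` is a relaxed slope of `f`: there are `u n ∈ LIP_b(X)` with `u n → f` and
`lip_a(u n) → G` in `L^p(μ)`. -/
def IsRelaxedSlope {X : Type*} [PseudoMetricSpace X] [MeasurableSpace X] (p : ℝ≥0∞)
    (μ : Measure X) (f G : X → ℝ) : Prop :=
  MemLp G p μ ∧ (∀ᵐ x ∂μ, 0 ≤ G x) ∧
    ∃ u : ℕ → X → ℝ, (∀ n, IsBddLipschitz (u n)) ∧ TendstoLp p μ u f ∧
      TendstoLp p μ (fun n x => (asympSlope (u n) x).toReal) G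

/-- `f ∈ W^{1,p}(X, μ)`. -/
def MemSobolev {X : Type*} [PseudoMetricSpace X] [MeasurableSpace X] (p : ℝ≥0∞)
    (μ : Measure X) (f : X → ℝ) : Prop :=
  MemLp f p μ ∧ ∃ G : X → ℝ, IsRelaxedSlope p μ f G

/-- `G` is (a representative of) the minimal relaxed slope `|Df|`: the `μ`-a.e. smallest
relaxed slope of `f`. -/
def IsMinimalRelaxedSlope {X : Type*} [PseudoMetricSpace X] [MeasurableSpace X] (p : ℝ≥0∞)
    (μ : Measure X) (f G : X → ℝ) : Prop :=
  IsRelaxedSlope p μ f G ∧ ∀ G' : X → ℝ, IsRelaxedSlope p μ f G' → ∀ᵐ x ∂μ, G x ≤ G' x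

/-- `f ∈ BV(X, μ)`. -/
def MemBV {X : Type*} [PseudoMetricSpace X] [MeasurableSpace X] (μ : Measure X)
    (f : X → ℝ) : Prop :=
  MemLp f 1 μ ∧ ∃ u : ℕ → X → ℝ, (∀ n, IsBddLipschitz (u n)) ∧ TendstoLp 1 μ u f ∧
    liminf (fun n => ∫⁻ x, asympSlope (u n) x ∂μ) atTop < ⊤

/-- The variation of `f` on an open set `Ω`: the infimum of `liminf_n ∫_Ω lip_a(u n) dμ` over
all sequences `u n ∈ LIP_loc(Ω) ∩ L¹(μ|Ω)` converging to `f` in `L¹(μ|Ω)`. A function on the open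
set `Ω` is represented by an arbitrary extension to `X`; neither the conditions on `u n` nor
the values of `lip_a(u n)` in `Ω` depend on the extension. -/
def variationOn {X : Type*} [PseudoMetricSpace X] [MeasurableSpace X] (μ : Measure X)
    (f : X → ℝ) (Ω : Set X) : ℝ≥0∞ :=
  sInf {a : ℝ≥0∞ | ∃ u : ℕ → X → ℝ,
    (∀ n, LocallyLipschitzOn Ω (u n) ∧ MemLp (u n) 1 (μ.restrict Ω)) ∧
    TendstoLp 1 (μ.restrict Ω) u f ∧
    a = liminf (fun n => ∫⁻ x in Ω, asympSlope (u n) x ∂μ) atTop}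

/-- `ν` is the total variation measure of `f`: the finite Borel measure whose value on
every open set `Ω` is the variation of `f` on `Ω`. -/
def IsTotalVariation {X : Type*} [PseudoMetricSpace X] [MeasurableSpace X] (μ : Measure X)
    (f : X → ℝ) (ν : Measure X) : Prop :=
  IsFiniteMeasure ν ∧ ∀ Ω : Set X, IsOpen Ω → ν Ω = variationOn μ f Ω

end DensityInEnergy

end

set_option linter.unusedSectionVars false

noncomputable section

namespace DensityInEnergy

/-! ### Calculus of the asymptotic slope -/

section Slope

variable {X : Type*} [PseudoMetricSpace X]

/-! Both parts rest on a one-sided notion. `H` is a pre-slope of `f` if cylindrical `v` exist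
arbitrarily close to `f` in `L^p` with the positive part of `‖dv‖ - H` arbitrarily small in `L^p`.

A bounded `L`-Lipschitz function is an `L^p` limit of cylindrical functions with the same constant
(`exists_cylindrical_approx`): take the McShane formula over finitely many points of a dense
sequence, replace the norm by the maximum of finitely many functionals, and mollify in finite
dimension. So the constant `L` is a pre-slope. The product rule glues pre-slopes along cylindrical
cutoffs (`PreSlope.glue`); gluing `f` with itself produces no error term, so pre-slopes are stable
under minimum, and minimizing the integral gives a smallest one, `G`. Gluing with a Lipschitz
extension from a ball shows that `G` is at most the local Lipschitz constant, hence `lip_a(u)` is a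
pre-slope of every bounded Lipschitz `u` (`IsBddLipschitz.preSlope`), and so is every relaxed slope.
A convexity argument in a Hilbert space shows that `‖dv‖` cannot stay below `G` by a definite
amount, which upgrades the one-sided bound to strong convergence. Thus `G` is itself a relaxed
slope, necessarily the minimal one, and (i) follows.

For (ii), competitors in the variation are only locally Lipschitz. Cutoffs built from compact sets
of almost full measure turn them into bounded Lipschitz functions at small cost in energy
(`exists_cutoff_seq`), so cylindrical functions achieve the total variation. The variation on open
sets is countably subadditive (`variationOn_iUnion_le`, by a partition of unity) and superadditive
on disjoint sets, so it induces a metric outer measure and hence a Borel measure. Weak convergence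
follows from lower semicontinuity on open sets together with convergence of the total masses. -/

lemma lipConst_le {f : X → ℝ} {E : Set X} {K : ℝ≥0} (h : LipschitzOnWith K f E) :
    lipConst f E ≤ K := iInf₂_le K h

lemma asympSlope_lt_iff {f : X → ℝ} {x : X} {c : ℝ≥0∞} :
    asympSlope f x < c ↔
      ∃ r : ℝ, 0 < r ∧ ∃ K : ℝ≥0, (K : ℝ≥0∞) < c ∧ LipschitzOnWith K f (Metric.ball x r) := by
  simp only [asympSlope, lipConst, iInf_lt_iff, exists_prop]
  constructor
  · rintro ⟨r, hr, K, hK, hKc⟩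
    exact ⟨r, hr, K, hKc, hK⟩
  · rintro ⟨r, hr, K, hKc, hK⟩
    exact ⟨r, hr, K, hK, hKc⟩

lemma asympSlope_le_of_lipschitzOnWith {f : X → ℝ} {x : X} {s : Set X} {K : ℝ≥0}
    (hs : s ∈ 𝓝 x) (h : LipschitzOnWith K f s) : asympSlope f x ≤ K := by
  obtain ⟨r, hr, hrs⟩ := Metric.mem_nhds_iff.1 hs
  exact (iInf₂_le r hr).trans (lipConst_le (h.mono hrs))

lemma asympSlope_le_of_lipschitzWith {f : X → ℝ} {K : ℝ≥0} (h : LipschitzWith K f) (x : X) :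
    asympSlope f x ≤ K :=
  asympSlope_le_of_lipschitzOnWith univ_mem h.lipschitzOnWith

lemma isOpen_asympSlope_lt (f : X → ℝ) (c : ℝ≥0∞) : IsOpen {x | asympSlope f x < c} := by
  rw [Metric.isOpen_iff]
  intro x hx
  obtain ⟨r, hr, K, hK, hL⟩ := asympSlope_lt_iff.1 hx
  exact ⟨r, hr, fun y hy => (asympSlope_le_of_lipschitzOnWith
    (Metric.isOpen_ball.mem_nhds hy) hL).trans_lt hK⟩

lemma measurable_asympSlope [MeasurableSpace X] [OpensMeasurableSpace X] (f : X → ℝ) :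
    Measurable (asympSlope f) :=
  measurable_of_Iio fun c => (isOpen_asympSlope_lt f c).measurableSet

lemma asympSlope_ne_top_iff {f : X → ℝ} {x : X} :
    asympSlope f x ≠ ⊤ ↔ ∃ K : ℝ≥0, ∃ s ∈ 𝓝 x, LipschitzOnWith K f s := by
  constructor
  · intro h
    obtain ⟨r, hr, K, -, hK⟩ := asympSlope_lt_iff.1 h.lt_top
    exact ⟨K, _, Metric.ball_mem_nhds x hr, hK⟩
  · rintro ⟨K, s, hs, hK⟩
    exact ((asympSlope_le_of_lipschitzOnWith hs hK).trans_lt ENNReal.coe_lt_top).ne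

lemma locallyLipschitzOn_iff_asympSlope {f : X → ℝ} {U : Set X} (hU : IsOpen U) :
    LocallyLipschitzOn U f ↔ ∀ x ∈ U, asympSlope f x ≠ ⊤ := by
  constructor
  · intro h x hx
    obtain ⟨K, t, ht, hK⟩ := h hx
    exact asympSlope_ne_top_iff.2 ⟨K, t, by rwa [hU.nhdsWithin_eq hx] at ht, hK⟩
  · intro h x hx
    obtain ⟨K, t, ht, hK⟩ := asympSlope_ne_top_iff.1 (h x hx)
    exact ⟨K, t, mem_nhdsWithin_of_mem_nhds ht, hK⟩

lemma asympSlope_congr {f g : X → ℝ} {x : X} (h : f =ᶠ[𝓝 x] g) :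
    asympSlope f x = asympSlope g x := by
  have key : ∀ {f g : X → ℝ}, f =ᶠ[𝓝 x] g → asympSlope g x ≤ asympSlope f x := by
    intro f g h
    refine le_of_forall_gt fun c hc => ?_
    obtain ⟨r, hr, K, hK, hL⟩ := asympSlope_lt_iff.1 hc
    refine (asympSlope_le_of_lipschitzOnWith
      (inter_mem (Metric.ball_mem_nhds x hr) h) ?_).trans_lt hK
    intro y hy z hz
    have h1 : f y = g y := hy.2
    have h2 : f z = g z := hz.2
    rw [← h1, ← h2]
    exact hL hy.1 hz.1
  exact le_antisymm (key h.symm) (key h)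

lemma asympSlope_const (c : ℝ) (x : X) : asympSlope (fun _ : X => c) x = 0 :=
  le_antisymm (by simpa using asympSlope_le_of_lipschitzWith (LipschitzWith.const (α := X) c) x)
    bot_le

lemma asympSlope_eq_zero_of_eventually {f : X → ℝ} {x : X} {c : ℝ} (h : ∀ᶠ y in 𝓝 x, f y = c) :
    asympSlope f x = 0 :=
  (asympSlope_congr h).trans (asympSlope_const c x)

lemma asympSlope_add_le (f g : X → ℝ) (x : X) :
    asympSlope (fun y => f y + g y) x ≤ asympSlope f x + asympSlope g x := by
  rcases eq_or_ne (asympSlope f x) ⊤ with hf | hf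
  · simp [hf]
  rcases eq_or_ne (asympSlope g x) ⊤ with hg | hg
  · simp [hg]
  refine ENNReal.le_of_forall_pos_le_add fun ε hε _ => ?_
  have hε2 : (ε / 2 : ℝ≥0∞) ≠ 0 := by simpa using hε.ne'
  obtain ⟨r, hr, K, hK, hL⟩ := asympSlope_lt_iff.1 (ENNReal.lt_add_right hf hε2)
  obtain ⟨r', hr', K', hK', hL'⟩ := asympSlope_lt_iff.1 (ENNReal.lt_add_right hg hε2)
  have h := (hL.mono Set.inter_subset_left).add (hL'.mono Set.inter_subset_right)
  refine (asympSlope_le_of_lipschitzOnWith (inter_mem (Metric.ball_mem_nhds x hr)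
    (Metric.ball_mem_nhds x hr')) h).trans ?_
  push_cast
  refine (add_le_add hK.le hK'.le).trans (le_of_eq ?_)
  rw [add_add_add_comm, ENNReal.add_halves]

lemma asympSlope_sub_const (f : X → ℝ) (c : ℝ) (x : X) :
    asympSlope (fun y => f y - c) x = asympSlope f x := by
  refine le_antisymm ?_ ?_
  · simpa [sub_eq_add_neg, asympSlope_const] using asympSlope_add_le f (fun _ => -c) x
  · simpa [asympSlope_const] using asympSlope_add_le (fun y => f y - c) (fun _ => c) x

lemma asympSlope_sum_le {ι : Type*} (s : Finset ι) (f : ι → X → ℝ) (x : X) :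
    asympSlope (fun y => ∑ i ∈ s, f i y) x ≤ ∑ i ∈ s, asympSlope (f i) x := by
  classical
  induction s using Finset.induction_on with
  | empty => simp [asympSlope_const]
  | insert a s ha ih =>
    simp only [Finset.sum_insert ha]
    exact (asympSlope_add_le _ _ x).trans (add_le_add le_rfl ih)

lemma asympSlope_comp_le {f : X → ℝ} {φ : ℝ → ℝ} (hφ : LipschitzWith 1 φ) (x : X) :
    asympSlope (fun y => φ (f y)) x ≤ asympSlope f x := by
  refine le_of_forall_gt fun c hc => ?_
  obtain ⟨r, hr, K, hK, hL⟩ := asympSlope_lt_iff.1 hc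
  refine (asympSlope_le_of_lipschitzOnWith (K := K) (Metric.ball_mem_nhds x hr) ?_).trans_lt hK
  have h := hφ.comp_lipschitzOnWith hL
  rwa [one_mul] at h

lemma lipschitzOnWith_mul {f g : X → ℝ} {s : Set X} {K L A C : ℝ≥0}
    (hf : LipschitzOnWith K f s) (hg : LipschitzOnWith L g s)
    (hA : ∀ y ∈ s, |f y| ≤ A) (hC : ∀ y ∈ s, |g y| ≤ C) :
    LipschitzOnWith (A * L + C * K) (fun y => f y * g y) s := by
  rw [lipschitzOnWith_iff_dist_le_mul] at *
  intro y hy z hz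
  have h1 := hf y hy z hz
  have h2 := hg y hy z hz
  have e : f y * g y - f z * g z = f y * (g y - g z) + g z * (f y - f z) := by ring
  rw [Real.dist_eq] at *
  rw [e]
  refine (abs_add_le _ _).trans ?_
  rw [abs_mul, abs_mul]
  push_cast
  rw [add_mul, mul_assoc, mul_assoc]
  exact add_le_add (mul_le_mul (hA y hy) h2 (abs_nonneg _) A.2)
    (mul_le_mul (hC z hz) h1 (abs_nonneg _) C.2)

lemma continuousAt_of_asympSlope_ne_top {f : X → ℝ} {x : X} (h : asympSlope f x ≠ ⊤) :
    ContinuousAt f x := by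
  obtain ⟨K, s, hs, hK⟩ := asympSlope_ne_top_iff.1 h
  exact hK.continuousOn.continuousAt hs

/-- On a small ball the values and the Lipschitz constants of both factors exceed their pointwise
counterparts at `x` by at most `η`; the product rule for Lipschitz constants applies there and `η`
tends to `0`. Finiteness of the slopes avoids the convention `0 * ∞ = 0` and gives continuity at
`x`. -/
lemma asympSlope_mul_le {f g : X → ℝ} {x : X} (hf : asympSlope f x ≠ ⊤)
    (hg : asympSlope g x ≠ ⊤) :
    asympSlope (fun y => f y * g y) x ≤
      ‖f x‖ₑ * asympSlope g x + ‖g x‖ₑ * asympSlope f x := by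
  have hfc := continuousAt_of_asympSlope_ne_top hf
  have hgc := continuousAt_of_asympSlope_ne_top hg
  lift asympSlope f x to ℝ≥0 using hf with a ha
  lift asympSlope g x to ℝ≥0 using hg with b hb
  have key : ∀ η : ℝ≥0, 0 < η → asympSlope (fun y => f y * g y) x ≤
      (((‖f x‖₊ + η) * (b + η) + (‖g x‖₊ + η) * (a + η) : ℝ≥0) : ℝ≥0∞) := by
    intro η hη
    obtain ⟨r, hr, K, hK, hL⟩ := asympSlope_lt_iff.1
      (show asympSlope f x < ((a + η : ℝ≥0) : ℝ≥0∞) by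
        rw [← ha]; exact_mod_cast lt_add_of_pos_right a hη)
    obtain ⟨r', hr', K', hK', hL'⟩ := asympSlope_lt_iff.1
      (show asympSlope g x < ((b + η : ℝ≥0) : ℝ≥0∞) by
        rw [← hb]; exact_mod_cast lt_add_of_pos_right b hη)
    have h1 : ∀ᶠ y in 𝓝 x, ‖f y‖₊ < ‖f x‖₊ + η :=
      hfc.nnnorm.eventually_lt_const (lt_add_of_pos_right _ hη)
    have h2 : ∀ᶠ y in 𝓝 x, ‖g y‖₊ < ‖g x‖₊ + η :=
      hgc.nnnorm.eventually_lt_const (lt_add_of_pos_right _ hη)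
    have hs := inter_mem (inter_mem (Metric.ball_mem_nhds x hr) (Metric.ball_mem_nhds x hr'))
      (inter_mem h1 h2)
    refine (asympSlope_le_of_lipschitzOnWith hs (lipschitzOnWith_mul
      (hL.mono fun y hy => hy.1.1) (hL'.mono fun y hy => hy.1.2)
      (A := ‖f x‖₊ + η) (C := ‖g x‖₊ + η)
      (fun y hy => ?_) (fun y hy => ?_))).trans ?_
    · exact_mod_cast (le_of_lt hy.2.1 : ‖f y‖₊ ≤ ‖f x‖₊ + η)
    · exact_mod_cast (le_of_lt hy.2.2 : ‖g y‖₊ ≤ ‖g x‖₊ + η)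
    · have hK1 : K ≤ a + η := by exact_mod_cast hK.le
      have hK2 : K' ≤ b + η := by exact_mod_cast hK'.le
      rw [ENNReal.coe_le_coe]
      gcongr
  have hlim : Tendsto (fun η : ℝ≥0 =>
      (((‖f x‖₊ + η) * (b + η) + (‖g x‖₊ + η) * (a + η) : ℝ≥0) : ℝ≥0∞)) (𝓝[>] 0)
      (𝓝 (((‖f x‖₊ + 0) * (b + 0) + (‖g x‖₊ + 0) * (a + 0) : ℝ≥0) : ℝ≥0∞)) := by
    refine ENNReal.tendsto_coe.2 (Tendsto.mono_left ?_ nhdsWithin_le_nhds)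
    exact Continuous.tendsto (by fun_prop) 0
  have := ge_of_tendsto hlim (eventually_nhdsWithin_of_forall key)
  refine this.trans (le_of_eq ?_)
  simp [enorm_eq_nnnorm]

end Slope

/-! ### Algebra and differentials of cylindrical functions -/

section Cylindrical

variable {B : Type*} [NormedAddCommGroup B] [NormedSpace ℝ B]

lemma IsBddLipschitz.add {X : Type*} [PseudoMetricSpace X] {f g : X → ℝ} (hf : IsBddLipschitz f)
    (hg : IsBddLipschitz g) : IsBddLipschitz fun x => f x + g x := by
  obtain ⟨⟨K, hK⟩, C, hC⟩ := hf
  obtain ⟨⟨L, hL⟩, D, hD⟩ := hg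
  exact ⟨⟨_, hK.add hL⟩, C + D, fun x => (abs_add_le _ _).trans (add_le_add (hC x) (hD x))⟩

lemma IsBddLipschitz.mul {X : Type*} [PseudoMetricSpace X] {f g : X → ℝ} (hf : IsBddLipschitz f)
    (hg : IsBddLipschitz g) : IsBddLipschitz fun x => f x * g x := by
  obtain ⟨⟨K, hK⟩, C, hC⟩ := hf
  obtain ⟨⟨L, hL⟩, D, hD⟩ := hg
  refine ⟨⟨C.toNNReal * L + D.toNNReal * K, ?_⟩, C * D, fun x => ?_⟩
  · rw [← lipschitzOnWith_univ] at *
    exact lipschitzOnWith_mul hK hL (fun y _ => (hC y).trans (Real.le_coe_toNNReal _))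
      (fun y _ => (hD y).trans (Real.le_coe_toNNReal _))
  · rw [abs_mul]
    exact mul_le_mul (hC x) (hD x) (abs_nonneg _) ((abs_nonneg _).trans (hC x))

lemma IsBddLipschitz.comp {X Y : Type*} [PseudoMetricSpace X] [PseudoMetricSpace Y] {g : Y → ℝ}
    (hg : IsBddLipschitz g) {T : X → Y} {K : ℝ≥0} (hT : LipschitzWith K T) :
    IsBddLipschitz (g ∘ T) := by
  obtain ⟨⟨L, hL⟩, D, hD⟩ := hg
  exact ⟨⟨_, hL.comp hT⟩, D, fun x => hD _⟩

lemma isBddLipschitz_const {X : Type*} [PseudoMetricSpace X] (c : ℝ) :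
    IsBddLipschitz fun _ : X => c :=
  ⟨⟨0, LipschitzWith.const c⟩, |c|, fun _ => le_rfl⟩

lemma isCylindrical_const (c : ℝ) : IsCylindrical fun _ : B => c :=
  ⟨ℝ, inferInstance, inferInstance, inferInstance, 0, fun _ => c, contDiff_const,
    isBddLipschitz_const c, rfl⟩

lemma IsCylindrical.add {f g : B → ℝ} (hf : IsCylindrical f) (hg : IsCylindrical g) :
    IsCylindrical fun x => f x + g x := by
  obtain ⟨V, _, _, _, T, φ, hφ, hφb, rfl⟩ := hf
  obtain ⟨W, _, _, _, S, ψ, hψ, hψb, rfl⟩ := hg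
  exact ⟨V × W, inferInstance, inferInstance, inferInstance, T.prod S,
    fun p => φ p.1 + ψ p.2, (hφ.comp contDiff_fst).add (hψ.comp contDiff_snd),
    (hφb.comp LipschitzWith.prod_fst).add (hψb.comp LipschitzWith.prod_snd), rfl⟩

lemma IsCylindrical.mul {f g : B → ℝ} (hf : IsCylindrical f) (hg : IsCylindrical g) :
    IsCylindrical fun x => f x * g x := by
  obtain ⟨V, _, _, _, T, φ, hφ, hφb, rfl⟩ := hf
  obtain ⟨W, _, _, _, S, ψ, hψ, hψb, rfl⟩ := hg
  exact ⟨V × W, inferInstance, inferInstance, inferInstance, T.prod S,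
    fun p => φ p.1 * ψ p.2, (hφ.comp contDiff_fst).mul (hψ.comp contDiff_snd),
    (hφb.comp LipschitzWith.prod_fst).mul (hψb.comp LipschitzWith.prod_snd), rfl⟩

lemma IsCylindrical.const_mul {f : B → ℝ} (hf : IsCylindrical f) (c : ℝ) :
    IsCylindrical fun x => c * f x := (isCylindrical_const c).mul hf

lemma IsCylindrical.const_sub {f : B → ℝ} (hf : IsCylindrical f) (c : ℝ) :
    IsCylindrical fun x => c - f x := by
  simpa [sub_eq_add_neg] using (isCylindrical_const c).add (hf.const_mul (-1))

lemma IsCylindrical.contDiff {f : B → ℝ} (hf : IsCylindrical f) : ContDiff ℝ 1 f := by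
  obtain ⟨V, _, _, _, T, φ, hφ, hφb, rfl⟩ := hf
  exact (hφ.comp T.contDiff).of_le (by exact_mod_cast le_top)

lemma IsCylindrical.differentiable {f : B → ℝ} (hf : IsCylindrical f) : Differentiable ℝ f :=
  hf.contDiff.differentiable one_ne_zero

lemma IsCylindrical.isBddLipschitz {f : B → ℝ} (hf : IsCylindrical f) : IsBddLipschitz f := by
  obtain ⟨V, _, _, _, T, φ, hφ, hφb, rfl⟩ := hf
  exact hφb.comp T.lipschitz

lemma IsCylindrical.continuous {f : B → ℝ} (hf : IsCylindrical f) : Continuous f :=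
  hf.contDiff.continuous

lemma IsCylindrical.continuous_norm_fderiv {f : B → ℝ} (hf : IsCylindrical f) :
    Continuous fun x => ‖fderiv ℝ f x‖ :=
  (hf.contDiff.continuous_fderiv one_ne_zero).norm

/-- For `C¹` functions the mean value inequality on a small ball, where `‖df‖` barely exceeds its
value at the centre, gives one bound; a local Lipschitz constant dominates the differential, which
gives the other. -/
lemma asympSlope_eq_enorm_fderiv {f : B → ℝ} (hf : ContDiff ℝ 1 f) (x : B) :
    asympSlope f x = ‖fderiv ℝ f x‖ₑ := by
  have hd : Differentiable ℝ f := hf.differentiable one_ne_zero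
  refine le_antisymm ?_ ?_
  · refine le_of_forall_gt fun c hc => ?_
    obtain ⟨K, hK, hKc⟩ := ENNReal.lt_iff_exists_nnreal_btwn.1 hc
    have hev : ∀ᶠ y in 𝓝 x, ‖fderiv ℝ f y‖₊ < K :=
      (hf.continuous_fderiv one_ne_zero).nnnorm.continuousAt.eventually_lt_const
        (by simpa [enorm_eq_nnnorm] using hK)
    obtain ⟨r, hr, hrK⟩ := Metric.mem_nhds_iff.1 hev
    refine (asympSlope_le_of_lipschitzOnWith (Metric.ball_mem_nhds x hr) ?_).trans_lt hKc
    exact (convex_ball x r).lipschitzOnWith_of_nnnorm_fderiv_le (𝕜 := ℝ) (fun y _ => hd y)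
      fun y hy => (hrK hy).le
  · refine le_of_forall_gt fun c hc => ?_
    obtain ⟨r, hr, K, hKc, hK⟩ := asympSlope_lt_iff.1 hc
    refine lt_of_le_of_lt ?_ hKc
    have := norm_fderiv_le_of_lipschitzOn ℝ (Metric.ball_mem_nhds x hr) hK
    rw [enorm_eq_nnnorm, ENNReal.coe_le_coe]
    exact_mod_cast this

end Cylindrical

/-! ### Mollification in finite dimension -/

section Mollification

variable {E : Type*} [NormedAddCommGroup E] [NormedSpace ℝ E] [FiniteDimensional ℝ E]

/-- Mollification keeps the Lipschitz constant and the bounds of a function. -/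
lemma exists_contDiff_lipschitzWith_approx {F : E → ℝ} {L : ℝ≥0} (hF : LipschitzWith L F)
    {a b : ℝ} (hab : ∀ x, F x ∈ Set.Icc a b) {δ : ℝ} (hδ : 0 < δ) :
    ∃ g : E → ℝ, ContDiff ℝ ∞ g ∧ LipschitzWith L g ∧ (∀ x, g x ∈ Set.Icc a b) ∧
      ∀ x, |g x - F x| ≤ δ := by
  borelize E
  let μ : Measure E := Measure.addHaar
  -- On the outer radius `δ / (L + 1)` an `L`-Lipschitz function varies by at most `δ`; the `+ 1`
  -- covers `L = 0`.
  let φ : ContDiffBump (0 : E) :=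
    ⟨δ / (L + 1) / 2, δ / (L + 1), by positivity, half_lt_self (by positivity)⟩
  set g : E → ℝ := convolution (φ.normed μ) F (ContinuousLinearMap.lsmul ℝ ℝ) μ with hg
  have hgx : ∀ x, g x = ∫ t, φ.normed μ t * F (x - t) ∂μ := fun x => by
    simp [hg, convolution_def]
  have hnn : ∀ t, 0 ≤ φ.normed μ t := fun t => φ.nonneg_normed t
  have hint : ∀ x, Integrable (fun t => φ.normed μ t * F (x - t)) μ := fun x => by
    have hc : Continuous fun t => F (x - t) := hF.continuous.comp (by fun_prop)
    exact (φ.continuous_normed.mul hc).integrable_of_hasCompactSupport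
      (φ.hasCompactSupport_normed.mul_right)
  have hint1 : Integrable (φ.normed μ) μ :=
    φ.continuous_normed.integrable_of_hasCompactSupport φ.hasCompactSupport_normed
  have h1 : ∫ t, φ.normed μ t ∂μ = 1 := φ.integral_normed
  refine ⟨g, ?_, ?_, fun x => ⟨?_, ?_⟩, fun x => ?_⟩
  · exact φ.hasCompactSupport_normed.contDiff_convolution_left _ φ.contDiff_normed
      hF.continuous.locallyIntegrable
  · refine LipschitzWith.of_le_add_mul L fun x y => ?_
    have : g x ≤ ∫ t, (φ.normed μ t * F (y - t) + φ.normed μ t * (L * dist x y)) ∂μ := by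
      rw [hgx]
      refine integral_mono (hint x) ((hint y).add (hint1.mul_const _)) fun t => ?_
      dsimp only
      rw [← mul_add]
      refine mul_le_mul_of_nonneg_left ?_ (hnn t)
      simpa using hF.le_add_mul (x - t) (y - t)
    rwa [integral_add (hint y) (hint1.mul_const _), integral_mul_const, h1, one_mul,
      ← hgx] at this
  · calc a = ∫ t, φ.normed μ t * a ∂μ := by rw [integral_mul_const, h1, one_mul]
      _ ≤ g x := by
        rw [hgx]
        exact integral_mono (hint1.mul_const _) (hint x) fun t =>
          mul_le_mul_of_nonneg_left (hab _).1 (hnn t)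
  · calc
      g x ≤ ∫ t, φ.normed μ t * b ∂μ := by
        rw [hgx]
        exact integral_mono (hint x) (hint1.mul_const _) fun t =>
          mul_le_mul_of_nonneg_left (hab _).2 (hnn t)
      _ = b := by rw [integral_mul_const, h1, one_mul]
  · have := φ.dist_normed_convolution_le (μ := μ) (g := F) (x₀ := x) (ε := δ)
      hF.continuous.aestronglyMeasurable fun y hy => ?_
    · rwa [Real.dist_eq] at this
    · have hy' : dist y x ≤ δ / (L + 1) := (Metric.mem_ball.1 hy).le
      calc dist (F y) (F x) ≤ L * dist y x := hF.dist_le_mul y x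
        _ ≤ (L + 1) * (δ / (L + 1)) := by
          gcongr
          exact le_add_of_nonneg_right zero_le_one
        _ = δ := by field_simp

end Mollification

/-! ### Dominated convergence in `L^p` -/

section LpTools

variable {X : Type*} [MeasurableSpace X] {μ : Measure X} {p : ℝ≥0∞}

lemma tendsto_eLpNorm_zero_of_dominated (hp0 : p ≠ 0) (hp : p ≠ ⊤) {F : ℕ → X → ℝ} {H : X → ℝ}
    (hH : MemLp H p μ) (hF : ∀ n, AEStronglyMeasurable (F n) μ)
    (hb : ∀ n, ∀ᵐ x ∂μ, |F n x| ≤ H x)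
    (hlim : ∀ᵐ x ∂μ, Tendsto (fun n => F n x) atTop (𝓝 0)) :
    Tendsto (fun n => eLpNorm (F n) p μ) atTop (𝓝 0) := by
  have hpr : 0 < p.toReal := ENNReal.toReal_pos hp0 hp
  simp only [eLpNorm_eq_lintegral_rpow_enorm_toReal hp0 hp]
  have h0 : Tendsto (fun n => ∫⁻ x, ‖F n x‖ₑ ^ p.toReal ∂μ) atTop (𝓝 (∫⁻ _, 0 ∂μ)) := by
    refine tendsto_lintegral_of_dominated_convergence' (fun x => ‖H x‖ₑ ^ p.toReal)
      (fun n => (hF n).enorm.pow_const _) (fun n => ?_)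
      (lintegral_rpow_enorm_lt_top_of_eLpNorm_lt_top hp0 hp hH.2).ne ?_
    · filter_upwards [hb n] with x hx
      refine ENNReal.rpow_le_rpow ?_ hpr.le
      exact enorm_le_iff_norm_le.2 (hx.trans (le_abs_self _))
    · filter_upwards [hlim] with x hx
      have := ((ENNReal.continuous_rpow_const (y := p.toReal)).tendsto _).comp
        ((continuous_enorm.tendsto _).comp hx)
      simpa [ENNReal.zero_rpow_of_pos hpr, Function.comp_def] using this
  have := ((ENNReal.continuous_rpow_const (y := 1 / p.toReal)).tendsto _).comp h0
  simpa [ENNReal.zero_rpow_of_pos (inv_pos.2 hpr), Function.comp_def] using this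

end LpTools

/-! ### Cylindrical approximation with the same Lipschitz constant -/

section GlobalApprox

/-- Minimum of the first `n + 1` terms of a real sequence. -/
def runMin (c : ℕ → ℝ) : ℕ → ℝ
  | 0 => c 0
  | n + 1 => min (runMin c n) (c (n + 1))

lemma runMin_le (c : ℕ → ℝ) {j n : ℕ} (h : j ≤ n) : runMin c n ≤ c j := by
  induction n with
  | zero => obtain rfl : j = 0 := by omega
            exact le_rfl
  | succ n ih =>
    rcases Nat.of_le_succ h with h | rfl
    · exact (min_le_left _ _).trans (ih h)
    · exact min_le_right _ _

lemma le_runMin {c : ℕ → ℝ} {t : ℝ} (h : ∀ j, t ≤ c j) (n : ℕ) : t ≤ runMin c n := by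
  induction n with
  | zero => exact h 0
  | succ n ih => exact le_min ih (h _)

lemma lipschitzWith_runMin {X : Type*} [PseudoMetricSpace X] {c : ℕ → X → ℝ} {L : ℝ≥0}
    (h : ∀ j, LipschitzWith L (c j)) (n : ℕ) : LipschitzWith L fun x => runMin (fun j => c j x) n := by
  induction n with
  | zero => exact h 0
  | succ n ih => simpa [runMin] using ih.min (h (n + 1))

lemma tendsto_runMin {c : ℕ → ℕ → ℝ} {d : ℕ → ℝ}
    (h : ∀ j, Tendsto (fun k => c k j) atTop (𝓝 (d j))) (n : ℕ) :
    Tendsto (fun k => runMin (c k) n) atTop (𝓝 (runMin d n)) := by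
  induction n with
  | zero => exact h 0
  | succ n ih => exact ih.min (h _)

lemma clamp_mem {a b : ℝ} (hab : a ≤ b) (y : ℝ) : max a (min b y) ∈ Set.Icc a b :=
  ⟨le_max_left _ _, max_le hab (min_le_left _ _)⟩

lemma clamp_eq {a b y : ℝ} (hy : y ∈ Set.Icc a b) : max a (min b y) = y := by
  rw [min_eq_right hy.2, max_eq_right hy.1]

lemma abs_sub_le_of_mem {a b x y : ℝ} (hx : x ∈ Set.Icc a b) (hy : y ∈ Set.Icc a b) :
    |x - y| ≤ b - a := by
  rw [abs_le]
  constructor <;> linarith [hx.1, hx.2, hy.1, hy.2]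

/-- McShane-type extension from finitely many points `w 0, …, w n`, clamped to `[a, b]`. -/
def clampedMcShane {Y : Type*} [PseudoMetricSpace Y] (L : ℝ≥0) (a b : ℝ) (c : ℕ → ℝ) (w : ℕ → Y)
    (n : ℕ) (y : Y) : ℝ :=
  max a (min b (runMin (fun j => c j + L * dist y (w j)) n))

section McShane

variable {Y : Type*} [PseudoMetricSpace Y] {L : ℝ≥0} {a b : ℝ}

lemma clampedMcShane_mem (hab : a ≤ b) (c : ℕ → ℝ) (w : ℕ → Y) (n : ℕ) (y : Y) :
    clampedMcShane L a b c w n y ∈ Set.Icc a b := clamp_mem hab _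

lemma lipschitzWith_clampedMcShane (c : ℕ → ℝ) (w : ℕ → Y) (n : ℕ) :
    LipschitzWith L (clampedMcShane L a b c w n) := by
  refine (LipschitzWith.const_min (lipschitzWith_runMin (fun j => ?_) n) b).const_max a
  refine LipschitzWith.of_le_add_mul L fun x y => ?_
  have := mul_le_mul_of_nonneg_left (dist_triangle x y (w j)) L.coe_nonneg
  linarith

/-- Each term `u (z j) + L * dist x (z j)` is at least `u x`, and exceeds it by at most `2 * L *
dist x (z j)`, which is small for a suitable `j` by density. Clamping is harmless since `u` takes
values in `[a, b]`. -/
lemma tendsto_clampedMcShane {u : Y → ℝ} (hu : LipschitzWith L u)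
    (hab : ∀ x, u x ∈ Set.Icc a b) {z : ℕ → Y} (hz : DenseRange z) (x : Y) :
    Tendsto (fun n => clampedMcShane L a b (u ∘ z) z n x) atTop (𝓝 (u x)) := by
  have : Tendsto (fun J => runMin (fun j => u (z j) + L * dist x (z j)) J) atTop
      (𝓝 (u x)) := by
    refine tendsto_order.2 ⟨fun t ht => Eventually.of_forall fun J => ht.trans_le
      (le_runMin (fun j => hu.le_add_mul x (z j)) J), fun t ht => ?_⟩
    obtain ⟨j, hj⟩ := Metric.denseRange_iff.1 hz x
      ((t - u x) / (2 * L + 1)) (div_pos (by linarith) (by positivity))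
    filter_upwards [eventually_ge_atTop j] with J hJ
    refine (runMin_le _ hJ).trans_lt ?_
    have h1 := hu.le_add_mul (z j) x
    rw [lt_div_iff₀ (by positivity)] at hj
    rw [dist_comm] at h1
    have h : 0 ≤ dist x (z j) := dist_nonneg
    linarith
  have h2 := (tendsto_const_nhds (x := a)).max ((tendsto_const_nhds (x := b)).min this)
  rwa [clamp_eq (hab x)] at h2

end McShane

variable {B : Type*} [NormedAddCommGroup B] [NormedSpace ℝ B]
  [TopologicalSpace.SeparableSpace B]

-- Functionals norming the points of a dense sequence suffice: if `l` norms `y`, then `l x ≥ ‖x‖ - 2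
-- * ‖x - y‖`.
variable (B) in
lemma exists_norming_seq : ∃ l : ℕ → B →L[ℝ] ℝ, (∀ k, ‖l k‖ ≤ 1) ∧
    ∀ x, ∀ ε > 0, ∃ k, ‖x‖ - ε < l k x := by
  choose g hg hgx using fun x : B => exists_dual_vector'' ℝ x
  refine ⟨fun k => g (TopologicalSpace.denseSeq B k), fun k => hg _, fun x ε hε => ?_⟩
  obtain ⟨k, hk⟩ := Metric.denseRange_iff.1 (TopologicalSpace.denseRange_denseSeq B) x (ε / 2)
    (by positivity)
  refine ⟨k, ?_⟩
  set y := TopologicalSpace.denseSeq B k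
  have h1 : g y x = ‖y‖ + g y (x - y) := by
    have := hgx y
    simp only [map_sub]
    simp at this
    linarith
  have h2 : |g y (x - y)| ≤ ‖x - y‖ := by
    have := (g y).le_of_opNorm_le (hg y) (x - y)
    simpa using this
  have h3 := norm_sub_norm_le x y
  rw [dist_eq_norm] at hk
  have := (abs_le.1 h2).1
  rw [h1]
  linarith

variable [MeasurableSpace B] [BorelSpace B]

/-- A bounded Lipschitz function is a limit in `L^p(μ)` of cylindrical functions with the same
Lipschitz constant and the same bounds. -/
lemma exists_cylindrical_approx (μ : Measure B) [IsFiniteMeasure μ] {p : ℝ≥0∞} (hp1 : 1 ≤ p)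
    (hp : p ≠ ⊤) {u : B → ℝ} {L : ℝ≥0} (hu : LipschitzWith L u) {a b : ℝ}
    (hab : ∀ x, u x ∈ Set.Icc a b) {ε : ℝ≥0∞} (hε : 0 < ε) :
    ∃ v : B → ℝ, IsCylindrical v ∧ LipschitzWith L v ∧ (∀ x, v x ∈ Set.Icc a b) ∧
      eLpNorm (fun x => v x - u x) p μ ≤ ε := by
  have hp0 : p ≠ 0 := (zero_lt_one.trans_le hp1).ne'
  have hle : a ≤ b := (hab 0).1.trans (hab 0).2
  obtain ⟨l, hl1, hl⟩ := exists_norming_seq B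
  set z := TopologicalSpace.denseSeq B with hz
  -- With the sup norm on `Fin K → ℝ` these maps are contractions, and `‖T K x‖` tends to `‖x‖`
  -- because the functionals are norming.
  let T : ∀ K : ℕ, B →L[ℝ] (Fin K → ℝ) := fun K => ContinuousLinearMap.pi fun k : Fin K => l k
  have hT : ∀ K x, ‖T K x‖ ≤ ‖x‖ := fun K x =>
    (pi_norm_le_iff_of_nonneg (norm_nonneg x)).2 fun k => by
      simpa [T] using (l k).le_of_opNorm_le (hl1 k) x
  have hTlip : ∀ K, LipschitzWith 1 (T K) := fun K =>
    LipschitzWith.of_dist_le_mul fun x y => by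
      simpa [dist_eq_norm, ← map_sub] using hT K (x - y)
  have hTlim : ∀ x, Tendsto (fun K => ‖T K x‖) atTop (𝓝 ‖x‖) := fun x => by
    refine tendsto_order.2 ⟨fun t ht => ?_, fun t ht => Eventually.of_forall fun K =>
      (hT K x).trans_lt ht⟩
    obtain ⟨k, hk⟩ := hl x (‖x‖ - t) (by linarith)
    filter_upwards [eventually_gt_atTop k] with K hK
    have h1 : |l k x| ≤ ‖T K x‖ := by simpa [T] using norm_le_pi_norm (T K x) ⟨k, hK⟩
    have := le_abs_self (l k x)
    linarith
  -- The values `u (z j)` need not be compatible with the distances between the `T K (z j)`: the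
  -- formula is `L`-Lipschitz for any data, and only its limit in `K`, then in `J`, has to recover
  -- `u`.
  let F : ∀ K : ℕ, ℕ → (Fin K → ℝ) → ℝ := fun K J =>
    clampedMcShane L a b (u ∘ z) (fun j => T K (z j)) J
  let G : ℕ → B → ℝ := clampedMcShane L a b (u ∘ z) z
  have hFmem : ∀ K J y, F K J y ∈ Set.Icc a b := fun K J y => clampedMcShane_mem hle _ _ _ _
  have hGmem : ∀ J x, G J x ∈ Set.Icc a b := fun J x => clampedMcShane_mem hle _ _ _ _
  have hFlip : ∀ K J, LipschitzWith L (F K J) := fun K J => lipschitzWith_clampedMcShane _ _ _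
  have hFcont : ∀ K J, Continuous fun x => F K J (T K x) := fun K J =>
    (hFlip K J).continuous.comp (T K).continuous
  have hGcont : ∀ J, Continuous (G J) := fun J =>
    (lipschitzWith_clampedMcShane (L := L) (a := a) (b := b) (u ∘ z) z J).continuous
  have hconst : MemLp (fun _ : B => b - a) p μ := memLp_const _
  have hε3 : 0 < ε / 3 := ENNReal.div_pos hε.ne' (by simp)
  have hGlim : ∀ x, Tendsto (fun J => G J x - u x) atTop (𝓝 0) := fun x =>
    tendsto_sub_nhds_zero_iff.2
      (tendsto_clampedMcShane hu hab (TopologicalSpace.denseRange_denseSeq B) x)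
  -- The parameters are fixed in the order `J`, `K`, `δ`, each costing `ε / 3`; clamping to `[a, b]`
  -- supplies the dominating constant `b - a`.
  obtain ⟨J, hJ⟩ : ∃ J, eLpNorm (fun x => G J x - u x) p μ ≤ ε / 3 := by
    have := tendsto_eLpNorm_zero_of_dominated hp0 hp hconst
      (fun J => ((hGcont J).sub hu.continuous).aestronglyMeasurable)
      (fun J => ae_of_all _ fun x => abs_sub_le_of_mem (hGmem J x) (hab x)) (ae_of_all μ hGlim)
    exact ((this.eventually (ge_mem_nhds hε3)).exists)
  obtain ⟨K, hK⟩ : ∃ K, eLpNorm (fun x => F K J (T K x) - G J x) p μ ≤ ε / 3 := by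
    have := tendsto_eLpNorm_zero_of_dominated (F := fun K x => F K J (T K x) - G J x) hp0 hp
      hconst
      (fun K => ((hFcont K J).sub (hGcont J)).aestronglyMeasurable)
      (fun K => ae_of_all _ fun x => abs_sub_le_of_mem (hFmem K J _) (hGmem J x))
      (ae_of_all μ fun x => by
        rw [tendsto_sub_nhds_zero_iff]
        refine tendsto_const_nhds.max (tendsto_const_nhds.min (tendsto_runMin (fun j => ?_) J))
        refine (Tendsto.const_mul _ ?_).const_add _
        simpa [dist_eq_norm, ← map_sub] using hTlim (x - z j))
    exact ((this.eventually (ge_mem_nhds hε3)).exists)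
  obtain ⟨δ, hδ, hδε⟩ : ∃ δ : ℝ, 0 < δ ∧ eLpNorm (fun _ : B => δ) p μ ≤ ε / 3 := by
    have := tendsto_eLpNorm_zero_of_dominated (μ := μ) (F := fun n _ => 1 / ((n : ℝ) + 1)) hp0 hp
      (memLp_const (1 : ℝ)) (fun n => aestronglyMeasurable_const)
      (fun n => ae_of_all _ fun x : B => by
        rw [abs_of_nonneg (by positivity)]
        exact div_le_one_of_le₀ (by linarith [n.cast_nonneg (α := ℝ)]) (by positivity))
      (ae_of_all μ fun x : B => tendsto_one_div_add_atTop_nhds_zero_nat)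
    obtain ⟨n, hn⟩ := (this.eventually (ge_mem_nhds hε3)).exists
    exact ⟨_, by positivity, hn⟩
  obtain ⟨g, hgc, hgl, hgm, hgF⟩ := exists_contDiff_lipschitzWith_approx
    (hFlip K J) (hFmem K J) hδ
  have hcyl : IsCylindrical (g ∘ T K) :=
    ⟨Fin K → ℝ, inferInstance, inferInstance, inferInstance, T K, g, hgc,
      ⟨⟨L, hgl⟩, max |a| |b|, fun x => abs_le_max_abs_abs (hgm x).1 (hgm x).2⟩, rfl⟩
  refine ⟨g ∘ T K, hcyl, by simpa using hgl.comp (hTlip K), fun x => hgm _, ?_⟩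
  have hFc := hFcont K J
  have hGc := hGcont J
  have e : (fun x => (g ∘ T K) x - u x) = ((fun x => (g ∘ T K) x - F K J (T K x)) +
      fun x => F K J (T K x) - G J x) + fun x => G J x - u x := by
    ext x
    simp
  rw [e]
  refine (eLpNorm_add_le ((hcyl.continuous.sub hFc).add (hFc.sub hGc)).aestronglyMeasurable
    (hGc.sub hu.continuous).aestronglyMeasurable hp1).trans ?_
  refine (add_le_add (eLpNorm_add_le (hcyl.continuous.sub hFc).aestronglyMeasurable
    (hFc.sub hGc).aestronglyMeasurable hp1) hJ).trans ?_
  refine (add_le_add (add_le_add (le_trans (eLpNorm_mono_real fun x => hgF (T K x)) hδε) hK)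
    le_rfl).trans (le_of_eq (ENNReal.add_thirds ε))

end GlobalApprox

/-! ### Triangle inequality and almost everywhere subsequences -/

section LpTools

variable {X : Type*} [MeasurableSpace X] {μ : Measure X} {p : ℝ≥0∞}

lemma eLpNorm_le_add_of_abs_le (hp1 : 1 ≤ p) {F G₁ G₂ : X → ℝ} (h₁ : AEStronglyMeasurable G₁ μ)
    (h₂ : AEStronglyMeasurable G₂ μ) (h : ∀ᵐ x ∂μ, |F x| ≤ G₁ x + G₂ x) :
    eLpNorm F p μ ≤ eLpNorm G₁ p μ + eLpNorm G₂ p μ :=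
  (eLpNorm_mono_ae_real h).trans (eLpNorm_add_le h₁ h₂ hp1)

lemma eLpNorm_abs (F : X → ℝ) : eLpNorm (fun x => |F x|) p μ = eLpNorm F p μ := eLpNorm_norm F

lemma exists_seq_tendsto_ae_of_approx (hp0 : p ≠ 0) {P : (X → ℝ) → Prop} {g : X → ℝ}
    (hg : AEStronglyMeasurable g μ)
    (h : ∀ ε : ℝ≥0∞, 0 < ε → ∃ v, P v ∧ AEStronglyMeasurable v μ ∧
      eLpNorm (fun x => v x - g x) p μ ≤ ε) :
    ∃ u : ℕ → X → ℝ, (∀ n, P (u n)) ∧ ∀ᵐ x ∂μ, Tendsto (fun n => u n x) atTop (𝓝 (g x)) := by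
  choose v hPv hv hvg using fun n : ℕ =>
    h ((n : ℝ≥0∞) + 1)⁻¹ (ENNReal.inv_pos.2 (by simp))
  have hlim : Tendsto (fun n => eLpNorm (v n - g) p μ) atTop (𝓝 0) := by
    refine tendsto_of_tendsto_of_tendsto_of_le_of_le tendsto_const_nhds ?_ (fun _ => bot_le) hvg
    have := (tendsto_add_atTop_iff_nat 1).2 ENNReal.tendsto_inv_nat_nhds_zero
    simpa using this
  obtain ⟨ns, -, hns⟩ := (tendstoInMeasure_of_tendsto_eLpNorm hp0 hv hg hlim).exists_seq_tendsto_ae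
  exact ⟨fun n => v (ns n), fun n => hPv _, hns⟩

end LpTools

/-! ### Pre-slopes: closedness and gluing -/

section PreSlope

variable {B : Type*} [NormedAddCommGroup B] [NormedSpace ℝ B] [MeasurableSpace B]

/-- `H` is an asymptotic `L^p` upper bound for the norms of the differentials of some
cylindrical approximations of `f`. -/
def PreSlope (p : ℝ≥0∞) (μ : Measure B) (f H : B → ℝ) : Prop :=
  ∀ ε : ℝ≥0∞, 0 < ε → ∃ v : B → ℝ, IsCylindrical v ∧ eLpNorm (fun x => v x - f x) p μ ≤ ε ∧
    eLpNorm (fun x => max (‖fderiv ℝ v x‖ - H x) 0) p μ ≤ ε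

variable [BorelSpace B] {μ : Measure B} {p : ℝ≥0∞} {f H : B → ℝ}

lemma IsCylindrical.aestronglyMeasurable [TopologicalSpace.SeparableSpace B] {v : B → ℝ}
    (hv : IsCylindrical v) (μ : Measure B) : AEStronglyMeasurable v μ :=
  hv.continuous.aestronglyMeasurable

lemma IsCylindrical.aestronglyMeasurable_norm_fderiv [TopologicalSpace.SeparableSpace B]
    {v : B → ℝ} (hv : IsCylindrical v) (μ : Measure B) :
    AEStronglyMeasurable (fun x => ‖fderiv ℝ v x‖) μ :=
  hv.continuous_norm_fderiv.aestronglyMeasurable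

lemma aestronglyMeasurable_posPart_sub {G H : B → ℝ} (hG : AEStronglyMeasurable G μ)
    (hH : AEStronglyMeasurable H μ) : AEStronglyMeasurable (fun x => max (G x - H x) 0) μ :=
  (hG.sub hH).sup aestronglyMeasurable_const

variable [TopologicalSpace.SeparableSpace B]

/-- Closedness under `L^p` limits follows from `(‖dv‖ - H)⁺ ≤ (‖dv‖ - H')⁺ + (H' - H)⁺`; only the
positive part of `H' - H` has to be small. -/
lemma PreSlope.of_approx (hp1 : 1 ≤ p) (hf : AEStronglyMeasurable f μ)
    (hH : AEStronglyMeasurable H μ)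
    (h : ∀ ε : ℝ≥0∞, 0 < ε → ∃ f' H' : B → ℝ, AEStronglyMeasurable f' μ ∧
      AEStronglyMeasurable H' μ ∧ PreSlope p μ f' H' ∧ eLpNorm (fun x => f' x - f x) p μ ≤ ε ∧
      eLpNorm (fun x => max (H' x - H x) 0) p μ ≤ ε) : PreSlope p μ f H := by
  intro ε hε
  have hε2 : 0 < ε / 2 := ENNReal.half_pos hε.ne'
  obtain ⟨f', H', hf', hH', hS, h1, h2⟩ := h _ hε2
  obtain ⟨v, hv, hvf, hvH⟩ := hS _ hε2
  refine ⟨v, hv, ?_, ?_⟩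
  · rw [← ENNReal.add_halves ε]
    have e : (fun x => v x - f x) = (fun x => v x - f' x) + fun x => f' x - f x := by
      ext x
      simp
    rw [e]
    exact (eLpNorm_add_le ((hv.aestronglyMeasurable μ).sub hf') (hf'.sub hf) hp1).trans
      (add_le_add hvf h1)
  · rw [← ENNReal.add_halves ε]
    refine (eLpNorm_le_add_of_abs_le hp1 (aestronglyMeasurable_posPart_sub
      (hv.aestronglyMeasurable_norm_fderiv μ) hH') (aestronglyMeasurable_posPart_sub hH' hH)
      (ae_of_all _ fun x => ?_)).trans (add_le_add hvH h2)
    rw [abs_of_nonneg (le_max_right _ _)]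
    refine max_le ?_ (add_nonneg (le_max_right _ _) (le_max_right _ _))
    linarith [le_max_left (‖fderiv ℝ v x‖ - H' x) 0, le_max_left (H' x - H x) 0]

lemma PreSlope.of_tendsto (hp1 : 1 ≤ p) (hf : AEStronglyMeasurable f μ)
    (hH : AEStronglyMeasurable H μ) {f' H' : ℕ → B → ℝ}
    (hf' : ∀ n, AEStronglyMeasurable (f' n) μ) (hH' : ∀ n, AEStronglyMeasurable (H' n) μ)
    (hS : ∀ n, PreSlope p μ (f' n) (H' n))
    (h1 : Tendsto (fun n => eLpNorm (fun x => f' n x - f x) p μ) atTop (𝓝 0))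
    (h2 : Tendsto (fun n => eLpNorm (fun x => max (H' n x - H x) 0) p μ) atTop (𝓝 0)) :
    PreSlope p μ f H := by
  refine PreSlope.of_approx hp1 hf hH fun ε hε => ?_
  obtain ⟨n, hn1, hn2⟩ := ((h1.eventually (ge_mem_nhds hε)).and
    (h2.eventually (ge_mem_nhds hε))).exists
  exact ⟨f' n, H' n, hf' n, hH' n, hS n, hn1, hn2⟩

/-- Closedness of pre-slopes under dominated almost everywhere convergence. -/
lemma PreSlope.of_tendsto_ae (hp1 : 1 ≤ p) (hp : p ≠ ⊤) (hf : AEStronglyMeasurable f μ)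
    (hH : AEStronglyMeasurable H μ) {f' H' : ℕ → B → ℝ}
    (hf' : ∀ n, AEStronglyMeasurable (f' n) μ) (hH' : ∀ n, AEStronglyMeasurable (H' n) μ)
    (hS : ∀ n, PreSlope p μ (f' n) (H' n)) {D : B → ℝ} (hD : MemLp D p μ)
    (hbf : ∀ n, ∀ᵐ x ∂μ, |f' n x - f x| ≤ D x) (hbH : ∀ n, ∀ᵐ x ∂μ, |H' n x - H x| ≤ D x)
    (h1 : ∀ᵐ x ∂μ, Tendsto (fun n => f' n x) atTop (𝓝 (f x)))
    (h2 : ∀ᵐ x ∂μ, Tendsto (fun n => H' n x) atTop (𝓝 (H x))) :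
    PreSlope p μ f H := by
  have hp0 : p ≠ 0 := (zero_lt_one.trans_le hp1).ne'
  refine PreSlope.of_tendsto hp1 hf hH hf' hH' hS ?_ ?_
  · refine tendsto_eLpNorm_zero_of_dominated hp0 hp hD (fun n => (hf' n).sub hf) hbf ?_
    filter_upwards [h1] with x hx
    exact tendsto_sub_nhds_zero_iff.2 hx
  · refine tendsto_eLpNorm_zero_of_dominated hp0 hp hD
      (fun n => aestronglyMeasurable_posPart_sub (hH' n) hH) (fun n => ?_) ?_
    · filter_upwards [hbH n] with x hx
      rw [abs_of_nonneg (le_max_right _ _)]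
      exact (max_le (le_abs_self _) (abs_nonneg _)).trans hx
    · filter_upwards [h2] with x hx
      simpa using (tendsto_sub_nhds_zero_iff.2 hx).max (tendsto_const_nhds (x := (0 : ℝ)))

lemma PreSlope.mono (h : PreSlope p μ f H) {H' : B → ℝ} (hle : ∀ᵐ x ∂μ, H x ≤ H' x) :
    PreSlope p μ f H' := by
  intro ε hε
  obtain ⟨v, hv, h1, h2⟩ := h ε hε
  refine ⟨v, hv, h1, (eLpNorm_mono_ae_real ?_).trans h2⟩
  filter_upwards [hle] with x hx
  rw [Real.norm_of_nonneg (le_max_right _ _)]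
  exact max_le_max (by linarith) le_rfl

lemma PreSlope.congr_left (h : PreSlope p μ f H) {f' : B → ℝ} (hff : f =ᵐ[μ] f') :
    PreSlope p μ f' H := by
  intro ε hε
  obtain ⟨v, hv, h1, h2⟩ := h ε hε
  refine ⟨v, hv, le_of_eq_of_le (eLpNorm_congr_ae ?_) h1, h2⟩
  filter_upwards [hff] with x hx
  rw [hx]

/-- Since `‖dv‖ ≥ 0`, the negative part of `H` is dominated by `(‖dv‖ - H)⁺`, whose norm is
arbitrarily small. -/
lemma PreSlope.nonneg (hp1 : 1 ≤ p) (h : PreSlope p μ f H) (hH : AEStronglyMeasurable H μ) :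
    ∀ᵐ x ∂μ, 0 ≤ H x := by
  have h0 : eLpNorm (fun x => max (-H x) 0) p μ = 0 := by
    refine le_antisymm (le_of_forall_pos_le_add fun ε hε => ?_) bot_le
    obtain ⟨v, hv, -, h2⟩ := h ε hε
    rw [zero_add]
    refine (eLpNorm_mono_real fun x => ?_).trans h2
    rw [Real.norm_of_nonneg (le_max_right _ _)]
    exact max_le_max (by linarith [norm_nonneg (fderiv ℝ v x)]) le_rfl
  have hm : AEStronglyMeasurable (fun x => max (-H x) 0) μ :=
    hH.neg.sup aestronglyMeasurable_const
  rw [eLpNorm_eq_zero_iff hm (zero_lt_one.trans_le hp1).ne'] at h0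
  filter_upwards [h0] with x hx
  have := le_max_left (-H x) 0
  simp only [Pi.zero_apply] at hx
  linarith

lemma norm_fderiv_glue_le {χ v w : B → ℝ} (hχ : IsCylindrical χ) (hv : IsCylindrical v)
    (hw : IsCylindrical w) (x : B) (hx : χ x ∈ Set.Icc 0 1) :
    ‖fderiv ℝ (fun y => χ y * v y + (1 - χ y) * w y) x‖ ≤
      χ x * ‖fderiv ℝ v x‖ + (1 - χ x) * ‖fderiv ℝ w x‖ + ‖fderiv ℝ χ x‖ * |v x - w x| := by
  have h1 := (hχ.differentiable x).hasFDerivAt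
  have h2 := (hv.differentiable x).hasFDerivAt
  have h3 := (hw.differentiable x).hasFDerivAt
  have h := (h1.mul h2).add ((h1.const_sub 1).mul h3)
  have h' : HasFDerivAt (fun y => χ y * v y + (1 - χ y) * w y)
      (χ x • fderiv ℝ v x + (1 - χ x) • fderiv ℝ w x + (v x - w x) • fderiv ℝ χ x) x := by
    refine h.congr_fderiv ?_
    ext y
    simp
    ring
  rw [h'.fderiv]
  refine (norm_add_le _ _).trans (add_le_add ((norm_add_le _ _).trans (add_le_add ?_ ?_)) ?_)
  · rw [norm_smul, Real.norm_of_nonneg hx.1]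
  · rw [norm_smul, Real.norm_of_nonneg (sub_nonneg.2 hx.2)]
  · rw [norm_smul, mul_comm, Real.norm_eq_abs]

lemma abs_glue_sub_glue_le {t v₁ v₂ f₁ f₂ : ℝ} (ht : t ∈ Set.Icc (0 : ℝ) 1) :
    |t * v₁ + (1 - t) * v₂ - (t * f₁ + (1 - t) * f₂)| ≤ |v₁ - f₁| + |v₂ - f₂| := by
  have e : t * v₁ + (1 - t) * v₂ - (t * f₁ + (1 - t) * f₂) =
      t * (v₁ - f₁) + (1 - t) * (v₂ - f₂) := by ring
  rw [e]
  refine (abs_add_le _ _).trans (add_le_add ?_ ?_)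
  · rw [abs_mul, abs_of_nonneg ht.1]
    exact mul_le_of_le_one_left (abs_nonneg _) ht.2
  · rw [abs_mul, abs_of_nonneg (sub_nonneg.2 ht.2)]
    exact mul_le_of_le_one_left (abs_nonneg _) (by linarith [ht.1])

lemma posPart_glue_le {t n a₁ a₂ h₁ h₂ c C v₁ v₂ f₁ f₂ : ℝ} (ht : t ∈ Set.Icc (0 : ℝ) 1)
    (hn : n ≤ t * a₁ + (1 - t) * a₂ + c * |v₁ - v₂|) (hc : c ≤ C) (hC : 0 ≤ C) :
    max (n - (t * h₁ + (1 - t) * h₂ + C * |f₁ - f₂|)) 0 ≤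
      (max (a₁ - h₁) 0 + max (a₂ - h₂) 0) + C * (|v₁ - f₁| + |v₂ - f₂|) := by
  have j₁ := le_max_right (a₁ - h₁) 0
  have j₂ := le_max_right (a₂ - h₂) 0
  have k : |v₁ - v₂| ≤ |f₁ - f₂| + (|v₁ - f₁| + |v₂ - f₂|) := by
    have e : v₁ - v₂ = (f₁ - f₂) + ((v₁ - f₁) - (v₂ - f₂)) := by ring
    rw [e]
    exact (abs_add_le _ _).trans (add_le_add le_rfl (abs_sub _ _))
  have s₁ : c * |v₁ - v₂| ≤ C * (|f₁ - f₂| + (|v₁ - f₁| + |v₂ - f₂|)) :=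
    mul_le_mul hc k (abs_nonneg _) hC
  have s₂ : t * (a₁ - h₁) ≤ max (a₁ - h₁) 0 :=
    (mul_le_mul_of_nonneg_left (le_max_left _ _) ht.1).trans (mul_le_of_le_one_left j₁ ht.2)
  have s₃ : (1 - t) * (a₂ - h₂) ≤ max (a₂ - h₂) 0 :=
    (mul_le_mul_of_nonneg_left (le_max_left _ _) (sub_nonneg.2 ht.2)).trans
      (mul_le_of_le_one_left j₂ (by linarith [ht.1]))
  have hpos : 0 ≤ C * (|v₁ - f₁| + |v₂ - f₂|) := by positivity
  refine max_le ?_ (by linarith)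
  linarith

/-- Cylindrical approximations are glued with the same `χ`, and `d(χ v + (1 - χ) w) = χ dv + (1 - χ)
dw + (v - w) dχ`. The error term involves only `|f₁ - f₂|`, so it disappears wherever the two
functions agree. -/
lemma PreSlope.glue (hp1 : 1 ≤ p) {f₁ f₂ H₁ H₂ : B → ℝ} (hf₁ : AEStronglyMeasurable f₁ μ)
    (hf₂ : AEStronglyMeasurable f₂ μ) (hH₁ : AEStronglyMeasurable H₁ μ)
    (hH₂ : AEStronglyMeasurable H₂ μ) (h₁ : PreSlope p μ f₁ H₁) (h₂ : PreSlope p μ f₂ H₂)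
    {χ : B → ℝ} (hχ : IsCylindrical χ) (hχ01 : ∀ x, χ x ∈ Set.Icc (0 : ℝ) 1) {C : ℝ≥0}
    (hC : LipschitzWith C χ) :
    PreSlope p μ (fun x => χ x * f₁ x + (1 - χ x) * f₂ x)
      (fun x => χ x * H₁ x + (1 - χ x) * H₂ x + C * |f₁ x - f₂ x|) := by
  intro ε hε
  -- The positive parts contribute `2 * δ`, and the term with `dχ` contributes `C * (2 * δ)`.
  obtain ⟨δ, hδ, hδε⟩ : ∃ δ : ℝ≥0∞, 0 < δ ∧ (2 + C * 2) * δ ≤ ε :=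
    ⟨ε / (2 + C * 2), ENNReal.div_pos hε.ne' (by finiteness), ENNReal.mul_div_le⟩
  obtain ⟨v₁, hv₁, hvf₁, hvH₁⟩ := h₁ _ hδ
  obtain ⟨v₂, hv₂, hvf₂, hvH₂⟩ := h₂ _ hδ
  have m₁ : AEStronglyMeasurable (fun x => |v₁ x - f₁ x|) μ :=
    ((hv₁.aestronglyMeasurable μ).sub hf₁).norm
  have m₂ : AEStronglyMeasurable (fun x => |v₂ x - f₂ x|) μ :=
    ((hv₂.aestronglyMeasurable μ).sub hf₂).norm
  have hb₁ : eLpNorm (fun x => |v₁ x - f₁ x|) p μ ≤ δ := by rwa [eLpNorm_abs]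
  have hb₂ : eLpNorm (fun x => |v₂ x - f₂ x|) p μ ≤ δ := by rwa [eLpNorm_abs]
  refine ⟨fun x => χ x * v₁ x + (1 - χ x) * v₂ x,
    (hχ.mul hv₁).add ((hχ.const_sub 1).mul hv₂), ?_, ?_⟩
  · refine (eLpNorm_le_add_of_abs_le hp1 m₁ m₂
      (ae_of_all _ fun x => abs_glue_sub_glue_le (hχ01 x))).trans
      ((add_le_add hb₁ hb₂).trans (le_trans ?_ hδε))
    rw [add_mul, ← two_mul]
    exact le_self_add
  · have k₁ := aestronglyMeasurable_posPart_sub (hv₁.aestronglyMeasurable_norm_fderiv μ) hH₁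
    have k₂ := aestronglyMeasurable_posPart_sub (hv₂.aestronglyMeasurable_norm_fderiv μ) hH₂
    have hab := (eLpNorm_add_le m₁ m₂ hp1).trans (add_le_add hb₁ hb₂)
    have hk := (eLpNorm_add_le k₁ k₂ hp1).trans (add_le_add hvH₁ hvH₂)
    refine (eLpNorm_le_add_of_abs_le hp1 (k₁.add k₂) ((m₁.add m₂).const_smul (C : ℝ))
      (ae_of_all _ fun x => ?_)).trans ?_
    · rw [abs_of_nonneg (le_max_right _ _)]
      exact posPart_glue_le (hχ01 x) (norm_fderiv_glue_le hχ hv₁ hv₂ x (hχ01 x))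
        (norm_fderiv_le_of_lipschitz ℝ hC) C.coe_nonneg
    · rw [eLpNorm_const_smul, Real.enorm_eq_ofReal C.coe_nonneg, ENNReal.ofReal_coe_nnreal]
      refine (add_le_add hk (mul_le_mul_right hab _)).trans (le_trans (le_of_eq ?_) hδε)
      ring

end PreSlope

/-! ### Cylindrical cutoffs and the minimum of two pre-slopes -/

section Density

variable {B : Type*} [NormedAddCommGroup B] [NormedSpace ℝ B] [MeasurableSpace B] [BorelSpace B]
  [TopologicalSpace.SeparableSpace B] {μ : Measure B} [IsFiniteMeasure μ] {p : ℝ≥0∞}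
  {f H : B → ℝ}

/-- Cylindrical functions with values in `[0, 1]` approximate Lipschitz functions with values in
`[0, 1]` almost everywhere, without increasing the Lipschitz constant. -/
lemma exists_cylindrical_seq_ae (μ : Measure B) [IsFiniteMeasure μ] {χ : B → ℝ} {C : ℝ≥0}
    (hχ : LipschitzWith C χ) (hχ01 : ∀ x, χ x ∈ Set.Icc (0 : ℝ) 1) :
    ∃ ψ : ℕ → B → ℝ, (∀ n, IsCylindrical (ψ n) ∧ LipschitzWith C (ψ n) ∧
      ∀ x, ψ n x ∈ Set.Icc (0 : ℝ) 1) ∧ ∀ᵐ x ∂μ, Tendsto (fun n => ψ n x) atTop (𝓝 (χ x)) := by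
  refine exists_seq_tendsto_ae_of_approx (μ := μ) (p := 1)
    (P := fun v => IsCylindrical v ∧ LipschitzWith C v ∧ ∀ x, v x ∈ Set.Icc (0 : ℝ) 1) one_ne_zero
    hχ.continuous.aestronglyMeasurable fun ε hε => ?_
  obtain ⟨v, h1, h2, h3, h4⟩ := exists_cylindrical_approx μ le_rfl ENNReal.one_ne_top hχ hχ01 hε
  exact ⟨v, ⟨h1, h2, h3⟩, h1.aestronglyMeasurable μ, h4⟩

/-- Three approximations, each within `ε / 3` in `L¹`: a closed subset by inner regularity, its
thickened indicators, which are Lipschitz, and cylindrical functions close to those. -/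
lemma exists_cylindrical_seq_indicator (μ : Measure B) [IsFiniteMeasure μ] {A : Set B}
    (hA : MeasurableSet A) :
    ∃ ψ : ℕ → B → ℝ, (∀ n, IsCylindrical (ψ n) ∧ ∀ x, ψ n x ∈ Set.Icc (0 : ℝ) 1) ∧
      ∀ᵐ x ∂μ, Tendsto (fun n => ψ n x) atTop (𝓝 (A.indicator 1 x)) := by
  have hmeas : ∀ {S : Set B}, MeasurableSet S →
      AEStronglyMeasurable (S.indicator (1 : B → ℝ)) μ := fun hS =>
    (stronglyMeasurable_one.indicator hS).aestronglyMeasurable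
  refine exists_seq_tendsto_ae_of_approx (μ := μ) (p := 1)
    (P := fun v => IsCylindrical v ∧ ∀ x, v x ∈ Set.Icc (0 : ℝ) 1) one_ne_zero (hmeas hA) fun ε hε => ?_
  have hε3 : ε / 3 ≠ 0 := (ENNReal.div_pos hε.ne' (by simp)).ne'
  obtain ⟨F, hFA, hF, hFε⟩ := hA.exists_isClosed_sdiff_lt (measure_ne_top μ A) hε3
  have hδ : ∀ n : ℕ, (0 : ℝ) < 1 / (n + 1) := fun n => by positivity
  let θ : ℕ → B → ℝ := fun n x => thickenedIndicator (hδ n) F x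
  have hθlip : ∀ n : ℕ, LipschitzWith (1 / ((n : ℝ) + 1)).toNNReal⁻¹ (θ n) := fun n => by
    have h := NNReal.isometry_coe.lipschitz.comp (lipschitzWith_thickenedIndicator (hδ n) F)
    rwa [one_mul] at h
  have hθ01 : ∀ n x, θ n x ∈ Set.Icc (0 : ℝ) 1 := fun n x =>
    ⟨NNReal.coe_nonneg _, NNReal.coe_le_coe.2 (thickenedIndicator_le_one (hδ n) F x)⟩
  have hθlim : ∀ x, Tendsto (fun n => θ n x) atTop (𝓝 (F.indicator 1 x)) := fun x => by
    have h := tendsto_pi_nhds.1 (thickenedIndicator_tendsto_indicator_closure hδ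
      tendsto_one_div_add_atTop_nhds_zero_nat F) x
    rw [hF.closure_eq] at h
    have h' := (NNReal.continuous_coe.tendsto _).comp h
    have e : ((F.indicator (fun _ => (1 : ℝ≥0)) x : ℝ≥0) : ℝ) = F.indicator 1 x := by
      by_cases hx : x ∈ F <;> simp [hx]
    rwa [e] at h'
  have hlim := tendsto_eLpNorm_zero_of_dominated (μ := μ)
    (F := fun n x => θ n x - F.indicator 1 x) one_ne_zero ENNReal.one_ne_top
    (memLp_const (1 : ℝ))
    (fun n => (hθlip n).continuous.aestronglyMeasurable.sub (hmeas hF.measurableSet))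
    (fun n => ae_of_all _ fun x => by
      have h : F.indicator (1 : B → ℝ) x ∈ Set.Icc (0 : ℝ) 1 := by
        by_cases hx : x ∈ F <;> simp [hx]
      simpa using abs_sub_le_of_mem (hθ01 n x) h)
    (ae_of_all _ fun x => tendsto_sub_nhds_zero_iff.2 (hθlim x))
  obtain ⟨n, hn⟩ := (hlim.eventually (ge_mem_nhds (pos_iff_ne_zero.2 hε3))).exists
  obtain ⟨v, hv, -, hv01, hvθ⟩ := exists_cylindrical_approx μ le_rfl ENNReal.one_ne_top (hθlip n)
    (hθ01 n) (pos_iff_ne_zero.2 hε3)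
  refine ⟨v, ⟨hv, hv01⟩, hv.aestronglyMeasurable μ, ?_⟩
  have e : (fun x => v x - A.indicator 1 x) = ((fun x => v x - θ n x) +
      fun x => θ n x - F.indicator 1 x) + fun x => F.indicator 1 x - A.indicator 1 x := by
    ext x
    simp
  have m1 : AEStronglyMeasurable (fun x => v x - θ n x) μ :=
    (hv.continuous.sub (hθlip n).continuous).aestronglyMeasurable
  have m2 : AEStronglyMeasurable (fun x => θ n x - F.indicator 1 x) μ :=
    (hθlip n).continuous.aestronglyMeasurable.sub (hmeas hF.measurableSet)
  have m3 : AEStronglyMeasurable (fun x => F.indicator (1 : B → ℝ) x - A.indicator 1 x) μ :=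
    (hmeas hF.measurableSet).sub (hmeas hA)
  have h3 : eLpNorm (fun x => F.indicator (1 : B → ℝ) x - A.indicator 1 x) 1 μ ≤ ε / 3 := by
    refine le_trans (le_of_eq ?_) hFε.le
    rw [eLpNorm_one_eq_lintegral_enorm, ← lintegral_indicator_one (hA.diff hF.measurableSet)]
    refine lintegral_congr fun x => ?_
    by_cases hx : x ∈ F
    · simp [hx, hFA hx]
    · by_cases hx' : x ∈ A <;> simp [hx, hx']
  rw [e]
  exact (eLpNorm_add_le (m1.add m2) m3 le_rfl).trans ((add_le_add ((eLpNorm_add_le m1 m2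
    le_rfl).trans (add_le_add hvθ hn)) h3).trans (le_of_eq (ENNReal.add_thirds ε)))

/-- Gluing `f` with itself along `ψ n` gives the pre-slopes `ψ n * H₁ + (1 - ψ n) * H₂` without
error term. With `ψ n` tending to the indicator of `{H₁ ≤ H₂}` they converge to the minimum.
Measurable representatives `G₁`, `G₂` make this set measurable. -/
lemma PreSlope.min (hp1 : 1 ≤ p) (hp : p ≠ ⊤) (hf : AEStronglyMeasurable f μ) {H₁ H₂ : B → ℝ}
    (hH₁ : MemLp H₁ p μ) (hH₂ : MemLp H₂ p μ) (h₁ : PreSlope p μ f H₁) (h₂ : PreSlope p μ f H₂) :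
    PreSlope p μ f fun x => min (H₁ x) (H₂ x) := by
  set G₁ := hH₁.1.mk H₁
  set G₂ := hH₂.1.mk H₂
  have e₁ : H₁ =ᵐ[μ] G₁ := hH₁.1.ae_eq_mk
  have e₂ : H₂ =ᵐ[μ] G₂ := hH₂.1.ae_eq_mk
  have hA : MeasurableSet {x | G₁ x ≤ G₂ x} := measurableSet_le
    hH₁.1.stronglyMeasurable_mk.measurable hH₂.1.stronglyMeasurable_mk.measurable
  obtain ⟨ψ, hψ, hlim⟩ := exists_cylindrical_seq_indicator μ hA
  have hψm := fun n => (hψ n).1.aestronglyMeasurable μ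
  refine PreSlope.of_tendsto_ae (f' := fun _ => f)
    (H' := fun n x => ψ n x * H₁ x + (1 - ψ n x) * H₂ x) (D := fun x => |H₁ x| + |H₂ x|)
    hp1 hp hf (hH₁.1.inf hH₂.1) (fun _ => hf)
    (fun n => ((hψm n).mul hH₁.1).add ((aestronglyMeasurable_const.sub (hψm n)).mul hH₂.1))
    (fun n => ?_) (hH₁.norm.add hH₂.norm) (fun n => ae_of_all _ fun x => ?_)
    (fun n => ae_of_all _ fun x => ?_) (ae_of_all _ fun x => tendsto_const_nhds) ?_
  · obtain ⟨C, hC⟩ := (hψ n).1.isBddLipschitz.1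
    have h := PreSlope.glue hp1 hf hf hH₁.1 hH₂.1 h₁ h₂ (hψ n).1 (hψ n).2 hC
    refine (h.congr_left (ae_of_all _ fun x => ?_)).mono (ae_of_all _ fun x => ?_)
    · dsimp only
      ring
    · simp
  · rw [sub_self, abs_zero]
    positivity
  · have ht := (hψ n).2 x
    have e : ∀ m : ℝ, ψ n x * H₁ x + (1 - ψ n x) * H₂ x - m =
        ψ n x * (H₁ x - m) + (1 - ψ n x) * (H₂ x - m) := fun m => by ring
    rcases le_total (H₁ x) (H₂ x) with h | h
    · rw [min_eq_left h, e, sub_self, mul_zero, zero_add, abs_mul,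
        abs_of_nonneg (sub_nonneg.2 ht.2)]
      refine (mul_le_of_le_one_left (abs_nonneg _) (by linarith [ht.1])).trans ?_
      exact (abs_sub _ _).trans (by rw [add_comm])
    · rw [min_eq_right h, e, sub_self, mul_zero, add_zero, abs_mul, abs_of_nonneg ht.1]
      exact (mul_le_of_le_one_left (abs_nonneg _) ht.2).trans (abs_sub _ _)
  · filter_upwards [hlim, e₁, e₂] with x hx hx₁ hx₂
    have hl : Tendsto (fun n => ψ n x * H₁ x + (1 - ψ n x) * H₂ x) atTop
        (𝓝 (Set.indicator {x | G₁ x ≤ G₂ x} 1 x * H₁ x +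
          (1 - Set.indicator {x | G₁ x ≤ G₂ x} 1 x) * H₂ x)) :=
      (hx.mul_const _).add ((tendsto_const_nhds.sub hx).mul_const _)
    convert hl using 2
    by_cases h : G₁ x ≤ G₂ x
    · have h' : H₁ x ≤ H₂ x := by rwa [hx₁, hx₂]
      simp [h, h']
    · have h' : H₂ x ≤ H₁ x := by rw [hx₁, hx₂]; exact (not_le.1 h).le
      simp [h, h']

end Density

/-! ### The minimal pre-slope -/

section Minimal

variable {B : Type*} [NormedAddCommGroup B] [NormedSpace ℝ B] [MeasurableSpace B] [BorelSpace B]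
  [TopologicalSpace.SeparableSpace B] {μ : Measure B} [IsFiniteMeasure μ] {p : ℝ≥0∞}
  {f : B → ℝ}

/-- Running minima along a sequence minimizing the integral decrease to a pre-slope `G` of least
integral. For any other `H`, `min G H` is again a pre-slope, so its integral cannot be smaller,
which forces `G ≤ H` almost everywhere. -/
lemma exists_minimal_preSlope (hp1 : 1 ≤ p) (hp : p ≠ ⊤) (hf : AEStronglyMeasurable f μ)
    (hex : ∃ H, MemLp H p μ ∧ PreSlope p μ f H) :
    ∃ G, MemLp G p μ ∧ PreSlope p μ f G ∧ ∀ H, MemLp H p μ → PreSlope p μ f H →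
      ∀ᵐ x ∂μ, G x ≤ H x := by
  obtain ⟨H₀, hH₀, hS₀⟩ := hex
  let S : Set (B → ℝ) := {H | MemLp H p μ ∧ PreSlope p μ f H}
  let I : (B → ℝ) → ℝ≥0∞ := fun H => ∫⁻ x, ENNReal.ofReal (H x) ∂μ
  have hmin : ∀ {H H'}, H ∈ S → H' ∈ S → (fun x => min (H x) (H' x)) ∈ S := fun hH hH' =>
    ⟨hH.1.inf hH'.1, PreSlope.min hp1 hp hf hH.1 hH'.1 hH.2 hH'.2⟩
  have hnn : ∀ {H}, H ∈ S → ∀ᵐ x ∂μ, 0 ≤ H x := fun hH => hH.2.nonneg hp1 hH.1.1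
  obtain ⟨a, -, ha, haS⟩ := exists_seq_tendsto_sInf (S := I '' S) ⟨_, H₀, ⟨hH₀, hS₀⟩, rfl⟩
    (OrderBot.bddBelow _)
  choose h hhS hha using haS
  -- Placing `H₀` at index `0` keeps every running minimum below it, as needed for domination in
  -- `L^p`.
  let M : ℕ → B → ℝ := fun n x => runMin (fun j => if j = 0 then H₀ x else h (j - 1) x) n
  have hM0 : M 0 = H₀ := rfl
  have hMS : ∀ n, M n ∈ S := fun n => by
    induction n with
    | zero => exact ⟨hH₀, hS₀⟩
    | succ n ih => simpa [M, runMin] using hmin ih (hhS n)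
  have hMh : ∀ n x, M (n + 1) x ≤ h n x := fun n x => by
    simpa [M] using runMin_le (fun j => if j = 0 then H₀ x else h (j - 1) x) (le_refl (n + 1))
  have hMH : ∀ n x, M n x ≤ H₀ x := fun n x => by
    simpa [M] using runMin_le (fun j => if j = 0 then H₀ x else h (j - 1) x) (Nat.zero_le n)
  have hanti : ∀ x, Antitone fun n => M n x := fun x =>
    antitone_nat_of_succ_le fun n => min_le_left _ _
  have hnnM : ∀ᵐ x ∂μ, ∀ n, 0 ≤ M n x := ae_all_iff.2 fun n => hnn (hMS n)
  obtain ⟨G, hGm, hG⟩ := exists_stronglyMeasurable_limit_of_tendsto_ae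
    (fun n => (hMS n).1.1) (by
      filter_upwards [hnnM] with x hx
      exact ⟨_, tendsto_atTop_ciInf (hanti x) ⟨0, by rintro _ ⟨n, rfl⟩; exact hx n⟩⟩)
  have hG0 : ∀ᵐ x ∂μ, 0 ≤ G x := by
    filter_upwards [hnnM, hG] with x hx hx'
    exact ge_of_tendsto' hx' hx
  have hGM : ∀ᵐ x ∂μ, ∀ n, G x ≤ M n x := by
    filter_upwards [hG] with x hx n
    exact (hanti x).le_of_tendsto hx n
  have hGLp : MemLp G p μ := by
    refine hH₀.mono hGm.aestronglyMeasurable ?_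
    filter_upwards [hG0, hGM] with x h0 h1
    rw [Real.norm_of_nonneg h0]
    exact (h1 0).trans (le_abs_self _)
  have hGS : G ∈ S := by
    refine ⟨hGLp, PreSlope.of_tendsto_ae (f' := fun _ => f) (H' := M) (D := fun x => |H₀ x|)
      hp1 hp hf hGLp.1 (fun _ => hf) (fun n => (hMS n).1.1) (fun n => (hMS n).2) hH₀.norm
      (fun n => ae_of_all _ fun x => by simp) (fun n => ?_)
      (ae_of_all _ fun x => tendsto_const_nhds) hG⟩
    filter_upwards [hG0, hGM] with x h0 h1
    rw [abs_of_nonneg (sub_nonneg.2 (h1 n))]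
    linarith [hMH n x, le_abs_self (H₀ x)]
  have hIG : I G ≤ sInf (I '' S) := by
    refine ge_of_tendsto' ha fun n => ?_
    rw [← hha n]
    refine lintegral_mono_ae ?_
    filter_upwards [hGM] with x hx
    exact ENNReal.ofReal_le_ofReal ((hx (n + 1)).trans (hMh n x))
  refine ⟨G, hGLp, hGS.2, fun H hH hHS => ?_⟩
  have hm := hmin hGS ⟨hH, hHS⟩
  have hfin : I (fun x => min (G x) (H x)) ≠ ⊤ :=
    (hm.1.integrable hp1).lintegral_lt_top.ne
  have heq := ae_eq_of_ae_le_of_lintegral_le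
    (f := fun x => ENNReal.ofReal (min (G x) (H x))) (g := fun x => ENNReal.ofReal (G x))
    (ae_of_all μ fun x => ENNReal.ofReal_le_ofReal (min_le_left _ _)) hfin
    hGLp.1.aemeasurable.ennreal_ofReal (hIG.trans (sInf_le ⟨_, hm, rfl⟩))
  filter_upwards [heq, hG0, hnn hm] with x hx h0 h1
  rw [ENNReal.ofReal_eq_ofReal_iff h1 h0] at hx
  exact min_eq_left_iff.1 hx

end Minimal

/-! ### Convergence of almost minimal elements -/

section Hilbert

variable {E : Type*} [NormedAddCommGroup E] [InnerProductSpace ℝ E] [CompleteSpace E]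

/-- Elements of almost minimal norm in a decreasing sequence of midpoint convex bounded sets of
a Hilbert space converge. -/
lemma exists_tendsto_of_antitone_midpoint {D : ℕ → Set E} (hD : Antitone D)
    (hne : ∀ n, (D n).Nonempty)
    (hmid : ∀ n, ∀ x ∈ D n, ∀ y ∈ D n, (1 / 2 : ℝ) • (x + y) ∈ D n) {R : ℝ}
    (hR : ∀ n, ∀ x ∈ D n, ‖x‖ ≤ R) :
    ∃ q : ℕ → E, (∀ n, q n ∈ D n) ∧ ∃ x, Tendsto q atTop (𝓝 x) := by
  let d : ℕ → ℝ := fun n => sInf (norm '' D n)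
  have hbdd : ∀ n, BddBelow (norm '' D n) := fun n =>
    ⟨0, by rintro _ ⟨x, -, rfl⟩; exact norm_nonneg x⟩
  have hdle : ∀ n, ∀ x ∈ D n, d n ≤ ‖x‖ := fun n x hx => csInf_le (hbdd n) ⟨x, hx, rfl⟩
  have hd0 : ∀ n, 0 ≤ d n := fun n => Real.sInf_nonneg (by
    rintro _ ⟨x, -, rfl⟩; exact norm_nonneg x)
  have hdmono : Monotone d := fun n m h =>
    csInf_le_csInf (hbdd n) ((hne m).image _) (Set.image_mono (hD h))
  have hdR : ∀ n, d n ≤ R := fun n => by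
    obtain ⟨x, hx⟩ := hne n
    exact (hdle n x hx).trans (hR n x hx)
  set δ : ℝ := ⨆ n, d n
  have hbA : BddAbove (Set.range d) := ⟨R, by rintro _ ⟨n, rfl⟩; exact hdR n⟩
  have hlim : Tendsto d atTop (𝓝 δ) := tendsto_atTop_ciSup hdmono hbA
  have hle : ∀ n, d n ≤ δ := fun n => le_ciSup hbA n
  have hq : ∀ n : ℕ, ∃ x ∈ D n, ‖x‖ < d n + 1 / (n + 1) := fun n => by
    obtain ⟨_, ⟨x, hx, rfl⟩, hlt⟩ := exists_lt_of_csInf_lt ((hne n).image norm)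
      (show sInf (norm '' D n) < d n + 1 / (n + 1) from lt_add_of_pos_right _ (by positivity))
    exact ⟨x, hx, hlt⟩
  choose q hqD hqd using hq
  refine ⟨q, hqD, cauchySeq_tendsto_of_complete ?_⟩
  -- For `n, m ≥ N` the midpoint of `q n` and `q m` lies in `D N`, so its norm is at least `d N`,
  -- and the parallelogram law bounds `‖q n - q m‖²` by the expression under the root. It tends to
  -- `0` because the increasing sequence `d` converges to `δ`.
  refine cauchySeq_of_le_tendsto_0
    (fun N => √(4 * (δ + 1 / ((N : ℝ) + 1)) ^ 2 - 4 * d N ^ 2)) (fun n m N hn hm => ?_) ?_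
  · have hb : ∀ k, N ≤ k → ‖q k‖ ≤ δ + 1 / ((N : ℝ) + 1) := fun k hk =>
      (hqd k).le.trans (add_le_add (hle k) (one_div_le_one_div_of_le (by positivity)
        (by exact_mod_cast Nat.succ_le_succ hk)))
    have h1 := hdle N _ (hmid N _ (hD hn (hqD n)) _ (hD hm (hqD m)))
    rw [norm_smul, Real.norm_of_nonneg (by norm_num)] at h1
    have h2 := parallelogram_law_with_norm ℝ (q n) (q m)
    have h3 : 2 * d N ≤ ‖q n + q m‖ := by linarith
    have h4 : (2 * d N) ^ 2 ≤ ‖q n + q m‖ ^ 2 := pow_le_pow_left₀ (by linarith [hd0 N]) h3 2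
    have h5 := pow_le_pow_left₀ (norm_nonneg _) (hb n hn) 2
    have h6 := pow_le_pow_left₀ (norm_nonneg _) (hb m hm) 2
    rw [dist_eq_norm]
    refine Real.le_sqrt_of_sq_le ?_
    nlinarith
  · have h1 : Tendsto (fun N : ℕ => δ + 1 / ((N : ℝ) + 1)) atTop (𝓝 (δ + 0)) :=
      tendsto_one_div_add_atTop_nhds_zero_nat.const_add δ
    have h2 : Tendsto (fun N : ℕ => √(4 * (δ + 1 / ((N : ℝ) + 1)) ^ 2 - 4 * d N ^ 2)) atTop
        (𝓝 √(4 * (δ + 0) ^ 2 - 4 * δ ^ 2)) :=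
      (((h1.pow 2).const_mul 4).sub ((hlim.pow 2).const_mul 4)).sqrt
    simpa using h2

end Hilbert

/-! ### From the one-sided bound to strong convergence -/

section Strong

variable {B : Type*} [NormedAddCommGroup B] [NormedSpace ℝ B] [MeasurableSpace B] [BorelSpace B]
  [TopologicalSpace.SeparableSpace B] {μ : Measure B} [IsFiniteMeasure μ] {p : ℝ≥0∞}
  {f : B → ℝ}

lemma norm_fderiv_midpoint_le {v w : B → ℝ} (hv : IsCylindrical v) (hw : IsCylindrical w)
    (x : B) : ‖fderiv ℝ (fun y => (1 / 2) * v y + (1 - 1 / 2) * w y) x‖ ≤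
      (1 / 2) * ‖fderiv ℝ v x‖ + (1 - 1 / 2) * ‖fderiv ℝ w x‖ := by
  simpa using norm_fderiv_glue_le (isCylindrical_const (1 / 2)) hv hw x
    (by constructor <;> norm_num)

/-- Otherwise there are ever better approximations `v n` for which `min ‖d(v n)‖ G` misses `η` of
the integral of `G`. The functions with that deficit which bound, up to `1 / (n + 1)`, the
differential of some approximation of `f` form decreasing convex sets. Hilbert space geometry
extracts a strong limit from them: a pre-slope with integral at most `∫ G - η`, against minimality.
-/
lemma exists_lt_integral_min_of_minimal (hp1 : 1 ≤ p) (hp : p ≠ ⊤)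
    (hf : AEStronglyMeasurable f μ) {G : B → ℝ} (hG : MemLp G p μ) (hGS : PreSlope p μ f G)
    (hmin : ∀ H, MemLp H p μ → PreSlope p μ f H → ∀ᵐ x ∂μ, G x ≤ H x) {η : ℝ} (hη : 0 < η) :
    ∃ n : ℕ, ∀ v : B → ℝ, IsCylindrical v →
      eLpNorm (fun x => v x - f x) p μ ≤ ((n : ℝ≥0∞) + 1)⁻¹ →
      eLpNorm (fun x => max (‖fderiv ℝ v x‖ - G x) 0) p μ ≤ ((n : ℝ≥0∞) + 1)⁻¹ →
      ∫ x, G x ∂μ - η < ∫ x, min ‖fderiv ℝ v x‖ (G x) ∂μ := by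
  have hp0 : p ≠ 0 := (zero_lt_one.trans_le hp1).ne'
  by_contra! hcon
  choose v hv hvf hvG hvη using hcon
  have hG0 : ∀ᵐ x ∂μ, 0 ≤ G x := hGS.nonneg hp1 hG.1
  have hGint : Integrable G μ := hG.integrable hp1
  -- Dividing by this weight turns functions between `0` and `|G|` into functions bounded by `1`, so
  -- that the argument takes place in `L²(μ)` whatever `p` is.
  let w : B → ℝ := fun x => 1 + |G x|
  have hw : ∀ x, 0 < w x := fun x => by positivity
  have hwm : AEStronglyMeasurable w μ := aestronglyMeasurable_const.add hG.1.norm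
  let D : ℕ → Set (Lp ℝ 2 μ) := fun n => {q | (∀ᵐ x ∂μ, 0 ≤ q x) ∧
    (∀ᵐ x ∂μ, q x * w x ≤ |G x|) ∧ ∫ x, q x * w x ∂μ ≤ ∫ x, G x ∂μ - η ∧
    ∃ v : B → ℝ, IsCylindrical v ∧ eLpNorm (fun x => v x - f x) p μ ≤ ((n : ℝ≥0∞) + 1)⁻¹ ∧
      eLpNorm (fun x => max (‖fderiv ℝ v x‖ - q x * w x) 0) p μ ≤ ((n : ℝ≥0∞) + 1)⁻¹}
  have hqm : ∀ q : Lp ℝ 2 μ, AEStronglyMeasurable (fun x => q x * w x) μ := fun q =>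
    (Lp.aestronglyMeasurable q).mul hwm
  have hqint : ∀ n, ∀ q ∈ D n, Integrable (fun x => q x * w x) μ := fun n q hq => by
    refine hGint.mono (hqm q) ?_
    filter_upwards [hq.1, hq.2.1] with x h0 h1
    rwa [Real.norm_of_nonneg (mul_nonneg h0 (hw x).le)]
  have hanti : Antitone D := by
    rintro n m hnm q ⟨h1, h2, h3, u, hu, h4, h5⟩
    have hle : ((m : ℝ≥0∞) + 1)⁻¹ ≤ ((n : ℝ≥0∞) + 1)⁻¹ := by
      rw [ENNReal.inv_le_inv]
      gcongr
    exact ⟨h1, h2, h3, u, hu, h4.trans hle, h5.trans hle⟩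
  have hne : ∀ n, (D n).Nonempty := fun n => by
    have hk : AEStronglyMeasurable (fun x => min ‖fderiv ℝ (v n) x‖ (G x) / w x) μ :=
      ((hv n).aestronglyMeasurable_norm_fderiv μ |>.inf hG.1).div₀ hwm
    have hk2 : MemLp (fun x => min ‖fderiv ℝ (v n) x‖ (G x) / w x) 2 μ := by
      refine MemLp.of_bound hk 1 ?_
      filter_upwards [hG0] with x hx
      rw [Real.norm_of_nonneg (div_nonneg (le_min (norm_nonneg _) hx) (hw x).le),
        div_le_one (hw x)]
      exact (min_le_right _ _).trans ((le_abs_self _).trans (by simp [w]))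
    have he : ∀ᵐ x ∂μ, hk2.toLp _ x * w x = min ‖fderiv ℝ (v n) x‖ (G x) := by
      filter_upwards [hk2.coeFn_toLp] with x hx
      rw [hx, div_mul_cancel₀ _ (hw x).ne']
    refine ⟨hk2.toLp _, ?_, ?_, ?_, v n, hv n, hvf n, ?_⟩
    · filter_upwards [hk2.coeFn_toLp, hG0] with x hx h0
      rw [hx]
      exact div_nonneg (le_min (norm_nonneg _) h0) (hw x).le
    · filter_upwards [he] with x hx
      rw [hx]
      exact (min_le_right _ _).trans (le_abs_self _)
    · rw [integral_congr_ae he]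
      exact hvη n
    · refine (eLpNorm_mono_ae_real ?_).trans (hvG n)
      filter_upwards [he] with x hx
      rw [hx, Real.norm_of_nonneg (le_max_right _ _)]
      rcases le_total ‖fderiv ℝ (v n) x‖ (G x) with h | h
      · simp [h]
      · simp [h]
  -- Midpoints are admissible because the norm of the differential is convex in the function: the
  -- midpoint of the two cylindrical functions is a witness with the same tolerance.
  have hmid : ∀ n, ∀ x ∈ D n, ∀ y ∈ D n, (1 / 2 : ℝ) • (x + y) ∈ D n := by
    intro n q hq r hr
    have hqi := hqint n q hq
    have hri := hqint n r hr
    obtain ⟨q1, q2, q3, u, hu, q4, q5⟩ := hq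
    obtain ⟨r1, r2, r3, z, hz, r4, r5⟩ := hr
    have he : ∀ᵐ x ∂μ, ((1 / 2 : ℝ) • (q + r) : Lp ℝ 2 μ) x = 1 / 2 * (q x + r x) := by
      filter_upwards [Lp.coeFn_smul (1 / 2 : ℝ) (q + r), Lp.coeFn_add q r] with x h1 h2
      rw [h1, Pi.smul_apply, h2, Pi.add_apply, smul_eq_mul]
    have hew : ∀ᵐ x ∂μ, ((1 / 2 : ℝ) • (q + r) : Lp ℝ 2 μ) x * w x =
        1 / 2 * (q x * w x + r x * w x) := by
      filter_upwards [he] with x hx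
      rw [hx]
      ring
    have hhalf : ∀ ε : ℝ≥0∞, ε / 2 + ε / 2 = ε := ENNReal.add_halves
    have hsc : ∀ (F : B → ℝ) (ε : ℝ≥0∞), eLpNorm F p μ ≤ ε →
        eLpNorm ((1 / 2 : ℝ) • F) p μ ≤ ε / 2 := fun F ε h => by
      rw [eLpNorm_const_smul, ENNReal.div_eq_inv_mul]
      refine mul_le_mul' (le_of_eq ?_) h
      rw [Real.enorm_eq_ofReal (by norm_num), one_div, ENNReal.ofReal_inv_of_pos (by norm_num)]
      simp
    refine ⟨?_, ?_, ?_, fun y => (1 / 2) * u y + (1 - 1 / 2) * z y,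
      (hu.const_mul _).add (hz.const_mul _), ?_, ?_⟩
    · filter_upwards [he, q1, r1] with x h h1 h2
      rw [h]
      positivity
    · filter_upwards [hew, q2, r2] with x h h1 h2
      rw [h]
      linarith
    · rw [integral_congr_ae hew, integral_const_mul, integral_add hqi hri]
      linarith
    · rw [← hhalf ((n : ℝ≥0∞) + 1)⁻¹]
      have hu' := (hu.aestronglyMeasurable μ).sub hf
      have hz' := (hz.aestronglyMeasurable μ).sub hf
      refine le_trans (le_of_eq ?_) ((eLpNorm_add_le (hu'.const_smul (1 / 2 : ℝ))
        (hz'.const_smul (1 / 2 : ℝ)) hp1).trans (add_le_add (hsc _ _ q4) (hsc _ _ r4)))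
      congr 1
      ext x
      simp only [Pi.add_apply, Pi.smul_apply, Pi.sub_apply, smul_eq_mul]
      ring
    · rw [← hhalf ((n : ℝ≥0∞) + 1)⁻¹]
      have hu' := aestronglyMeasurable_posPart_sub (hu.aestronglyMeasurable_norm_fderiv μ) (hqm q)
      have hz' := aestronglyMeasurable_posPart_sub (hz.aestronglyMeasurable_norm_fderiv μ) (hqm r)
      refine (eLpNorm_mono_ae_real ?_).trans ((eLpNorm_add_le (hu'.const_smul (1 / 2 : ℝ))
        (hz'.const_smul (1 / 2 : ℝ)) hp1).trans (add_le_add (hsc _ _ q5) (hsc _ _ r5)))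
      filter_upwards [hew] with x hx
      rw [hx, Real.norm_of_nonneg (le_max_right _ _)]
      have := norm_fderiv_midpoint_le hu hz x
      have m1 := le_max_left (‖fderiv ℝ u x‖ - q x * w x) 0
      have m2 := le_max_left (‖fderiv ℝ z x‖ - r x * w x) 0
      have m3 := le_max_right (‖fderiv ℝ u x‖ - q x * w x) 0
      have m4 := le_max_right (‖fderiv ℝ z x‖ - r x * w x) 0
      simp only [Pi.add_apply, Pi.smul_apply, smul_eq_mul]
      refine max_le ?_ (by linarith)
      linarith
  -- The bound `R` is the `L²` norm of the constant `1`, as `0 ≤ q ≤ 1` on every `D n`.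
  obtain ⟨q, hqD, r, hr⟩ := exists_tendsto_of_antitone_midpoint (R := ((μ Set.univ).toNNReal : ℝ) ^ (2⁻¹ : ℝ))
    hanti hne hmid (fun n q hq => by
      have h := Lp.norm_le_of_ae_bound (f := q) (C := 1) zero_le_one (by
        filter_upwards [hq.1, hq.2.1] with x h0 h1
        rw [Real.norm_of_nonneg h0]
        have : q x * w x ≤ 1 * w x := h1.trans (by simp [w])
        exact le_of_mul_le_mul_right this (hw x))
      simpa [measureUnivNNReal] using h)
  obtain ⟨ns, hns, hlim⟩ := (tendstoInMeasure_of_tendsto_Lp hr).exists_seq_tendsto_ae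
  have hall : ∀ᵐ x ∂μ, ∀ n, 0 ≤ q n x ∧ q n x * w x ≤ |G x| := ae_all_iff.2 fun n => by
    filter_upwards [(hqD n).1, (hqD n).2.1] with x h1 h2
    exact ⟨h1, h2⟩
  have hkb : ∀ᵐ x ∂μ, 0 ≤ r x * w x ∧ r x * w x ≤ |G x| := by
    filter_upwards [hall, hlim] with x h1 h2
    exact ⟨mul_nonneg (ge_of_tendsto' h2 fun n => (h1 _).1) (hw x).le,
      le_of_tendsto' (h2.mul_const (w x)) fun n => (h1 _).2⟩
  have hkLp : MemLp (fun x => r x * w x) p μ := by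
    refine hG.mono (hqm r) ?_
    filter_upwards [hkb] with x hx
    rw [Real.norm_of_nonneg hx.1]
    exact hx.2
  have hLp := tendsto_eLpNorm_zero_of_dominated (F := fun n x => |q (ns n) x * w x - r x * w x|)
    hp0 hp hG.norm (fun n => ((hqm _).sub (hqm r)).norm) (fun n => by
      filter_upwards [hall, hkb] with x h1 h2
      have := h1 (ns n)
      rw [abs_abs, Real.norm_eq_abs, abs_le]
      have := mul_nonneg this.1 (hw x).le
      constructor <;> linarith) (by
      filter_upwards [hlim] with x hx
      simpa using (tendsto_sub_nhds_zero_iff.2 (hx.mul_const (w x))).abs)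
  have hinv : Tendsto (fun n : ℕ => ((ns n : ℝ≥0∞) + 1)⁻¹) atTop (𝓝 0) := by
    have h := (tendsto_add_atTop_iff_nat 1).2 ENNReal.tendsto_inv_nat_nhds_zero
    simpa [Function.comp_def] using h.comp hns.tendsto_atTop
  have hkS : PreSlope p μ f (fun x => r x * w x) := by
    intro ε hε
    have hε2 : 0 < ε / 2 := ENNReal.half_pos hε.ne'
    obtain ⟨n, hn1, hn2⟩ := ((hLp.eventually (ge_mem_nhds hε2)).and
      (hinv.eventually (ge_mem_nhds hε2))).exists
    obtain ⟨-, -, -, u, hu, h4, h5⟩ := hqD (ns n)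
    refine ⟨u, hu, h4.trans (hn2.trans ENNReal.half_le_self), ?_⟩
    rw [← ENNReal.add_halves ε]
    refine (eLpNorm_le_add_of_abs_le hp1 (aestronglyMeasurable_posPart_sub
      (hu.aestronglyMeasurable_norm_fderiv μ) (hqm _)) ((hqm (q (ns n))).sub (hqm r)).norm
      (ae_of_all _ fun x => ?_)).trans (add_le_add (h5.trans hn2) hn1)
    rw [abs_of_nonneg (le_max_right _ _)]
    have m1 := le_max_left (‖fderiv ℝ u x‖ - q (ns n) x * w x) 0
    have m2 := le_max_right (‖fderiv ℝ u x‖ - q (ns n) x * w x) 0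
    have m3 := le_abs_self (q (ns n) x * w x - r x * w x)
    simp only [Real.norm_eq_abs, Pi.sub_apply]
    exact max_le (by linarith) (add_nonneg m2 (abs_nonneg _))
  have hint : Tendsto (fun n => ∫ x, q (ns n) x * w x ∂μ) atTop (𝓝 (∫ x, r x * w x ∂μ)) := by
    refine tendsto_integral_of_dominated_convergence (fun x => |G x|) (fun n => hqm _) hGint.norm
      (fun n => ?_) ?_
    · filter_upwards [hall] with x hx
      rw [Real.norm_of_nonneg (mul_nonneg (hx _).1 (hw x).le)]
      exact (hx _).2
    · filter_upwards [hlim] with x hx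
      exact hx.mul_const _
  have h1 : ∫ x, r x * w x ∂μ ≤ ∫ x, G x ∂μ - η :=
    le_of_tendsto' hint fun n => (hqD (ns n)).2.2.1
  have h2 := integral_mono_ae hGint (hkLp.integrable hp1) (hmin _ hkLp hkS)
  linarith

/-- The minimal pre-slope is the strong limit of the norms of the differentials of cylindrical
functions. -/
lemma exists_cylindrical_tendsto_of_minimal (hp1 : 1 ≤ p) (hp : p ≠ ⊤)
    (hf : AEStronglyMeasurable f μ) {G : B → ℝ} (hG : MemLp G p μ) (hGS : PreSlope p μ f G)
    (hmin : ∀ H, MemLp H p μ → PreSlope p μ f H → ∀ᵐ x ∂μ, G x ≤ H x) :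
    ∃ u : ℕ → B → ℝ, (∀ n, IsCylindrical (u n)) ∧ TendstoLp p μ u f ∧
      TendstoLp p μ (fun n x => ‖fderiv ℝ (u n) x‖) G := by
  have hp0 : p ≠ 0 := (zero_lt_one.trans_le hp1).ne'
  have hG0 : ∀ᵐ x ∂μ, 0 ≤ G x := hGS.nonneg hp1 hG.1
  have hGint : Integrable G μ := hG.integrable hp1
  have hinv : Tendsto (fun n : ℕ => ((n : ℝ≥0∞) + 1)⁻¹) atTop (𝓝 0) := by
    simpa using (tendsto_add_atTop_iff_nat 1).2 ENNReal.tendsto_inv_nat_nhds_zero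
  have hex : ∀ j : ℕ, ∃ v : B → ℝ, IsCylindrical v ∧
      eLpNorm (fun x => v x - f x) p μ ≤ ((j : ℝ≥0∞) + 1)⁻¹ ∧
      eLpNorm (fun x => max (‖fderiv ℝ v x‖ - G x) 0) p μ ≤ ((j : ℝ≥0∞) + 1)⁻¹ ∧
      ∫ x, G x ∂μ - 1 / ((j : ℝ) + 1) < ∫ x, min ‖fderiv ℝ v x‖ (G x) ∂μ := fun j => by
    obtain ⟨n, hn⟩ := exists_lt_integral_min_of_minimal hp1 hp hf hG hGS hmin
      (show (0 : ℝ) < 1 / ((j : ℝ) + 1) by positivity)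
    obtain ⟨v, hv, h1, h2⟩ := hGS (min ((j : ℝ≥0∞) + 1)⁻¹ ((n : ℝ≥0∞) + 1)⁻¹)
      (lt_min (ENNReal.inv_pos.2 (by simp)) (ENNReal.inv_pos.2 (by simp)))
    exact ⟨v, hv, h1.trans (min_le_left _ _), h2.trans (min_le_left _ _),
      hn v hv (h1.trans (min_le_right _ _)) (h2.trans (min_le_right _ _))⟩
  choose v hv hvf hvG hvI using hex
  have hgm := fun j => (hv j).aestronglyMeasurable_norm_fderiv μ
  have hmm : ∀ j, AEStronglyMeasurable (fun x => min ‖fderiv ℝ (v j) x‖ (G x)) μ := fun j =>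
    (hgm j).inf hG.1
  have hmi : ∀ j, Integrable (fun x => min ‖fderiv ℝ (v j) x‖ (G x)) μ := fun j => by
    refine hGint.mono (hmm j) ?_
    filter_upwards [hG0] with x hx
    rw [Real.norm_of_nonneg (le_min (norm_nonneg _) hx)]
    exact (min_le_right _ _).trans (le_abs_self _)
  -- As `min ‖dv‖ G ≤ G`, convergence of the integrals is already convergence in `L¹`. Along a
  -- subsequence it holds almost everywhere, and domination by `G` lifts it to `L^p`.
  have hL1 : Tendsto (fun j => eLpNorm ((fun x => min ‖fderiv ℝ (v j) x‖ (G x)) - G) 1 μ) atTop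
      (𝓝 0) := by
    have hle : ∀ j : ℕ, eLpNorm ((fun x => min ‖fderiv ℝ (v j) x‖ (G x)) - G) 1 μ ≤
        ENNReal.ofReal (1 / ((j : ℝ) + 1)) := fun j => by
      have e : eLpNorm ((fun x => min ‖fderiv ℝ (v j) x‖ (G x)) - G) 1 μ =
          ENNReal.ofReal (∫ x, (G x - min ‖fderiv ℝ (v j) x‖ (G x)) ∂μ) := by
        have h := ofReal_integral_eq_lintegral_ofReal (hGint.sub (hmi j))
          (ae_of_all _ fun x => sub_nonneg.2 (min_le_right _ _))
        simp only [Pi.sub_apply] at h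
        rw [eLpNorm_one_eq_lintegral_enorm, h]
        refine lintegral_congr fun x => ?_
        rw [← Real.enorm_eq_ofReal (sub_nonneg.2 (min_le_right _ _)), Pi.sub_apply,
          ← enorm_neg, neg_sub]
      rw [e, integral_sub hGint (hmi j)]
      exact ENNReal.ofReal_le_ofReal (by linarith [hvI j])
    refine tendsto_of_tendsto_of_tendsto_of_le_of_le tendsto_const_nhds ?_ (fun _ => bot_le) hle
    simpa [Function.comp_def] using (ENNReal.continuous_ofReal.tendsto _).comp
      (tendsto_one_div_add_atTop_nhds_zero_nat (𝕜 := ℝ))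
  obtain ⟨ns, hns, hlim⟩ := (tendstoInMeasure_of_tendsto_eLpNorm one_ne_zero
    hmm hG.1 hL1).exists_seq_tendsto_ae
  have hinv' := hinv.comp hns.tendsto_atTop
  have hLp := tendsto_eLpNorm_zero_of_dominated
    (F := fun n x => G x - min ‖fderiv ℝ (v (ns n)) x‖ (G x)) hp0 hp hG
    (fun n => hG.1.sub (hmm _)) (fun n => by
      filter_upwards [hG0] with x hx
      rw [abs_of_nonneg (sub_nonneg.2 (min_le_right _ _))]
      linarith [le_min (norm_nonneg (fderiv ℝ (v (ns n)) x)) hx]) (by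
      filter_upwards [hlim] with x hx
      simpa using hx.const_sub (G x))
  refine ⟨fun n => v (ns n), fun n => hv _, ?_, ?_⟩
  · exact tendsto_of_tendsto_of_tendsto_of_le_of_le tendsto_const_nhds hinv' (fun _ => bot_le)
      fun n => hvf (ns n)
  · have hsum := hinv'.add hLp
    rw [add_zero] at hsum
    refine tendsto_of_tendsto_of_tendsto_of_le_of_le tendsto_const_nhds hsum (fun _ => bot_le)
      fun n => ?_
    -- The splitting is `|‖dv‖ - G| = (‖dv‖ - G)⁺ + (G - min ‖dv‖ G)`.
    refine (eLpNorm_le_add_of_abs_le hp1 (aestronglyMeasurable_posPart_sub (hgm (ns n)) hG.1)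
      (hG.1.sub (hmm (ns n))) (ae_of_all _ fun x => ?_)).trans (add_le_add (hvG _) le_rfl)
    simp only [Pi.sub_apply]
    rcases le_total ‖fderiv ℝ (v (ns n)) x‖ (G x) with h | h
    · rw [min_eq_left h, max_eq_right (sub_nonpos.2 h), abs_of_nonpos (sub_nonpos.2 h)]
      linarith
    · rw [min_eq_right h, max_eq_left (sub_nonneg.2 h), abs_of_nonneg (sub_nonneg.2 h)]
      linarith

end Strong

/-! ### Lipschitz cutoffs of balls -/

section Cutoff

variable {X : Type*} [PseudoMetricSpace X]

/-- The Lipschitz cutoff equal to `1` on the ball of radius `r` and to `0` outside the ball of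
radius `2 * r`. -/
def cutoff (x₀ : X) (r : ℝ) (x : X) : ℝ := max 0 (min 1 (2 - dist x x₀ / r))

lemma cutoff_mem (x₀ : X) (r : ℝ) (x : X) : cutoff x₀ r x ∈ Set.Icc (0 : ℝ) 1 :=
  clamp_mem zero_le_one _

lemma cutoff_eq_one {x₀ : X} {r : ℝ} (hr : 0 < r) {x : X} (hx : dist x x₀ ≤ r) :
    cutoff x₀ r x = 1 := by
  have : dist x x₀ / r ≤ 1 := (div_le_one hr).2 hx
  rw [cutoff, min_eq_left (by linarith), max_eq_right zero_le_one]

lemma cutoff_eq_zero {x₀ : X} {r : ℝ} (hr : 0 < r) {x : X} (hx : 2 * r ≤ dist x x₀) :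
    cutoff x₀ r x = 0 := by
  have : 2 ≤ dist x x₀ / r := (le_div_iff₀ hr).2 hx
  rw [cutoff, max_eq_left ((min_le_right _ _).trans (by linarith))]

lemma lipschitzWith_cutoff (x₀ : X) {r : ℝ} (hr : 0 < r) :
    LipschitzWith (1 / r).toNNReal (cutoff x₀ r) := by
  refine (LipschitzWith.const_min ?_ 1).const_max 0
  refine LipschitzWith.of_le_add_mul _ fun x y => ?_
  rw [Real.coe_toNNReal _ (by positivity)]
  have := div_le_div_of_nonneg_right (dist_triangle y x x₀) hr.le
  rw [add_div, dist_comm y x] at this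
  rw [one_div_mul_eq_div]
  linarith

end Cutoff

/-! ### The asymptotic slope as a pre-slope -/

section Lipschitz

variable {B : Type*} [NormedAddCommGroup B] [NormedSpace ℝ B] [MeasurableSpace B] [BorelSpace B]
  [TopologicalSpace.SeparableSpace B] {μ : Measure B} [IsFiniteMeasure μ] {p : ℝ≥0∞}

lemma preSlope_const_of_lipschitzWith (hp1 : 1 ≤ p) (hp : p ≠ ⊤) {u : B → ℝ} {L : ℝ≥0}
    (hu : LipschitzWith L u) {a b : ℝ} (hab : ∀ x, u x ∈ Set.Icc a b) :
    PreSlope p μ u fun _ => L := by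
  intro ε hε
  obtain ⟨v, hv, hvL, -, hvu⟩ := exists_cylindrical_approx μ hp1 hp hu hab hε
  refine ⟨v, hv, hvu, le_of_eq_of_le ?_ (zero_le (a := ε))⟩
  have : (fun x => max (‖fderiv ℝ v x‖ - L) 0) = 0 := by
    ext x
    exact max_eq_right (sub_nonpos.2 (norm_fderiv_le_of_lipschitz ℝ hvL))
  rw [this, eLpNorm_zero]

/-- A pre-slope of a bounded Lipschitz function which is adapted to its Lipschitz constant on a
given ball. -/
lemma preSlope_local (hp1 : 1 ≤ p) (hp : p ≠ ⊤) {u : B → ℝ} {L : ℝ≥0}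
    (hu : LipschitzWith L u) {a b : ℝ} (hab : ∀ x, u x ∈ Set.Icc a b) {x₀ : B} {r : ℝ}
    (hr : 0 < r) {K : ℝ≥0} (hK : LipschitzOnWith K u (Metric.ball x₀ (2 * r))) :
    ∃ H, MemLp H p μ ∧ PreSlope p μ u H ∧ ∀ x ∈ Metric.ball x₀ r, H x = K := by
  have hle : a ≤ b := (hab 0).1.trans (hab 0).2
  -- A `K`-Lipschitz extension of `u` from the large ball, clamped to the range of `u`, agrees with
  -- `u` wherever the cutoff `χ` is nonzero. Hence `χ w + (1 - χ) u = u`, while the gluing lemma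
  -- sees the constant `K` on the small ball.
  obtain ⟨g, hg, hgu⟩ := hK.extend_real
  let w : B → ℝ := fun x => max a (min b (g x))
  have hw : LipschitzWith K w := (hg.const_min b).const_max a
  have hwm : ∀ x, w x ∈ Set.Icc a b := fun x => clamp_mem hle _
  have hwu : ∀ x ∈ Metric.ball x₀ (2 * r), w x = u x := fun x hx => by
    simp only [w]
    rw [← hgu hx, clamp_eq (hab x)]
  let χ := cutoff x₀ r
  have hχ : LipschitzWith (1 / r).toNNReal χ := lipschitzWith_cutoff x₀ hr
  have hχ01 : ∀ x, χ x ∈ Set.Icc (0 : ℝ) 1 := cutoff_mem x₀ r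
  obtain ⟨ψ, hψ, hlim⟩ := exists_cylindrical_seq_ae μ hχ hχ01
  let C : ℝ≥0 := (1 / r).toNNReal
  let H : B → ℝ := fun x => χ x * K + (1 - χ x) * L + C * |w x - u x|
  have hHc : Continuous H :=
    ((hχ.continuous.mul continuous_const).add ((continuous_const.sub hχ.continuous).mul
      continuous_const)).add (continuous_const.mul (hw.continuous.sub hu.continuous).abs)
  have huv : ∀ x, |w x - u x| ≤ b - a := fun x => abs_sub_le_of_mem (hwm x) (hab x)
  have hψχ : ∀ n x, |ψ n x - χ x| ≤ 1 := fun n x => by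
    simpa using abs_sub_le_of_mem ((hψ n).2.2 x) (hχ01 x)
  refine ⟨H, MemLp.of_bound hHc.aestronglyMeasurable (K + L + C * (b - a)) (ae_of_all _ fun x => ?_),
    ?_, fun x hx => ?_⟩
  · have h0 := (hχ01 x).1
    have h1 := (hχ01 x).2
    have hK0 := K.coe_nonneg
    have hL0 := L.coe_nonneg
    have hpos : 0 ≤ H x := by
      have := mul_nonneg (sub_nonneg.2 h1) hL0
      positivity
    rw [Real.norm_of_nonneg hpos]
    refine add_le_add (add_le_add (mul_le_of_le_one_left hK0 h1)
      (mul_le_of_le_one_left hL0 (by linarith))) (mul_le_mul_of_nonneg_left (huv x) C.coe_nonneg)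
  -- Gluing requires a cylindrical cutoff, which `χ` is not; it is applied to the approximations `ψ
  -- n`, with the same Lipschitz bound `C`, and then passed to the limit.
  · refine PreSlope.of_tendsto_ae (f' := fun n x => ψ n x * w x + (1 - ψ n x) * u x)
      (H' := fun n x => ψ n x * K + (1 - ψ n x) * L + C * |w x - u x|)
      (D := fun _ => (b - a) + (K + L)) hp1 hp hu.continuous.aestronglyMeasurable
      hHc.aestronglyMeasurable (fun n => ?_) (fun n => ?_) (fun n => ?_) (memLp_const _)
      (fun n => ae_of_all _ fun x => ?_) (fun n => ae_of_all _ fun x => ?_) ?_ ?_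
    · have := (hψ n).1.continuous
      exact ((this.mul hw.continuous).add ((continuous_const.sub this).mul
        hu.continuous)).aestronglyMeasurable
    · have := (hψ n).1.continuous
      exact (((this.mul continuous_const).add ((continuous_const.sub this).mul
        continuous_const)).add (continuous_const.mul
          (hw.continuous.sub hu.continuous).abs)).aestronglyMeasurable
    · exact PreSlope.glue hp1 hw.continuous.aestronglyMeasurable
        hu.continuous.aestronglyMeasurable aestronglyMeasurable_const aestronglyMeasurable_const
        (preSlope_const_of_lipschitzWith hp1 hp hw hwm)
        (preSlope_const_of_lipschitzWith hp1 hp hu hab) (hψ n).1 (hψ n).2.2 (hψ n).2.1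
    · have e : ψ n x * w x + (1 - ψ n x) * u x - u x = ψ n x * (w x - u x) := by ring
      rw [e, abs_mul, abs_of_nonneg ((hψ n).2.2 x).1]
      have := mul_le_of_le_one_left (abs_nonneg (w x - u x)) ((hψ n).2.2 x).2
      linarith [huv x, K.coe_nonneg, L.coe_nonneg]
    · have e : ψ n x * K + (1 - ψ n x) * L + C * |w x - u x| - H x =
          (ψ n x - χ x) * (K - L) := by
        simp only [H]
        ring
      rw [e, abs_mul]
      have h1 := mul_le_of_le_one_left (abs_nonneg ((K : ℝ) - L)) (hψχ n x)
      have h2 := abs_sub (K : ℝ) L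
      rw [abs_of_nonneg K.coe_nonneg, abs_of_nonneg L.coe_nonneg] at h2
      linarith
    · filter_upwards [hlim] with x hx
      have h := (hx.mul_const (w x)).add ((hx.const_sub 1).mul_const (u x))
      convert h using 2
      rcases lt_or_ge (dist x x₀) (2 * r) with h' | h'
      · rw [hwu x h']
        ring
      · rw [show χ x = 0 from cutoff_eq_zero hr h']
        ring
    · filter_upwards [hlim] with x hx
      exact ((hx.mul_const (K : ℝ)).add ((hx.const_sub 1).mul_const (L : ℝ))).add_const _
  · have hx' : dist x x₀ < r := hx
    simp only [H, χ, cutoff_eq_one hr hx'.le,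
      hwu x (Metric.ball_subset_ball (by linarith) hx), sub_self, abs_zero]
    ring

/-- The asymptotic slope of a bounded Lipschitz function is a pre-slope. -/
lemma IsBddLipschitz.preSlope (hp1 : 1 ≤ p) (hp : p ≠ ⊤) {u : B → ℝ} (hu : IsBddLipschitz u) :
    PreSlope p μ u fun x => (asympSlope u x).toReal := by
  obtain ⟨⟨L, hL⟩, C, hC⟩ := hu
  have hab : ∀ x, u x ∈ Set.Icc (-C) C := fun x => abs_le.1 (hC x)
  have hum : AEStronglyMeasurable u μ := hL.continuous.aestronglyMeasurable
  obtain ⟨G, hG, hGS, hmin⟩ := exists_minimal_preSlope hp1 hp hum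
    ⟨_, memLp_const _, preSlope_const_of_lipschitzWith hp1 hp hL hab⟩
  refine hGS.mono ?_
  -- If the slope at `x` is below `q`, then `u` is `K`-Lipschitz on a ball with `K < q`. The adapted
  -- pre-slope equals `K` on half that ball, so minimality gives `G ≤ K` almost everywhere there.
  -- The exceptional set is thus locally null, hence null by separability.
  have hq : ∀ᵐ x ∂μ, ∀ q : ℚ, asympSlope u x < ENNReal.ofReal q → G x ≤ q := by
    refine ae_all_iff.2 fun q => ?_
    rw [ae_iff]
    refine measure_null_of_locally_null _ fun x hx => ?_
    simp only [Set.mem_ofPred_eq, Classical.not_imp, not_le] at hx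
    obtain ⟨r, hr, K, hKq, hK⟩ := asympSlope_lt_iff.1 hx.1
    have hr2 : 0 < r / 2 := half_pos hr
    obtain ⟨H, hH, hHS, hHK⟩ := preSlope_local (μ := μ) hp1 hp hL hab hr2
      (show LipschitzOnWith K u (Metric.ball x (2 * (r / 2))) by
        rwa [mul_div_cancel₀ r two_ne_zero])
    refine ⟨Metric.ball x (r / 2) ∩ {y | ¬(asympSlope u y < ENNReal.ofReal q → G y ≤ q)},
      inter_mem (mem_nhdsWithin_of_mem_nhds (Metric.ball_mem_nhds x hr2)) self_mem_nhdsWithin, ?_⟩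
    refine measure_mono_null ?_ (ae_iff.1 (hmin H hH hHS))
    rintro y ⟨hy, hy'⟩
    simp only [Set.mem_ofPred_eq, Classical.not_imp, not_le] at hy' ⊢
    rw [hHK y hy]
    refine lt_of_le_of_lt ?_ hy'.2
    have h := ENNReal.toReal_mono ENNReal.ofReal_ne_top hKq.le
    rcases le_or_gt 0 (q : ℝ) with h0 | h0
    · simpa [ENNReal.toReal_ofReal h0] using h
    · rw [ENNReal.ofReal_of_nonpos h0.le] at hKq
      simp at hKq
  filter_upwards [hq] with x hx
  by_contra! hlt
  obtain ⟨q, hq1, hq2⟩ := exists_rat_btwn hlt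
  have hfin : asympSlope u x ≠ ⊤ :=
    ((asympSlope_le_of_lipschitzWith hL x).trans_lt ENNReal.coe_lt_top).ne
  exact absurd (hx q ((ENNReal.lt_ofReal_iff_toReal_lt hfin).2 hq1)) (not_le.2 hq2)

end Lipschitz

/-! ### The Sobolev case -/

section Sobolev

variable {B : Type*} [NormedAddCommGroup B] [NormedSpace ℝ B] [MeasurableSpace B] [BorelSpace B]
  [TopologicalSpace.SeparableSpace B] {μ : Measure B} [IsFiniteMeasure μ] {p : ℝ≥0∞}
  {f : B → ℝ}

lemma aestronglyMeasurable_asympSlope (u : B → ℝ) :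
    AEStronglyMeasurable (fun x => (asympSlope u x).toReal) μ :=
  (measurable_asympSlope u).ennreal_toReal.aestronglyMeasurable

lemma IsRelaxedSlope.preSlope (hp1 : 1 ≤ p) (hp : p ≠ ⊤) (hf : AEStronglyMeasurable f μ)
    {G : B → ℝ} (hG : IsRelaxedSlope p μ f G) : PreSlope p μ f G := by
  obtain ⟨hGp, -, u, hu, hu1, hu2⟩ := hG
  refine PreSlope.of_tendsto hp1 hf hGp.1 (f' := u)
    (H' := fun n x => (asympSlope (u n) x).toReal) (fun n => ?_)
    (fun n => aestronglyMeasurable_asympSlope _) (fun n => (hu n).preSlope hp1 hp) hu1 ?_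
  · obtain ⟨⟨L, hL⟩, -⟩ := hu n
    exact hL.continuous.aestronglyMeasurable
  · refine tendsto_of_tendsto_of_tendsto_of_le_of_le tendsto_const_nhds hu2 (fun _ => bot_le)
      fun n => eLpNorm_mono fun x => ?_
    rw [Real.norm_of_nonneg (le_max_right _ _)]
    exact max_le (le_abs_self _) (abs_nonneg _)

lemma toReal_asympSlope_eq_norm_fderiv {v : B → ℝ} (hv : IsCylindrical v) (x : B) :
    (asympSlope v x).toReal = ‖fderiv ℝ v x‖ := by
  rw [asympSlope_eq_enorm_fderiv hv.contDiff, toReal_enorm]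

/-- Existence of the minimal relaxed slope and density in energy of cylindrical functions. -/
theorem MemSobolev.density_in_energy (hp1 : 1 ≤ p) (hp : p ≠ ⊤) (hf : MemSobolev p μ f) :
    (∃ G : B → ℝ, IsMinimalRelaxedSlope p μ f G) ∧
      ∀ G : B → ℝ, IsMinimalRelaxedSlope p μ f G →
        ∃ u : ℕ → B → ℝ, (∀ n, IsCylindrical (u n)) ∧ TendstoLp p μ u f ∧
          TendstoLp p μ (fun n x => ‖fderiv ℝ (u n) x‖) G := by
  obtain ⟨hfp, G₀, hG₀⟩ := hf
  obtain ⟨G, hG, hGS, hmin⟩ := exists_minimal_preSlope hp1 hp hfp.1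
    ⟨G₀, hG₀.1, hG₀.preSlope hp1 hp hfp.1⟩
  obtain ⟨u, hu, huf, huG⟩ := exists_cylindrical_tendsto_of_minimal hp1 hp hfp.1 hG hGS hmin
  -- The strong approximations are themselves bounded Lipschitz functions whose asymptotic slope is
  -- `‖dv‖`, so the minimal pre-slope is a relaxed slope.
  have hrel : IsRelaxedSlope p μ f G := by
    refine ⟨hG, hGS.nonneg hp1 hG.1, u, fun n => (hu n).isBddLipschitz, huf, ?_⟩
    simpa only [TendstoLp, toReal_asympSlope_eq_norm_fderiv (hu _)] using huG
  have hle : ∀ G', IsRelaxedSlope p μ f G' → ∀ᵐ x ∂μ, G x ≤ G' x := fun G' hG' =>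
    hmin G' hG'.1 (hG'.preSlope hp1 hp hfp.1)
  refine ⟨⟨G, hrel, hle⟩, fun G' hG' => ⟨u, hu, huf, ?_⟩⟩
  have heq : G =ᵐ[μ] G' := by
    filter_upwards [hle G' hG'.1, hG'.2 G hrel] with x h1 h2
    exact le_antisymm h1 h2
  refine huG.congr fun n => eLpNorm_congr_ae ?_
  filter_upwards [heq] with x hx
  rw [hx]

end Sobolev

/-! ### Cutoffs adapted to a locally Lipschitz function -/

section CompactExhaustion

variable {X : Type*} [PseudoMetricSpace X] [CompleteSpace X]

/-- Near sets which are asymptotically close to compact sets, locally Lipschitz functions are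
uniformly Lipschitz at small scales. -/
lemma exists_uniform_lipschitz {w : X → ℝ} (hw : LocallyLipschitz w) {K : ℕ → Set X}
    (hK : ∀ m, IsCompact (K m)) (hne : ∀ m, (K m).Nonempty) {s : ℕ → ℝ}
    (hs : Tendsto s atTop (𝓝 0)) :
    ∃ N : ℕ, ∃ η > 0, ∃ L : ℝ, 0 ≤ L ∧ ∀ x, (∀ m < N, Metric.infDist x (K m) ≤ s m) →
      ∀ y, dist x y < η → |w x - w y| ≤ L * dist x y := by
  by_contra! hcon
  -- The counterexample `x n` lies within `s m` of `K m` for all `m ≤ n`, so the sequence is totally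
  -- bounded. Near a cluster point `w` is Lipschitz, which contradicts difference quotients
  -- exceeding `n + 1`.
  choose x hx y hy hxy using fun n : ℕ =>
    hcon n (1 / ((n : ℝ) + 1)) (by positivity) (n + 1) (by positivity)
  have htb : TotallyBounded (Set.range x) := by
    rw [Metric.totallyBounded_iff]
    intro ε hε
    obtain ⟨m, hm⟩ := (hs.eventually_lt_const (half_pos hε)).exists
    obtain ⟨t, ht, htK⟩ := Metric.totallyBounded_iff.1 (hK m).totallyBounded (ε / 2) (half_pos hε)
    refine ⟨t ∪ x '' {n | n ≤ m}, ht.union ((Set.finite_le_nat m).image x), ?_⟩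
    rintro _ ⟨n, rfl⟩
    rw [Set.mem_iUnion₂]
    rcases le_or_gt n m with h | h
    · exact ⟨x n, Or.inr ⟨n, h, rfl⟩, Metric.mem_ball_self hε⟩
    · obtain ⟨k, hk, hxk⟩ := (Metric.infDist_lt_iff (hne m)).1 ((hx n m h).trans_lt hm)
      obtain ⟨z, hz, hkz⟩ := Set.mem_iUnion₂.1 (htK hk)
      refine ⟨z, Or.inl hz, Metric.mem_ball.2 ?_⟩
      have := Metric.mem_ball.1 hkz
      linarith [dist_triangle (x n) k z]
  have hcomp : IsCompact (closure (Set.range x)) :=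
    isCompact_iff_totallyBounded_isComplete.2 ⟨htb.closure, isClosed_closure.isComplete⟩
  obtain ⟨z, -, φ, hφ, hlim⟩ := hcomp.tendsto_subseq fun n => subset_closure (Set.mem_range_self n)
  have hdist : Tendsto (fun n => dist (x (φ n)) (y (φ n))) atTop (𝓝 0) :=
    squeeze_zero (fun _ => dist_nonneg) (fun n => (hy (φ n)).le)
      (tendsto_one_div_add_atTop_nhds_zero_nat.comp hφ.tendsto_atTop)
  have hlim' : Tendsto (fun n => y (φ n)) atTop (𝓝 z) :=
    (tendsto_iff_of_dist hdist).1 hlim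
  obtain ⟨C, t, ht, hC⟩ := hw z
  obtain ⟨k, hk⟩ := exists_nat_ge (C : ℝ)
  obtain ⟨n, hn1, hn2, hn3⟩ := ((hlim.eventually ht).and ((hlim'.eventually ht).and
    (hφ.tendsto_atTop.eventually_ge_atTop k))).exists
  have h1 := hC.dist_le_mul _ hn1 _ hn2
  have h2 := hxy (φ n)
  rw [Real.dist_eq] at h1
  have h3 : (k : ℝ) ≤ φ n := by exact_mod_cast hn3
  have h4 : (C : ℝ) * dist (x (φ n)) (y (φ n)) ≤ ((φ n : ℝ) + 1) * dist (x (φ n)) (y (φ n)) :=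
    mul_le_mul_of_nonneg_right (by linarith) dist_nonneg
  exact absurd (h1.trans h4) (not_le.2 h2)

/-- For points closer than `η` the product rule applies, based at a point where `θ` does not vanish;
at larger distances the trivial bound `2 * M` is at most `2 * M / η` times the distance. -/
lemma lipschitzWith_mul_of_support {θ w : X → ℝ} {A : ℝ≥0} (hθ : LipschitzWith A θ)
    (hθ01 : ∀ x, θ x ∈ Set.Icc (0 : ℝ) 1) {M : ℝ} (hM : ∀ x, |w x| ≤ M) {L η : ℝ} (hL : 0 ≤ L)
    (hη : 0 < η)
    (h : ∀ x, θ x ≠ 0 → ∀ y, dist x y < η → |w x - w y| ≤ L * dist x y) :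
    ∃ C, LipschitzWith C fun x => θ x * w x := by
  have key : ∀ x, θ x ≠ 0 → ∀ y,
      |θ x * w x - θ y * w y| ≤ (A * M + L + 2 * M / η) * dist x y := by
    intro x hx y
    have hM0 : 0 ≤ M := (abs_nonneg _).trans (hM x)
    have hd : 0 ≤ dist x y := dist_nonneg
    rcases lt_or_ge (dist x y) η with hxy | hxy
    · have e : θ x * w x - θ y * w y = (θ x - θ y) * w y + θ x * (w x - w y) := by ring
      rw [e]
      have h1 : |θ x - θ y| ≤ A * dist x y := hθ.dist_le_mul x y
      have h2 := h x hx y hxy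
      have h3 : |(θ x - θ y) * w y| ≤ A * dist x y * M := by
        rw [abs_mul]
        exact mul_le_mul h1 (hM y) (abs_nonneg _) (by positivity)
      have h4 : |θ x * (w x - w y)| ≤ L * dist x y := by
        rw [abs_mul, abs_of_nonneg (hθ01 x).1]
        exact (mul_le_of_le_one_left (abs_nonneg _) (hθ01 x).2).trans h2
      have h5 : 0 ≤ 2 * M / η * dist x y := by positivity
      refine (abs_add_le _ _).trans ?_
      linarith
    · have hb : ∀ z, |θ z * w z| ≤ M := fun z => by
        rw [abs_mul, abs_of_nonneg (hθ01 z).1]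
        exact (mul_le_of_le_one_left (abs_nonneg _) (hθ01 z).2).trans (hM z)
      have h1 : |θ x * w x - θ y * w y| ≤ 2 * M :=
        (abs_sub _ _).trans (by linarith [hb x, hb y])
      have h2 : 2 * M ≤ 2 * M / η * dist x y := by
        rw [div_mul_eq_mul_div, le_div_iff₀ hη]
        exact mul_le_mul_of_nonneg_left hxy (by positivity)
      have h3 : 0 ≤ A * M * dist x y := by positivity
      have h4 : 0 ≤ L * dist x y := by positivity
      linarith
  refine ⟨_, LipschitzWith.of_dist_le' (K := A * M + L + 2 * M / η) fun x y => ?_⟩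
  rw [Real.dist_eq]
  by_cases hx : θ x = 0
  · by_cases hy : θ y = 0
    · have hM0 : 0 ≤ M := (abs_nonneg _).trans (hM x)
      rw [hx, hy, zero_mul, zero_mul, sub_self, abs_zero]
      positivity
    · rw [abs_sub_comm, dist_comm]
      exact key y hy x
  · exact key x hx y

variable [MeasurableSpace X] [BorelSpace X] [SecondCountableTopology X] [Nonempty X]

/-- An exhaustion of the space by Lipschitz cutoffs of small energy, adapted to a bounded locally
Lipschitz function. -/
lemma exists_cutoff_seq (μ : Measure X) [IsFiniteMeasure μ] {w : X → ℝ} (hw : LocallyLipschitz w)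
    {M : ℝ} (hM : ∀ x, |w x| ≤ M) :
    ∃ (θ : ℕ → X → ℝ) (g : X → ℝ≥0∞), Measurable g ∧ ∫⁻ x, g x ∂μ ≠ ⊤ ∧
      (∀ n x, θ n x ∈ Set.Icc (0 : ℝ) 1) ∧ (∀ n, ∃ A, LipschitzWith A (θ n)) ∧
      (∀ n, ∃ C, LipschitzWith C fun x => θ n x * w x) ∧
      (∀ n x, asympSlope (θ n) x ≤ ENNReal.ofReal (1 / ((n : ℝ) + 1)) * g x) ∧
      ∀ᵐ x ∂μ, Tendsto (fun n => θ n x) atTop (𝓝 1) := by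
  have htight := isTightMeasureSet_iff_exists_isCompact_measure_compl_le.1
    (isTightMeasureSet_singleton (μ := μ))
  choose K₀ hK₀ hK₀μ using fun m : ℕ => htight ((1 / 4) ^ m) (by
    exact ENNReal.pow_pos (by simp) m)
  obtain ⟨z⟩ := ‹Nonempty X›
  -- The unions make the compact sets increasing; the extra point keeps them nonempty, since
  -- `Metric.infDist` to the empty set is `0` by convention.
  let K : ℕ → Set X := fun m => {z} ∪ ⋃ i ∈ Finset.range (m + 1), K₀ i
  have hK : ∀ m, IsCompact (K m) := fun m =>
    isCompact_singleton.union ((Finset.range (m + 1)).isCompact_biUnion fun i _ => hK₀ i)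
  have hne : ∀ m, (K m).Nonempty := fun m => ⟨z, Or.inl rfl⟩
  have hmono : Monotone K := fun m n hmn => Set.union_subset_union_right _
    (Set.iUnion₂_subset fun i hi => Set.subset_iUnion₂_of_subset i
      (Finset.range_mono (by omega) hi) le_rfl)
  have hKμ : ∀ m, μ (K m)ᶜ ≤ (1 / 4) ^ m := fun m =>
    (measure_mono (Set.compl_subset_compl.2 ((Set.subset_biUnion_of_mem
      (u := fun i => K₀ i) (Finset.mem_coe.2 (Finset.self_mem_range_succ m))).trans
        Set.subset_union_right))).trans (hK₀μ m μ rfl)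
  let τ : ℕ → X → ℝ := fun m x => 2 ^ m * max (Metric.infDist x (K m) - (1 / 2) ^ m) 0
  have hτ0 : ∀ m x, 0 ≤ τ m x := fun m x => by
    have := le_max_right (Metric.infDist x (K m) - (1 / 2) ^ m) 0
    positivity
  have hτlip : ∀ m, LipschitzWith (2 ^ m) (τ m) := fun m => by
    refine LipschitzWith.of_le_add_mul _ fun x y => ?_
    have h1 := Metric.infDist_le_infDist_add_dist (s := K m) (x := x) (y := y)
    simp only [τ]
    push_cast
    rw [← mul_add]
    refine mul_le_mul_of_nonneg_left (max_le ?_ ?_) (by positivity)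
    · linarith [le_max_left (Metric.infDist y (K m) - (1 / 2) ^ m) 0]
    · linarith [le_max_right (Metric.infDist y (K m) - (1 / 2) ^ m) 0, dist_nonneg (x := x) (y := y)]
  let S : ℕ → Set X := fun m => {x | (1 / 2 : ℝ) ^ m ≤ Metric.infDist x (K m)}
  have hSm : ∀ m, MeasurableSet (S m) := fun m =>
    measurableSet_le measurable_const (Metric.continuous_infDist_pt _).measurable
  -- The slope of `τ m` is at most `2 ^ m` and lives on `S m`, which misses `K m` and so has measure
  -- at most `4⁻ᵐ`. The sum is therefore integrable and bounds the slopes of all partial sums `ρ N`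
  -- at once.
  let g : X → ℝ≥0∞ := fun x => ∑' m, (S m).indicator (fun _ => (2 : ℝ≥0∞) ^ m) x
  have hgm : Measurable g := Measurable.tsum fun m => measurable_const.indicator (hSm m)
  have hτslope : ∀ m x, asympSlope (τ m) x ≤ (S m).indicator (fun _ => (2 : ℝ≥0∞) ^ m) x := by
    intro m x
    by_cases hx : x ∈ S m
    · rw [Set.indicator_of_mem hx]
      exact_mod_cast asympSlope_le_of_lipschitzWith (hτlip m) x
    · rw [Set.indicator_of_notMem hx]
      refine (asympSlope_eq_zero_of_eventually (c := 0) ?_).le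
      have hx' : Metric.infDist x (K m) < (1 / 2) ^ m := not_le.1 hx
      filter_upwards [(Metric.continuous_infDist_pt (K m)).continuousAt.eventually_lt_const hx']
        with y hy
      simp only [τ]
      rw [max_eq_right (by linarith), mul_zero]
  have hgint : ∫⁻ x, g x ∂μ ≠ ⊤ := by
    have h1 : ∫⁻ x, g x ∂μ = ∑' m, 2 ^ m * μ (S m) := by
      rw [lintegral_tsum fun m => (measurable_const.indicator (hSm m)).aemeasurable]
      congr 1
      ext m
      rw [lintegral_indicator_const (hSm m)]
    have h2 : ∀ m, 2 ^ m * μ (S m) ≤ (2⁻¹ : ℝ≥0∞) ^ m := fun m => by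
      have h3 : μ (S m) ≤ (1 / 4) ^ m := by
        refine (measure_mono fun x hx hxK => ?_).trans (hKμ m)
        have hx' : (1 / 2 : ℝ) ^ m ≤ Metric.infDist x (K m) := hx
        rw [Metric.infDist_zero_of_mem hxK] at hx'
        exact absurd hx' (not_le.2 (by positivity))
      refine (mul_le_mul_right h3 _).trans (le_of_eq ?_)
      rw [← mul_pow]
      congr 1
      rw [one_div, show (4 : ℝ≥0∞) = 2 * 2 by norm_num, ENNReal.mul_inv (by simp) (by simp),
        ← mul_assoc, ENNReal.mul_inv_cancel (by simp) (by simp), one_mul]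
    rw [h1]
    refine ((ENNReal.tsum_le_tsum h2).trans_lt ?_).ne
    rw [ENNReal.tsum_geometric]
    simp
  let ρ : ℕ → X → ℝ := fun N x => ∑ m ∈ Finset.range N, τ m x
  have hρ0 : ∀ N x, 0 ≤ ρ N x := fun N x => Finset.sum_nonneg fun m _ => hτ0 m x
  have hρslope : ∀ N x, asympSlope (ρ N) x ≤ g x := fun N x =>
    (asympSlope_sum_le _ _ x).trans ((Finset.sum_le_sum fun m _ => hτslope m x).trans
      (ENNReal.sum_le_tsum _))
  have hρlip : ∀ N, ∃ A : ℝ≥0, LipschitzWith A (ρ N) := fun N => by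
    induction N with
    | zero => exact ⟨0, by simpa only [ρ, Finset.range_zero, Finset.sum_empty] using LipschitzWith.const (α := X) (0 : ℝ)⟩
    | succ N ih =>
      obtain ⟨A, hA⟩ := ih
      exact ⟨A + 2 ^ N, by simpa [ρ, Finset.sum_range_succ] using hA.add (hτlip N)⟩
  -- Where the `n`-th cutoff is nonzero, `τ m < n + 1` for every `m` in the sum, that is, the
  -- distance to `K m` is below `(n + 2) * 2⁻ᵐ`. These radii tend to `0`, and compactness then fixes
  -- the number `N n` of terms.
  have hs : ∀ n : ℕ, Tendsto (fun m : ℕ => ((n : ℝ) + 1 + 1) * (1 / 2 : ℝ) ^ m) atTop (𝓝 0) :=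
    fun n => by
      simpa using (tendsto_pow_atTop_nhds_zero_of_lt_one (by norm_num : (0 : ℝ) ≤ 1 / 2)
        (by norm_num)).const_mul ((n : ℝ) + 1 + 1)
  choose N η hη L hL0 hL using fun n => exists_uniform_lipschitz hw hK hne (hs n)
  let θ : ℕ → X → ℝ := fun n x => max 0 (1 - 1 / ((n : ℝ) + 1) * ρ (N n) x)
  have hθ01 : ∀ n x, θ n x ∈ Set.Icc (0 : ℝ) 1 := fun n x =>
    ⟨le_max_left _ _, max_le zero_le_one (sub_le_self _ (mul_nonneg (by positivity) (hρ0 _ _)))⟩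
  have hθlip : ∀ n, ∃ A, LipschitzWith A (θ n) := fun n => by
    obtain ⟨A, hA⟩ := hρlip (N n)
    refine ⟨A, LipschitzWith.const_max (LipschitzWith.of_le_add_mul A fun x y => ?_) 0⟩
    have h1 := hA.le_add_mul y x
    rw [dist_comm] at h1
    have h2 : 0 ≤ A * dist x y := by positivity
    have h3 : 1 / ((n : ℝ) + 1) ≤ 1 := by
      rw [div_le_one (by positivity)]
      linarith [n.cast_nonneg (α := ℝ)]
    have h4 : 1 / ((n : ℝ) + 1) * ρ (N n) y ≤ 1 / ((n : ℝ) + 1) * (ρ (N n) x + A * dist x y) :=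
      mul_le_mul_of_nonneg_left h1 (by positivity)
    have h5 := mul_le_of_le_one_left h2 h3
    rw [mul_add] at h4
    linarith
  refine ⟨θ, g, hgm, hgint, hθ01, hθlip, fun n => ?_, fun n x => ?_, ?_⟩
  · obtain ⟨A, hA⟩ := hθlip n
    refine lipschitzWith_mul_of_support hA (hθ01 n) hM (hL0 n) (hη n) fun x hx =>
      hL n x fun m hm => ?_
    have h1 : 1 / ((n : ℝ) + 1) * ρ (N n) x < 1 := by
      by_contra! h
      exact hx (max_eq_left (by linarith))
    have h2 : τ m x ≤ ρ (N n) x :=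
      Finset.single_le_sum (fun i _ => hτ0 i x) (Finset.mem_range.2 hm)
    rw [one_div_mul_eq_div, div_lt_one (by positivity)] at h1
    have h3 : 2 ^ m * (Metric.infDist x (K m) - (1 / 2) ^ m) ≤ τ m x :=
      mul_le_mul_of_nonneg_left (le_max_left _ _) (by positivity)
    have h4 : (2 : ℝ) ^ m * (1 / 2) ^ m = 1 := by
      rw [← mul_pow]
      norm_num
    have h5 : 2 ^ m * Metric.infDist x (K m) ≤ 2 ^ m * (((n : ℝ) + 1 + 1) * (1 / 2) ^ m) := by
      have e : (2 : ℝ) ^ m * (((n : ℝ) + 1 + 1) * (1 / 2) ^ m) =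
          ((n : ℝ) + 1 + 1) * (2 ^ m * (1 / 2) ^ m) := by ring
      rw [e, h4]
      rw [mul_sub, h4] at h3
      linarith
    exact le_of_mul_le_mul_left h5 (by positivity)
  · have h1 : asympSlope (θ n) x ≤ asympSlope (fun y => 1 / ((n : ℝ) + 1) * ρ (N n) y) x := by
      refine asympSlope_comp_le (φ := fun t => max 0 (1 - t))
        (f := fun y => 1 / ((n : ℝ) + 1) * ρ (N n) y) ?_ x
      refine LipschitzWith.const_max (LipschitzWith.of_le_add fun s t => ?_) 0
      have := (abs_le.1 (le_of_eq (Real.dist_eq s t).symm)).1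
      linarith
    refine h1.trans ?_
    obtain ⟨A, hA⟩ := hρlip (N n)
    refine (asympSlope_mul_le (f := fun _ => 1 / ((n : ℝ) + 1)) (by simp [asympSlope_const])
      (asympSlope_ne_top_iff.2 ⟨A, _, univ_mem, hA.lipschitzOnWith⟩)).trans ?_
    rw [asympSlope_const, mul_zero, add_zero, Real.enorm_eq_ofReal (by positivity)]
    exact mul_le_mul_right (hρslope _ _) _
  · have hnull : ∀ᵐ x ∂μ, ∃ m, x ∈ K m := by
      rw [ae_iff]
      have hlim : Tendsto (fun m : ℕ => (1 / 4 : ℝ≥0∞) ^ m) atTop (𝓝 0) :=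
        ENNReal.tendsto_pow_atTop_nhds_zero_of_lt_one (by
          rw [one_div]
          exact ENNReal.inv_lt_one.2 (by norm_num))
      refine le_antisymm (ge_of_tendsto' hlim fun m => ?_) bot_le
      refine (measure_mono fun x hx hxK => ?_).trans (hKμ m)
      exact hx ⟨m, hxK⟩
    filter_upwards [hnull] with x hx
    obtain ⟨m, hm⟩ := hx
    -- On `K m` all `τ i` with `i ≥ m` vanish, so `ρ` is bounded uniformly in the number of terms,
    -- however fast `N n` grows.
    have hb : ∀ n, ρ n x ≤ ρ m x := fun n => by
      have hz : ∀ i, m ≤ i → τ i x = 0 := fun i hi => by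
        simp only [τ]
        rw [Metric.infDist_zero_of_mem (hmono hi hm), max_eq_right (by
          have : (0 : ℝ) < (1 / 2) ^ i := by positivity
          linarith), mul_zero]
      rcases le_total n m with h | h
      · exact Finset.sum_le_sum_of_subset_of_nonneg (Finset.range_mono h) fun i _ _ => hτ0 i x
      · refine le_of_eq (Finset.sum_subset (Finset.range_mono h) fun i _ hi => hz i ?_).symm
        simpa using hi
    have hlow : Tendsto (fun n : ℕ => 1 - 1 / ((n : ℝ) + 1) * ρ m x) atTop (𝓝 1) := by
      simpa using ((tendsto_one_div_add_atTop_nhds_zero_nat (𝕜 := ℝ)).mul_const (ρ m x)).const_sub 1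
    refine tendsto_of_tendsto_of_tendsto_of_le_of_le hlow tendsto_const_nhds (fun n => ?_)
      fun n => (hθ01 n x).2
    refine le_trans ?_ (le_max_right _ _)
    have := mul_le_mul_of_nonneg_left (hb (N n)) (by positivity : 0 ≤ 1 / ((n : ℝ) + 1))
    linarith

end CompactExhaustion

/-! ### Locally Lipschitz functions in `L¹` -/

section LocallyLipschitz

variable {B : Type*} [NormedAddCommGroup B] [NormedSpace ℝ B] [CompleteSpace B]
  [TopologicalSpace.SeparableSpace B] [MeasurableSpace B] [BorelSpace B]
  {μ : Measure B} [IsFiniteMeasure μ]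

lemma locallyLipschitz_asympSlope_ne_top {w : B → ℝ} (hw : LocallyLipschitz w) (x : B) :
    asympSlope w x ≠ ⊤ := asympSlope_ne_top_iff.2 (hw x)

/-- The functions `θ n * w` are bounded and Lipschitz, and by the product rule their slope exceeds
that of `w` by at most `M * g / (n + 1)`. Since `g` is integrable, the excess vanishes in `L¹`; the
slope of `w` itself need not be integrable. -/
lemma preSlope_of_locallyLipschitz_of_bdd {w : B → ℝ} (hw : LocallyLipschitz w) {M : ℝ}
    (hM : ∀ x, |w x| ≤ M) : PreSlope 1 μ w fun x => (asympSlope w x).toReal := by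
  have : SecondCountableTopology B := UniformSpace.secondCountable_of_separable B
  obtain ⟨θ, g, hgm, hg, hθ01, hθ, hθw, hslope, hlim⟩ := exists_cutoff_seq μ hw hM
  have hM0 : 0 ≤ M := (abs_nonneg _).trans (hM 0)
  have hwm : AEStronglyMeasurable w μ := hw.continuous.aestronglyMeasurable
  have hθc : ∀ n, Continuous (θ n) := fun n => by
    obtain ⟨A, hA⟩ := hθ n
    exact hA.continuous
  have hbL : ∀ n, IsBddLipschitz fun x => θ n x * w x := fun n => ⟨hθw n, M, fun x => by
    rw [abs_mul, abs_of_nonneg (hθ01 n x).1]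
    exact (mul_le_of_le_one_left (abs_nonneg _) (hθ01 n x).2).trans (hM x)⟩
  have hexc : ∀ᵐ x ∂μ, ∀ n : ℕ,
      (asympSlope (fun y => θ n y * w y) x).toReal - (asympSlope w x).toReal ≤
        1 / ((n : ℝ) + 1) * (M * (g x).toReal) := by
    filter_upwards [ae_lt_top hgm hg] with x hx n
    have hw' := locallyLipschitz_asympSlope_ne_top hw x
    have hθ' : asympSlope (θ n) x ≠ ⊤ := by
      obtain ⟨A, hA⟩ := hθ n
      exact asympSlope_ne_top_iff.2 ⟨A, _, univ_mem, hA.lipschitzOnWith⟩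
    have h1 : asympSlope (fun y => θ n y * w y) x ≤
        asympSlope w x + ENNReal.ofReal M * (ENNReal.ofReal (1 / ((n : ℝ) + 1)) * g x) := by
      refine (asympSlope_mul_le hθ' hw').trans (add_le_add ?_ ?_)
      · refine mul_le_of_le_one_left zero_le ?_
        rw [Real.enorm_eq_ofReal (hθ01 n x).1]
        exact ENNReal.ofReal_le_one.2 (hθ01 n x).2
      · refine mul_le_mul' ?_ (hslope n x)
        rw [← ofReal_norm]
        exact ENNReal.ofReal_le_ofReal (hM x)
    have h2 := ENNReal.toReal_mono (ENNReal.add_ne_top.2 ⟨hw', ENNReal.mul_ne_top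
      ENNReal.ofReal_ne_top (ENNReal.mul_ne_top ENNReal.ofReal_ne_top hx.ne)⟩) h1
    rw [ENNReal.toReal_add hw' (ENNReal.mul_ne_top
      ENNReal.ofReal_ne_top (ENNReal.mul_ne_top ENNReal.ofReal_ne_top hx.ne)),
      ENNReal.toReal_mul, ENNReal.toReal_mul, ENNReal.toReal_ofReal hM0,
      ENNReal.toReal_ofReal (by positivity)] at h2
    linarith
  have hgi : Integrable (fun x => M * (g x).toReal) μ :=
    (integrable_toReal_of_lintegral_ne_top hgm.aemeasurable hg).const_mul M
  have hg0 : ∀ x, 0 ≤ M * (g x).toReal := fun x => mul_nonneg hM0 ENNReal.toReal_nonneg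
  refine PreSlope.of_tendsto le_rfl hwm (aestronglyMeasurable_asympSlope w)
    (f' := fun n x => θ n x * w x)
    (H' := fun n x => (asympSlope (fun y => θ n y * w y) x).toReal)
    (fun n => ((hθc n).mul hw.continuous).aestronglyMeasurable)
    (fun n => aestronglyMeasurable_asympSlope _)
    (fun n => (hbL n).preSlope le_rfl ENNReal.one_ne_top) ?_ ?_
  · refine tendsto_eLpNorm_zero_of_dominated one_ne_zero ENNReal.one_ne_top (memLp_const M)
      (fun n => (((hθc n).mul hw.continuous).sub hw.continuous).aestronglyMeasurable)
      (fun n => ae_of_all _ fun x => ?_) ?_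
    · have e : θ n x * w x - w x = -((1 - θ n x) * w x) := by ring
      rw [e, abs_neg, abs_mul, abs_of_nonneg (sub_nonneg.2 (hθ01 n x).2)]
      exact (mul_le_of_le_one_left (abs_nonneg _) (by linarith [(hθ01 n x).1])).trans (hM x)
    · filter_upwards [hlim] with x hx
      simpa using (hx.mul_const (w x)).sub_const (w x)
  · refine tendsto_eLpNorm_zero_of_dominated one_ne_zero ENNReal.one_ne_top
      (memLp_one_iff_integrable.2 hgi)
      (fun n => aestronglyMeasurable_posPart_sub (aestronglyMeasurable_asympSlope _)
        (aestronglyMeasurable_asympSlope _)) (fun n => ?_) ?_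
    · filter_upwards [hexc] with x hx
      rw [abs_of_nonneg (le_max_right _ _)]
      refine max_le ((hx n).trans (mul_le_of_le_one_left (hg0 x) ?_)) (hg0 x)
      rw [div_le_one (by positivity)]
      linarith [n.cast_nonneg (α := ℝ)]
    · filter_upwards [hexc] with x hx
      have hz : Tendsto (fun n : ℕ => 1 / ((n : ℝ) + 1) * (M * (g x).toReal)) atTop (𝓝 0) := by
        simpa using (tendsto_one_div_add_atTop_nhds_zero_nat (𝕜 := ℝ)).mul_const (M * (g x).toReal)
      refine squeeze_zero (fun n => le_max_right _ _) (fun n => max_le (hx n) ?_) hz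
      exact mul_nonneg (by positivity) (hg0 x)

/-- The asymptotic slope of an integrable locally Lipschitz function is a pre-slope. -/
lemma preSlope_of_locallyLipschitz {w : B → ℝ} (hw : LocallyLipschitz w) (hwi : MemLp w 1 μ) :
    PreSlope 1 μ w fun x => (asympSlope w x).toReal := by
  -- Truncation at height `n` is `1`-Lipschitz, so it does not increase the slope.
  let t : ℕ → ℝ → ℝ := fun n y => max (-(n : ℝ)) (min n y)
  have ht : ∀ n, LipschitzWith 1 (t n) := fun n => (LipschitzWith.id.const_min _).const_max _
  have htn : ∀ n y, |t n y| ≤ n := fun n y => by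
    have h0 : (0 : ℝ) ≤ n := n.cast_nonneg
    exact abs_le.2 ⟨le_max_left _ _, max_le (by linarith) (min_le_left _ _)⟩
  have hty : ∀ n y, |t n y| ≤ |y| := fun n y => by
    have h := (ht n).dist_le_mul y 0
    have h0 : t n 0 = 0 := by
      have : (0 : ℝ) ≤ n := n.cast_nonneg
      simp [t, this]
    simpa [h0, Real.dist_eq] using h
  have htc : ∀ n, LocallyLipschitz fun x => t n (w x) := fun n =>
    (ht n).locallyLipschitz.comp hw
  refine PreSlope.of_tendsto_ae (f' := fun n x => t n (w x))
    (H' := fun n x => (asympSlope w x).toReal) (D := fun x => 2 * |w x|) le_rfl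
    ENNReal.one_ne_top hwi.1 (aestronglyMeasurable_asympSlope w)
    (fun n => (htc n).continuous.aestronglyMeasurable)
    (fun n => aestronglyMeasurable_asympSlope w) (fun n => ?_) (hwi.norm.const_mul 2)
    (fun n => ae_of_all _ fun x => ?_) (fun n => ae_of_all _ fun x => ?_) ?_
    (ae_of_all _ fun x => tendsto_const_nhds)
  · refine (preSlope_of_locallyLipschitz_of_bdd (htc n) (fun x => htn n _)).mono
      (ae_of_all _ fun x => ?_)
    exact ENNReal.toReal_mono (locallyLipschitz_asympSlope_ne_top hw x) (asympSlope_comp_le (ht n) x)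
  · linarith [abs_sub (t n (w x)) (w x), hty n (w x)]
  · simp
  · refine ae_of_all _ fun x => tendsto_const_nhds.congr' ?_
    obtain ⟨k, hk⟩ := exists_nat_ge |w x|
    filter_upwards [eventually_ge_atTop k] with n hn
    have hkn : (k : ℝ) ≤ n := by exact_mod_cast hn
    have := abs_le.1 (hk.trans hkn)
    exact (clamp_eq ⟨this.1, this.2⟩).symm

/-- Energy approximation of locally Lipschitz functions by cylindrical functions in `L¹`. -/
lemma exists_cylindrical_energy_le {w : B → ℝ} (hw : LocallyLipschitz w) (hwi : MemLp w 1 μ)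
    {ε : ℝ≥0∞} (hε : 0 < ε) :
    ∃ v : B → ℝ, IsCylindrical v ∧ eLpNorm (fun x => v x - w x) 1 μ ≤ ε ∧
      ∫⁻ x, ‖fderiv ℝ v x‖ₑ ∂μ ≤ ∫⁻ x, asympSlope w x ∂μ + ε := by
  obtain ⟨v, hv, hvw, hve⟩ := preSlope_of_locallyLipschitz hw hwi ε hε
  refine ⟨v, hv, hvw, ?_⟩
  rw [eLpNorm_one_eq_lintegral_enorm] at hve
  refine le_trans ?_ (add_le_add le_rfl hve)
  rw [← lintegral_add_left (measurable_asympSlope w)]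
  refine lintegral_mono fun x => ?_
  have h1 : ‖fderiv ℝ v x‖ ≤ (asympSlope w x).toReal +
      max (‖fderiv ℝ v x‖ - (asympSlope w x).toReal) 0 := by
    linarith [le_max_left (‖fderiv ℝ v x‖ - (asympSlope w x).toReal) 0]
  rw [← ofReal_norm]
  refine (ENNReal.ofReal_le_ofReal h1).trans (ENNReal.ofReal_add_le.trans (add_le_add ?_ ?_))
  · rw [ENNReal.ofReal_toReal (locallyLipschitz_asympSlope_ne_top hw x)]
  · rw [Real.enorm_eq_ofReal (le_max_right _ _)]

end LocallyLipschitz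

/-! ### The variation on open sets -/

section Variation

lemma le_liminf_add_ennreal (u v : ℕ → ℝ≥0∞) :
    liminf u atTop + liminf v atTop ≤ liminf (fun n => u n + v n) atTop := by
  simp only [liminf_eq_iSup_iInf_of_nat]
  rw [ENNReal.iSup_add_iSup_of_monotone
    (fun n m h => biInf_mono fun i hi => le_trans h hi)
    (fun n m h => biInf_mono fun i hi => le_trans h hi)]
  exact iSup_mono fun n => le_iInf₂ fun i hi => add_le_add (iInf₂_le i hi) (iInf₂_le i hi)

variable {X : Type*} [PseudoMetricSpace X] [MeasurableSpace X] {μ : Measure X} {f : X → ℝ}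

lemma variationOn_le_liminf {Ω : Set X} {u : ℕ → X → ℝ} (hu : ∀ n, LocallyLipschitzOn Ω (u n) ∧
    MemLp (u n) 1 (μ.restrict Ω)) (huf : TendstoLp 1 (μ.restrict Ω) u f) :
    variationOn μ f Ω ≤ liminf (fun n => ∫⁻ x in Ω, asympSlope (u n) x ∂μ) atTop :=
  sInf_le ⟨u, hu, huf, rfl⟩

lemma exists_seq_of_variationOn_lt {Ω : Set X} {a : ℝ≥0∞} (h : variationOn μ f Ω < a) :
    ∃ u : ℕ → X → ℝ, (∀ n, LocallyLipschitzOn Ω (u n) ∧ MemLp (u n) 1 (μ.restrict Ω)) ∧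
      TendstoLp 1 (μ.restrict Ω) u f ∧ ∀ n, ∫⁻ x in Ω, asympSlope (u n) x ∂μ < a := by
  obtain ⟨b, ⟨u, hu, huf, rfl⟩, hb⟩ := sInf_lt_iff.1 h
  obtain ⟨φ, hφ, hφa⟩ := extraction_of_frequently_atTop (frequently_lt_of_liminf_lt (by
    isBoundedDefault) hb)
  exact ⟨fun n => u (φ n), fun n => hu _, huf.comp hφ.tendsto_atTop, hφa⟩

lemma variationOn_le_of_forall {Ω : Set X} {a : ℝ≥0∞}
    (h : ∀ ε : ℝ≥0∞, 0 < ε → ε ≠ ⊤ → ∃ u : X → ℝ, LocallyLipschitzOn Ω u ∧ MemLp u 1 (μ.restrict Ω) ∧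
      eLpNorm (fun x => u x - f x) 1 (μ.restrict Ω) ≤ ε ∧
      ∫⁻ x in Ω, asympSlope u x ∂μ ≤ a + ε) : variationOn μ f Ω ≤ a := by
  choose u h1 h2 h3 h4 using fun n : ℕ =>
    h ((n : ℝ≥0∞) + 1)⁻¹ (ENNReal.inv_pos.2 (by simp)) (ENNReal.inv_ne_top.2 (by simp))
  have hinv : Tendsto (fun n : ℕ => ((n : ℝ≥0∞) + 1)⁻¹) atTop (𝓝 0) := by
    simpa using (tendsto_add_atTop_iff_nat 1).2 ENNReal.tendsto_inv_nat_nhds_zero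
  refine (variationOn_le_liminf (fun n => ⟨h1 n, h2 n⟩)
    (tendsto_of_tendsto_of_tendsto_of_le_of_le tendsto_const_nhds hinv (fun _ => bot_le) h3)).trans ?_
  refine (liminf_le_liminf (Eventually.of_forall h4)).trans (le_of_eq ?_)
  simpa using (hinv.const_add a).liminf_eq

lemma variationOn_mono {Ω Ω' : Set X} (h : Ω ⊆ Ω') : variationOn μ f Ω ≤ variationOn μ f Ω' := by
  refine le_sInf ?_
  rintro _ ⟨u, hu, huf, rfl⟩
  have hle : μ.restrict Ω ≤ μ.restrict Ω' := Measure.restrict_mono h le_rfl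
  refine (variationOn_le_liminf (fun n => ⟨(hu n).1.mono h, (hu n).2.mono_measure hle⟩)
    (tendsto_of_tendsto_of_tendsto_of_le_of_le tendsto_const_nhds huf (fun _ => bot_le)
      fun n => eLpNorm_mono_measure _ hle)).trans ?_
  exact liminf_le_liminf (Eventually.of_forall fun n => lintegral_mono_set h)

lemma variationOn_empty : variationOn μ f ∅ = 0 := by
  refine le_antisymm (variationOn_le_of_forall fun ε hε _ => ?_) bot_le
  exact ⟨0, by simp, by simp, by simp, by simp⟩

variable [BorelSpace X]

/-- A competitor on the union restricts to one on each piece, the energies add up, and the lower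
limit is superadditive. -/
lemma variationOn_add_le {A C : Set X} (hC : IsOpen C) (hd : Disjoint A C) :
    variationOn μ f A + variationOn μ f C ≤ variationOn μ f (A ∪ C) := by
  refine le_sInf ?_
  rintro _ ⟨u, hu, huf, rfl⟩
  have hlow : ∀ S, S ⊆ A ∪ C → variationOn μ f S ≤
      liminf (fun n => ∫⁻ x in S, asympSlope (u n) x ∂μ) atTop := fun S hS => by
    have hle : μ.restrict S ≤ μ.restrict (A ∪ C) := Measure.restrict_mono hS le_rfl
    exact variationOn_le_liminf (fun n => ⟨(hu n).1.mono hS, (hu n).2.mono_measure hle⟩)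
      (tendsto_of_tendsto_of_tendsto_of_le_of_le tendsto_const_nhds huf (fun _ => bot_le)
        fun n => eLpNorm_mono_measure _ hle)
  refine (add_le_add (hlow A Set.subset_union_left) (hlow C Set.subset_union_right)).trans ?_
  refine (le_liminf_add_ennreal _ _).trans (le_of_eq ?_)
  congr 1
  ext n
  rw [lintegral_union hC.measurableSet hd]

end Variation

/-! ### A telescoping partition of unity -/

section PartitionOfUnity

variable {X : Type*} [PseudoMetricSpace X]

/-- Products `∏_{l < j} (1 - a_l)` of complementary cutoffs. -/
def cutoffCompl (x : ℕ → X) (r : ℕ → ℝ) (j : ℕ) (y : X) : ℝ :=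
  ∏ l ∈ Finset.range j, (1 - cutoff (x l) (r l) y)

/-- The telescoping Lipschitz partition of unity subordinate to a sequence of balls. -/
def ballPartition (x : ℕ → X) (r : ℕ → ℝ) (j : ℕ) (y : X) : ℝ :=
  cutoff (x j) (r j) y * cutoffCompl x r j y

variable {x : ℕ → X} {r : ℕ → ℝ}

lemma cutoffCompl_mem (j : ℕ) (y : X) : cutoffCompl x r j y ∈ Set.Icc (0 : ℝ) 1 :=
  ⟨Finset.prod_nonneg fun _ _ => sub_nonneg.2 (cutoff_mem _ _ _).2,
    Finset.prod_le_one (fun _ _ => sub_nonneg.2 (cutoff_mem _ _ _).2)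
      fun _ _ => sub_le_self _ (cutoff_mem _ _ _).1⟩

lemma ballPartition_mem (j : ℕ) (y : X) : ballPartition x r j y ∈ Set.Icc (0 : ℝ) 1 :=
  ⟨mul_nonneg (cutoff_mem _ _ _).1 (cutoffCompl_mem j y).1,
    mul_le_one₀ (cutoff_mem _ _ _).2 (cutoffCompl_mem j y).1 (cutoffCompl_mem j y).2⟩

lemma sum_ballPartition (n : ℕ) (y : X) :
    ∑ j ∈ Finset.range n, ballPartition x r j y = 1 - cutoffCompl x r n y := by
  induction n with
  | zero => simp [cutoffCompl]
  | succ n ih =>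
    rw [Finset.sum_range_succ, ih, ballPartition]
    simp only [cutoffCompl, Finset.prod_range_succ]
    ring

lemma sum_ballPartition_le_one (s : Finset ℕ) (y : X) :
    ∑ j ∈ s, ballPartition x r j y ≤ 1 := by
  obtain ⟨n, hn⟩ := s.exists_nat_subset_range
  refine (Finset.sum_le_sum_of_subset_of_nonneg hn fun j _ _ => (ballPartition_mem j y).1).trans ?_
  rw [sum_ballPartition]
  linarith [(cutoffCompl_mem (x := x) (r := r) n y).1]

lemma cutoffCompl_eq_zero (hr : ∀ j, 0 < r j) {k n : ℕ} (hkn : k < n) {y : X}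
    (hy : dist y (x k) < r k) : cutoffCompl x r n y = 0 :=
  Finset.prod_eq_zero (Finset.mem_range.2 hkn) (by rw [cutoff_eq_one (hr k) hy.le, sub_self])

lemma ballPartition_eq_zero_of_lt (hr : ∀ j, 0 < r j) {k n : ℕ} (hkn : k < n) {y : X}
    (hy : dist y (x k) < r k) : ballPartition x r n y = 0 := by
  rw [ballPartition, cutoffCompl_eq_zero hr hkn hy, mul_zero]

lemma ballPartition_eq_zero_of_dist (hr : ∀ j, 0 < r j) {n : ℕ} {y : X}
    (hy : 2 * r n ≤ dist y (x n)) : ballPartition x r n y = 0 := by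
  rw [ballPartition, cutoff_eq_zero (hr n) hy, zero_mul]

lemma exists_lipschitzWith_ballPartition (hr : ∀ j, 0 < r j) (j : ℕ) :
    ∃ A : ℝ≥0, LipschitzWith A (ballPartition x r j) := by
  have hcut : ∀ l, IsBddLipschitz (cutoff (x l) (r l)) := fun l =>
    ⟨⟨_, lipschitzWith_cutoff (x l) (hr l)⟩, 1, fun y => by
      rw [abs_of_nonneg (cutoff_mem _ _ _).1]
      exact (cutoff_mem _ _ _).2⟩
  have hcompl : ∀ n, IsBddLipschitz (cutoffCompl x r n) := fun n => by
    induction n with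
    | zero =>
      have e : cutoffCompl x r 0 = fun _ => 1 := by
        ext y
        simp [cutoffCompl]
      rw [e]
      exact isBddLipschitz_const 1
    | succ n ih =>
      have h1 : IsBddLipschitz fun y => 1 + (-1) * cutoff (x n) (r n) y :=
        (isBddLipschitz_const 1).add ((isBddLipschitz_const (-1)).mul (hcut n))
      have h2 := ih.mul h1
      have e : cutoffCompl x r (n + 1) =
          fun y => cutoffCompl x r n y * (1 + (-1) * cutoff (x n) (r n) y) := by
        ext y
        simp only [cutoffCompl, Finset.prod_range_succ]
        ring
      rwa [e]
  exact ((hcut j).mul (hcompl j)).1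

variable {U : ℕ → X → ℝ} {Ω : ℕ → Set X}

/-- Near a point of the `k`-th ball, only finitely many terms matter. -/
lemma tsum_ballPartition_eq (hr : ∀ j, 0 < r j) {k : ℕ} {y : X} (hy : dist y (x k) < r k) :
    ∑' j, ballPartition x r j y * U j y =
      ∑ j ∈ Finset.range (k + 1), ballPartition x r j y * U j y :=
  tsum_eq_sum fun j hj => by
    rw [ballPartition_eq_zero_of_lt hr (by simpa using hj) hy, zero_mul]

/-- On the `k`-th ball the first `k + 1` weights already sum to `1`, so a constant can be subtracted
inside the sum. -/
lemma tsum_ballPartition_sub_eq (hr : ∀ j, 0 < r j) {k : ℕ} {y : X} (hy : dist y (x k) < r k)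
    (c : ℝ) : ∑' j, ballPartition x r j y * U j y - c =
      ∑ j ∈ Finset.range (k + 1), ballPartition x r j y * (U j y - c) := by
  rw [tsum_ballPartition_eq hr hy]
  simp only [mul_sub, Finset.sum_sub_distrib]
  rw [← Finset.sum_mul, sum_ballPartition, cutoffCompl_eq_zero hr (Nat.lt_succ_self k) hy,
    sub_zero, one_mul]

/-- Subtracting `c` before applying the product rule leaves the Lipschitz constants of the weights
multiplied by `U j - c` only. With `c = f y` this error is controlled by `U j - f`. Outside `Ω j`
the weight vanishes in a neighbourhood. -/
lemma asympSlope_glue_le (hr : ∀ j, 0 < r j) (hΩ : ∀ j, Metric.ball (x j) (3 * r j) ⊆ Ω j)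
    (hU : ∀ j, ∀ y ∈ Ω j, asympSlope (U j) y ≠ ⊤) {A : ℕ → ℝ≥0}
    (hA : ∀ j, LipschitzWith (A j) (ballPartition x r j)) {k : ℕ} {y : X}
    (hy : dist y (x k) < r k) (c : ℝ) :
    asympSlope (fun z => ∑' j, ballPartition x r j z * U j z) y ≤
      ∑ j ∈ Finset.range (k + 1), (Ω j).indicator (fun z =>
        ‖ballPartition x r j z‖ₑ * asympSlope (U j) z + A j * ‖U j z - c‖ₑ) y := by
  have hev : ∀ᶠ z in 𝓝 y, dist z (x k) < r k :=
    (continuous_id.dist continuous_const).continuousAt.eventually_lt_const hy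
  rw [← asympSlope_sub_const _ c, asympSlope_congr
    (g := fun z => ∑ j ∈ Finset.range (k + 1), ballPartition x r j z * (U j z - c))
    (by filter_upwards [hev] with z hz using tsum_ballPartition_sub_eq hr hz c)]
  refine (asympSlope_sum_le _ _ _).trans (Finset.sum_le_sum fun j _ => ?_)
  by_cases hyj : y ∈ Ω j
  · rw [Set.indicator_of_mem hyj]
    have h1 : asympSlope (ballPartition x r j) y ≤ A j := asympSlope_le_of_lipschitzWith (hA j) y
    have h2 : asympSlope (fun z => U j z - c) y ≠ ⊤ := by
      rw [asympSlope_sub_const]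
      exact hU j y hyj
    refine (asympSlope_mul_le (h1.trans_lt ENNReal.coe_lt_top).ne h2).trans ?_
    rw [asympSlope_sub_const, mul_comm (A j : ℝ≥0∞)]
    exact add_le_add le_rfl (mul_le_mul_right h1 _)
  · rw [Set.indicator_of_notMem hyj]
    refine (asympSlope_eq_zero_of_eventually (c := 0) ?_).le
    have hd : 2 * r j < dist y (x j) := by
      by_contra! h
      exact hyj (hΩ j (Metric.mem_ball.2 (by linarith [hr j])))
    filter_upwards [(continuous_id.dist continuous_const).continuousAt.eventually_const_lt hd]
      with z hz
    have hz' : 2 * r j < dist z (x j) := hz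
    rw [ballPartition_eq_zero_of_dist hr hz'.le, zero_mul]

lemma enorm_glue_sub_le (hr : ∀ j, 0 < r j) (hΩ : ∀ j, Metric.ball (x j) (3 * r j) ⊆ Ω j)
    {k : ℕ} {y : X} (hy : dist y (x k) < r k) (c : ℝ) :
    ‖∑' j, ballPartition x r j y * U j y - c‖ₑ ≤
      ∑ j ∈ Finset.range (k + 1), (Ω j).indicator (fun z => ‖U j z - c‖ₑ) y := by
  rw [tsum_ballPartition_sub_eq hr hy]
  refine (enorm_sum_le _ _).trans (Finset.sum_le_sum fun j _ => ?_)
  by_cases hyj : y ∈ Ω j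
  · rw [Set.indicator_of_mem hyj, enorm_mul]
    refine mul_le_of_le_one_left zero_le ?_
    rw [Real.enorm_eq_ofReal (ballPartition_mem j y).1]
    exact ENNReal.ofReal_le_one.2 (ballPartition_mem j y).2
  · have hd : 2 * r j ≤ dist y (x j) := by
      by_contra! h
      exact hyj (hΩ j (Metric.mem_ball.2 (by linarith [hr j])))
    rw [ballPartition_eq_zero_of_dist hr hd, zero_mul, enorm_zero]
    exact zero_le

end PartitionOfUnity

/-! ### Countable subadditivity of the variation -/

section Subadditivity

variable {X : Type*} [PseudoMetricSpace X]

/-- The factor `3` leaves room around the cutoffs, which vanish outside the balls of radius `2 * r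
j`. -/
lemma exists_ball_cover [SecondCountableTopology X] {Ω : ℕ → Set X} (hΩ : ∀ i, IsOpen (Ω i))
    (hne : (⋃ i, Ω i).Nonempty) :
    ∃ (x : ℕ → X) (r : ℕ → ℝ) (i : ℕ → ℕ), (∀ j, 0 < r j) ∧
      (∀ j, Metric.ball (x j) (3 * r j) ⊆ Ω (i j)) ∧ ⋃ i, Ω i ⊆ ⋃ j, Metric.ball (x j) (r j) := by
  have h : ∀ y : X, ∃ (s : ℝ) (i : ℕ), y ∈ ⋃ i, Ω i → 0 < s ∧ Metric.ball y (3 * s) ⊆ Ω i := by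
    intro y
    by_cases hy : y ∈ ⋃ i, Ω i
    · obtain ⟨i, hi⟩ := Set.mem_iUnion.1 hy
      obtain ⟨s, hs, hsi⟩ := Metric.isOpen_iff.1 (hΩ i) y hi
      exact ⟨s / 3, i, fun _ => ⟨by positivity, by rwa [mul_div_cancel₀ s three_ne_zero]⟩⟩
    · exact ⟨0, 0, fun h => absurd h hy⟩
  choose s i hs using h
  obtain ⟨t, ht, htc, hcov⟩ := TopologicalSpace.countable_cover_nhdsWithin
    (s := ⋃ i, Ω i) (f := fun y => Metric.ball y (s y))
    fun y hy => mem_nhdsWithin_of_mem_nhds (Metric.ball_mem_nhds y (hs y hy).1)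
  have htne : t.Nonempty := by
    obtain ⟨y, hy⟩ := hne
    obtain ⟨z, hz, -⟩ := Set.mem_iUnion₂.1 (hcov hy)
    exact ⟨z, hz⟩
  obtain ⟨x, rfl⟩ := htc.exists_eq_range htne
  refine ⟨x, fun j => s (x j), fun j => i (x j), fun j => (hs _ (ht ⟨j, rfl⟩)).1,
    fun j => (hs _ (ht ⟨j, rfl⟩)).2, ?_⟩
  simpa only [Set.biUnion_range] using hcov

variable [MeasurableSpace X] {μ : Measure X} {f : X → ℝ}

lemma setLIntegral_le_tsum_of_le_indicator {O : Set X} (hO : MeasurableSet O) {S : ℕ → Set X}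
    (hS : ∀ j, MeasurableSet (S j)) {h : X → ℝ≥0∞} {g : ℕ → X → ℝ≥0∞}
    (hg : ∀ j, AEMeasurable (g j) (μ.restrict (S j)))
    (hle : ∀ y ∈ O, h y ≤ ∑' j, (S j).indicator (g j) y) :
    ∫⁻ y in O, h y ∂μ ≤ ∑' j, ∫⁻ y in S j, g j y ∂μ := by
  refine (setLIntegral_mono' hO hle).trans ((setLIntegral_le_lintegral _ _).trans ?_)
  rw [lintegral_tsum fun j => (aemeasurable_indicator_iff (hS j)).2 (hg j)]
  exact ENNReal.tsum_le_tsum fun j => (lintegral_indicator (hS j) _).le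

variable [BorelSpace X]

lemma measurable_enorm_ballPartition {x : ℕ → X} {r : ℕ → ℝ} (hr : ∀ j, 0 < r j) (j : ℕ) :
    Measurable fun y => ‖ballPartition x r j y‖ₑ := by
  obtain ⟨A, hA⟩ := exists_lipschitzWith_ballPartition (x := x) hr j
  exact hA.continuous.measurable.enorm

lemma sum_lintegral_ballPartition_le {x : ℕ → X} {r : ℕ → ℝ} (hr : ∀ j, 0 < r j) (T : Finset ℕ)
    {g : X → ℝ≥0∞} (hg : Measurable g) (ν : Measure X) :
    ∑ j ∈ T, ∫⁻ y, ‖ballPartition x r j y‖ₑ * g y ∂ν ≤ ∫⁻ y, g y ∂ν := by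
  have hmeas : ∀ j ∈ T, Measurable fun y => ‖ballPartition x r j y‖ₑ * g y :=
    fun j _ => (measurable_enorm_ballPartition hr j).mul hg
  rw [← lintegral_finsetSum _ hmeas]
  refine lintegral_mono fun y => ?_
  beta_reduce
  rw [← Finset.sum_mul]
  refine mul_le_of_le_one_left zero_le ?_
  simp only [Real.enorm_eq_ofReal (ballPartition_mem _ y).1]
  rw [← ENNReal.ofReal_sum_of_nonneg fun j _ => (ballPartition_mem j y).1]
  exact ENNReal.ofReal_le_one.2 (sum_ballPartition_le_one T y)

/-- Energies localized by a partition of unity have limits along an ultrafilter, whose sum is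
controlled by the total energy. -/
lemma exists_limits_of_localized_energy {x : ℕ → X} {r : ℕ → ℝ} (hr : ∀ j, 0 < r j) (i : ℕ → ℕ)
    (S : ℕ → Set X) {g : ℕ → ℕ → X → ℝ≥0∞} (hg : ∀ i n, Measurable (g i n)) {a : ℕ → ℝ≥0∞}
    (ha : ∀ i n, ∫⁻ y in S i, g i n y ∂μ ≤ a i) :
    ∃ m : ℕ → ℝ≥0∞, ∑' j, m j ≤ ∑' i, a i ∧ ∀ j,
      Tendsto (fun n => ∫⁻ y in S (i j), ‖ballPartition x r j y‖ₑ * g (i j) n y ∂μ)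
        (hyperfilter ℕ) (𝓝 (m j)) := by
  set I : ℕ → ℕ → ℝ≥0∞ := fun j n =>
    ∫⁻ y in S (i j), ‖ballPartition x r j y‖ₑ * g (i j) n y ∂μ with hI
  -- Compactness of `[0, ∞]` gives all limits along one ultrafilter, without a diagonal extraction.
  have hlim : ∀ j, Tendsto (I j) (hyperfilter ℕ) (𝓝 ((hyperfilter ℕ).map (I j)).lim) :=
    fun j => Ultrafilter.le_nhds_lim _
  refine ⟨_, ?_, hlim⟩
  rw [ENNReal.tsum_eq_iSup_sum]
  refine iSup_le fun s => ?_
  refine le_of_tendsto (tendsto_finsetSum s fun j _ => hlim j) (Eventually.of_forall fun n => ?_)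
  -- Weights attached to the same set `S k` act on the same function `g k n` and sum to at most `1`,
  -- so each fibre contributes at most `a k`.
  rw [← Finset.sum_fiberwise_of_maps_to (t := s.image i) fun j hj => Finset.mem_image_of_mem i hj]
  refine le_trans (Finset.sum_le_sum fun k _ => ?_) (ENNReal.sum_le_tsum (s.image i))
  refine le_trans (le_of_eq ?_) ((sum_lintegral_ballPartition_le (x := x) hr
    (s.filter fun j => i j = k) (hg k n) (μ.restrict (S k))).trans (ha k n))
  refine Finset.sum_congr rfl fun j hj => ?_
  rw [hI, ← (Finset.mem_filter.1 hj).2]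

/-- Almost optimal sequences on the `Ω i` are glued by the partition of unity. Each weight needs its
own index `n j`, because its Lipschitz constant `A j` is not uniform. Such independent choices could
break the bound on the total energy; comparing each localized energy with its limit `m j` restores
it. -/
theorem variationOn_iUnion_le [SecondCountableTopology X] (hf : MemLp f 1 μ) {Ω : ℕ → Set X}
    (hΩ : ∀ i, IsOpen (Ω i)) :
    variationOn μ f (⋃ i, Ω i) ≤ ∑' i, variationOn μ f (Ω i) := by
  by_cases htop : ∑' i, variationOn μ f (Ω i) = ⊤
  · rw [htop]
    exact le_top
  rcases (⋃ i, Ω i).eq_empty_or_nonempty with hne | hne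
  · rw [hne, variationOn_empty]
    exact bot_le
  refine variationOn_le_of_forall fun ε hε hεt => ?_
  -- The sum of the `δ j` is used three times: for near optimality on `Ω i`, for the distance of a
  -- localized energy from `m j`, and for the error with factor `A j`.
  obtain ⟨δ, hδ, hδε⟩ := ENNReal.exists_pos_sum_of_countable' (ENNReal.div_pos hε.ne'
    (by simp : (3 : ℝ≥0∞) ≠ ⊤)).ne' ℕ
  have hVtop : ∀ i, variationOn μ f (Ω i) ≠ ⊤ := ENNReal.ne_top_of_tsum_ne_top htop
  choose u hu huf hue using fun i =>
    exists_seq_of_variationOn_lt (ENNReal.lt_add_right (hVtop i) (hδ i).ne')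
  obtain ⟨x, r, i, hr, hball, hcov⟩ := exists_ball_cover hΩ hne
  choose A hA using fun j => exists_lipschitzWith_ballPartition (x := x) hr j
  obtain ⟨m, hm, hmlim⟩ := exists_limits_of_localized_energy (x := x) hr i Ω
    (fun i n => measurable_asympSlope (u i n)) (fun i n => (hue i n).le)
  have hchoice : ∀ j, ∃ n,
      ∫⁻ y in Ω (i j), ‖ballPartition x r j y‖ₑ * asympSlope (u (i j) n) y ∂μ ≤ m j + δ j ∧
      (1 + A j) * eLpNorm (fun y => u (i j) n y - f y) 1 (μ.restrict (Ω (i j))) ≤ δ j := by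
    intro j
    have h1 : ∀ᶠ n in (hyperfilter ℕ : Filter ℕ),
        ∫⁻ y in Ω (i j), ‖ballPartition x r j y‖ₑ * asympSlope (u (i j) n) y ∂μ ≤ m j + δ j := by
      by_cases hmt : m j = ⊤
      · simp [hmt]
      · exact ((hmlim j).eventually_lt_const (ENNReal.lt_add_right hmt (hδ j).ne')).mono
          fun n hn => hn.le
    have h2 : Tendsto (fun n => (1 + A j) *
        eLpNorm (fun y => u (i j) n y - f y) 1 (μ.restrict (Ω (i j)))) atTop (𝓝 0) := by
      have := ENNReal.Tendsto.const_mul (a := (1 + A j : ℝ≥0∞)) (huf (i j)) (Or.inr (by finiteness))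
      rwa [mul_zero] at this
    have h3 := (h2.eventually_lt_const (hδ j)).filter_mono Nat.hyperfilter_le_atTop
    obtain ⟨n, hn1, hn2⟩ := (h1.and h3).exists
    exact ⟨n, hn1, hn2.le⟩
  choose n hnI hnA using hchoice
  set U : ℕ → X → ℝ := fun j => u (i j) (n j) with hU
  set W : X → ℝ := fun y => ∑' j, ballPartition x r j y * U j y with hW
  have hUs : ∀ j, ∀ y ∈ Ω (i j), asympSlope (U j) y ≠ ⊤ := fun j =>
    (locallyLipschitzOn_iff_asympSlope (hΩ _)).1 (hu (i j) (n j)).1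
  have hO : IsOpen (⋃ i, Ω i) := isOpen_iUnion hΩ
  have hmem : ∀ y ∈ ⋃ i, Ω i, ∃ k, dist y (x k) < r k := fun y hy => by
    simpa using hcov hy
  have hWs : ∀ y ∈ ⋃ i, Ω i, asympSlope W y ≠ ⊤ := fun y hy => by
    obtain ⟨k, hk⟩ := hmem y hy
    refine ((asympSlope_glue_le hr hball hUs hA hk 0).trans_lt
      (ENNReal.sum_lt_top.2 fun j _ => ?_)).ne
    by_cases hyj : y ∈ Ω (i j)
    · rw [Set.indicator_of_mem hyj]
      exact ENNReal.add_lt_top.2 ⟨ENNReal.mul_lt_top enorm_lt_top (hUs j y hyj).lt_top,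
        ENNReal.mul_lt_top ENNReal.coe_lt_top enorm_lt_top⟩
    · rw [Set.indicator_of_notMem hyj]
      exact ENNReal.zero_lt_top
  have hWl : LocallyLipschitzOn (⋃ i, Ω i) W := (locallyLipschitzOn_iff_asympSlope hO).2 hWs
  have hUf : ∀ j, AEMeasurable (fun y => ‖U j y - f y‖ₑ) (μ.restrict (Ω (i j))) := fun j =>
    ((hu (i j) (n j)).2.1.sub (hf.1.restrict)).enorm
  have hL1 : ∀ j, eLpNorm (fun y => U j y - f y) 1 (μ.restrict (Ω (i j))) =
      ∫⁻ y in Ω (i j), ‖U j y - f y‖ₑ ∂μ := fun j => eLpNorm_one_eq_lintegral_enorm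
  have h3 : 3 * ∑' j, δ j ≤ ε := by
    rw [mul_comm]
    exact (ENNReal.le_div_iff_mul_le (by simp) (by simp)).1 hδε.le
  have h1 : ∑' j, δ j ≤ ε := le_trans (le_mul_of_one_le_left zero_le (by norm_num)) h3
  have hWf : eLpNorm (fun y => W y - f y) 1 (μ.restrict (⋃ i, Ω i)) ≤ ε := by
    refine le_trans ?_ h1
    rw [eLpNorm_one_eq_lintegral_enorm]
    refine (setLIntegral_le_tsum_of_le_indicator hO.measurableSet
      (fun j => (hΩ (i j)).measurableSet) hUf fun y hy => ?_).trans
      (ENNReal.tsum_le_tsum fun j => ?_)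
    · obtain ⟨k, hk⟩ := hmem y hy
      refine (enorm_glue_sub_le hr hball hk (f y)).trans ?_
      exact ENNReal.sum_le_tsum (f := fun j => (Ω (i j)).indicator (fun z => ‖U j z - f z‖ₑ) y) _
    · rw [← hL1]
      exact (le_mul_of_one_le_left zero_le le_self_add).trans (hnA j)
  refine ⟨W, hWl, ?_, hWf, ?_⟩
  · have hWm : AEStronglyMeasurable W (μ.restrict (⋃ i, Ω i)) :=
      ContinuousOn.aestronglyMeasurable (fun y hy =>
        (continuousAt_of_asympSlope_ne_top (hWs y hy)).continuousWithinAt) hO.measurableSet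
    have hd : MemLp (fun y => W y - f y) 1 (μ.restrict (⋃ i, Ω i)) :=
      ⟨hWm.sub hf.1.restrict, hWf.trans_lt (lt_top_iff_ne_top.2 hεt)⟩
    convert! hd.add (hf.restrict _) using 1
    ext y
    simp
  · have hsum : ∑' j, (m j + δ j + δ j) ≤ ∑' i, variationOn μ f (Ω i) + ε := by
      rw [ENNReal.tsum_add, ENNReal.tsum_add]
      rw [ENNReal.tsum_add] at hm
      calc ∑' j, m j + ∑' j, δ j + ∑' j, δ j
          ≤ ∑' i, variationOn μ f (Ω i) + ∑' j, δ j + ∑' j, δ j + ∑' j, δ j := by gcongr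
        _ = ∑' i, variationOn μ f (Ω i) + 3 * ∑' j, δ j := by ring
        _ ≤ _ := by gcongr
    refine le_trans ?_ hsum
    refine (setLIntegral_le_tsum_of_le_indicator hO.measurableSet
      (fun j => (hΩ (i j)).measurableSet) (g := fun j y =>
        ‖ballPartition x r j y‖ₑ * asympSlope (U j) y + A j * ‖U j y - f y‖ₑ) (fun j => ?_)
      fun y hy => ?_).trans (ENNReal.tsum_le_tsum fun j => ?_)
    · exact ((measurable_enorm_ballPartition hr j).mul
        (measurable_asympSlope _)).aemeasurable.add ((hUf j).const_mul _)
    · obtain ⟨k, hk⟩ := hmem y hy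
      refine (asympSlope_glue_le hr hball hUs hA hk (f y)).trans ?_
      exact ENNReal.sum_le_tsum (f := fun j => (Ω (i j)).indicator (fun z =>
        ‖ballPartition x r j z‖ₑ * asympSlope (U j) z + A j * ‖U j z - f z‖ₑ) y) _
    · have hmeas : Measurable fun y => ‖ballPartition x r j y‖ₑ * asympSlope (U j) y :=
        (measurable_enorm_ballPartition hr j).mul (measurable_asympSlope _)
      rw [lintegral_add_left hmeas,
        lintegral_const_mul' _ _ ENNReal.coe_ne_top]
      refine add_le_add (hnI j) ?_
      rw [← hL1]
      exact (mul_le_mul_left le_add_self _).trans (hnA j)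

end Subadditivity

/-! ### The total variation measure -/

section TotalVariationMeasure

variable {X : Type*} [MetricSpace X] [SecondCountableTopology X] [MeasurableSpace X] [BorelSpace X]
  {μ : Measure X} {f : X → ℝ}

variable (μ f) in
/-- The outer measure induced by the variation of `f` on open sets. -/
def variationOuter : OuterMeasure X :=
  inducedOuterMeasure (P := IsOpen) (fun s _ => variationOn μ f s) isOpen_empty variationOn_empty

lemma variationOuter_of_isOpen (hf : MemLp f 1 μ) {O : Set X} (hO : IsOpen O) :
    variationOuter μ f O = variationOn μ f O :=
  inducedOuterMeasure_eq' (fun _ h => isOpen_iUnion h)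
    (fun _ h => variationOn_iUnion_le hf h) (fun _ _ _ _ h => variationOn_mono h) hO

lemma variationOuter_eq_iInf (hf : MemLp f 1 μ) (s : Set X) :
    variationOuter μ f s = ⨅ (t : Set X) (_ : IsOpen t) (_ : s ⊆ t), variationOn μ f t :=
  inducedOuterMeasure_eq_iInf (fun _ h => isOpen_iUnion h)
    (fun _ h => variationOn_iUnion_le hf h) (fun _ _ _ _ h => variationOn_mono h) s

/-- Two sets at distance at least `r` have disjoint open neighbourhoods of radius `r / 2`; inside
any open set covering both, the variation is superadditive on these. -/
lemma isMetric_variationOuter (hf : MemLp f 1 μ) : (variationOuter μ f).IsMetric := by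
  rintro s t ⟨r, hr, hst⟩
  refine le_antisymm (measure_union_le s t) ?_
  rw [variationOuter_eq_iInf hf (s ∪ t)]
  refine le_iInf fun O => le_iInf fun hO => le_iInf fun hstO => ?_
  have hopen : ∀ S : Set X, IsOpen (O ∩ {x | Metric.infEDist x S < r / 2}) := fun S =>
    hO.inter (isOpen_Iio.preimage Metric.continuous_infEDist)
  have hsub : ∀ S : Set X, S ⊆ O → S ⊆ O ∩ {x | Metric.infEDist x S < r / 2} := fun S hS x hx =>
    ⟨hS hx, (Metric.infEDist_zero_of_mem hx).trans_lt (ENNReal.half_pos hr)⟩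
  have hdisj : Disjoint (O ∩ {x | Metric.infEDist x s < r / 2})
      (O ∩ {x | Metric.infEDist x t < r / 2}) := by
    refine Set.disjoint_left.2 fun x hxs hxt => ?_
    obtain ⟨a, ha, hxa⟩ := Metric.infEDist_lt_iff.1 hxs.2
    obtain ⟨b, hb, hxb⟩ := Metric.infEDist_lt_iff.1 hxt.2
    refine (hst a ha b hb).not_gt ?_
    rw [edist_comm] at hxa
    exact (edist_triangle a x b).trans_lt ((ENNReal.add_lt_add hxa hxb).trans_eq
      (ENNReal.add_halves r))
  calc variationOuter μ f s + variationOuter μ f t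
      ≤ variationOuter μ f (O ∩ {x | Metric.infEDist x s < r / 2}) +
        variationOuter μ f (O ∩ {x | Metric.infEDist x t < r / 2}) :=
        add_le_add (measure_mono (hsub s (Set.subset_union_left.trans hstO)))
          (measure_mono (hsub t (Set.subset_union_right.trans hstO)))
    _ ≤ variationOn μ f (O ∩ {x | Metric.infEDist x s < r / 2} ∪
        O ∩ {x | Metric.infEDist x t < r / 2}) := by
        rw [variationOuter_of_isOpen hf (hopen s), variationOuter_of_isOpen hf (hopen t)]
        exact variationOn_add_le (hopen t) hdisj
    _ ≤ variationOn μ f O :=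
        variationOn_mono (Set.union_subset Set.inter_subset_left Set.inter_subset_left)

lemma IsBddLipschitz.locallyLipschitzOn_and_memLp [IsFiniteMeasure μ] {u : X → ℝ}
    (hu : IsBddLipschitz u) (Ω : Set X) :
    LocallyLipschitzOn Ω u ∧ MemLp u 1 (μ.restrict Ω) := by
  obtain ⟨⟨K, hK⟩, C, hC⟩ := hu
  exact ⟨hK.locallyLipschitz.locallyLipschitzOn, MemLp.of_bound
    hK.continuous.aestronglyMeasurable C (ae_of_all _ hC)⟩

lemma MemBV.variationOn_univ_lt_top [IsFiniteMeasure μ] (hf : MemBV μ f) :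
    variationOn μ f Set.univ < ⊤ := by
  obtain ⟨-, u, hu, huf, hlt⟩ := hf
  refine (variationOn_le_liminf (fun n => (hu n).locallyLipschitzOn_and_memLp _) ?_).trans_lt ?_
  · rwa [Measure.restrict_univ]
  · rwa [Measure.restrict_univ]

/-- A metric outer measure is additive on Borel sets by Carathéodory's criterion. Open sets form a
π-system generating the Borel sets, so a finite measure is determined by its values on them. -/
theorem MemBV.existsUnique_isTotalVariation [IsFiniteMeasure μ] (hf : MemBV μ f) :
    ∃! ν : Measure X, IsTotalVariation μ f ν := by
  have hm := (isMetric_variationOuter hf.1).le_caratheodory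
  have hO : ∀ Ω : Set X, IsOpen Ω →
      (variationOuter μ f).toMeasure hm Ω = variationOn μ f Ω := fun Ω hΩ => by
    rw [toMeasure_apply _ _ hΩ.measurableSet, variationOuter_of_isOpen hf.1 hΩ]
  refine ⟨(variationOuter μ f).toMeasure hm, ⟨⟨?_⟩, hO⟩, fun ν hν => ?_⟩
  · rw [hO _ isOpen_univ]
    exact hf.variationOn_univ_lt_top
  · have := hν.1
    exact ext_of_generate_finite _ (BorelSpace.measurable_eq (α := X)) isPiSystem_isOpen
      (fun s hs => (hν.2 s hs).trans (hO s hs).symm)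
      ((hν.2 _ isOpen_univ).trans (hO _ isOpen_univ).symm)

end TotalVariationMeasure

/-! ### Weak convergence from lower semicontinuity -/

section WeakConvergence

/-- If `u` exceeded some `c > a` along a subsequence, the lower bound on `v` would push the limit of
the sums to at least `c + b`. -/
lemma tendsto_of_le_liminf_of_tendsto_add {a b : ℝ≥0∞} {u v : ℕ → ℝ≥0∞} (hu : a ≤ liminf u atTop)
    (hv : b ≤ liminf v atTop) (hb : b ≠ ⊤)
    (huv : Tendsto (fun n => u n + v n) atTop (𝓝 (a + b))) : Tendsto u atTop (𝓝 a) := by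
  refine tendsto_of_le_liminf_of_limsup_le hu (le_of_forall_lt_imp_le_of_dense fun c hc => ?_)
  obtain ⟨φ, hφ, hφc⟩ := extraction_of_frequently_atTop
    (frequently_lt_of_lt_limsup (by isBoundedDefault) hc)
  have h1 : c + b ≤ a + b := by
    rw [← (huv.comp hφ.tendsto_atTop).liminf_eq]
    refine le_trans ?_ (le_liminf_add_ennreal (u ∘ φ) (v ∘ φ))
    refine add_le_add (le_liminf_of_le (by isBoundedDefault)
      (Eventually.of_forall fun n => (hφc n).le)) (hv.trans ?_)
    rw [Filter.liminf, Filter.liminf, ← Filter.map_map]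
    exact limsInf_le_limsInf_of_le (Filter.map_mono hφ.tendsto_atTop) (by isBoundedDefault)
      (by isBoundedDefault)
  exact (ENNReal.add_le_add_iff_right hb).1 h1

/-- Lower semicontinuity on open sets passes to integrals of nonnegative continuous functions. It
applies to both `φ` and `C - φ`, whose integrals add up to `C` times the total mass, which
converges. -/
theorem FiniteMeasure.tendsto_of_isOpen_le_liminf {X : Type*} [TopologicalSpace X]
    [MeasurableSpace X] [OpensMeasurableSpace X] {ν : FiniteMeasure X} {νs : ℕ → FiniteMeasure X}
    (hO : ∀ G, IsOpen G → (ν : Measure X) G ≤ liminf (fun n => (νs n : Measure X) G) atTop)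
    (htot : Tendsto (fun n => (νs n : Measure X) Set.univ) atTop (𝓝 ((ν : Measure X) Set.univ))) :
    Tendsto νs atTop (𝓝 ν) := by
  rw [FiniteMeasure.tendsto_iff_forall_lintegral_tendsto]
  intro φ
  set C : ℝ≥0 := nndist φ 0 with hC
  have hφC : ∀ x, φ x ≤ C := fun x => by
    simpa [NNReal.nndist_eq] using BoundedContinuousFunction.nndist_coe_le_nndist (f := φ) (g := 0) x
  have hlow : ∀ g : X → ℝ≥0, Continuous g → ∫⁻ x, g x ∂(ν : Measure X) ≤
      liminf (fun n => ∫⁻ x, g x ∂(νs n : Measure X)) atTop := fun g hg => by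
    simpa using lintegral_le_liminf_lintegral_of_forall_isOpen_measure_le_liminf_measure
      (NNReal.continuous_coe.comp hg) (fun x => (g x).2) hO
  have hsum : ∀ ρ : FiniteMeasure X, ∫⁻ x, φ x ∂(ρ : Measure X) +
      ∫⁻ x, ((C - φ x : ℝ≥0) : ℝ≥0∞) ∂(ρ : Measure X) = C * (ρ : Measure X) Set.univ := fun ρ => by
    rw [← lintegral_add_left (by fun_prop), ← lintegral_const]
    refine lintegral_congr fun x => ?_
    rw [← ENNReal.coe_add, add_tsub_cancel_of_le (hφC x)]
  refine tendsto_of_le_liminf_of_tendsto_add (hlow φ φ.continuous)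
    (hlow (fun x => C - φ x) (by fun_prop)) ?_ ?_
  · refine ((le_add_self.trans (hsum ν).le).trans_lt ?_).ne
    exact ENNReal.mul_lt_top ENNReal.coe_lt_top (measure_lt_top _ _)
  · simp only [hsum]
    exact ENNReal.Tendsto.const_mul htot (Or.inr ENNReal.coe_ne_top)

end WeakConvergence

/-! ### The `BV` case -/

section DensityBV

variable {B : Type*} [NormedAddCommGroup B] [NormedSpace ℝ B] [CompleteSpace B]
  [TopologicalSpace.SeparableSpace B] [MeasurableSpace B] [BorelSpace B]
  {μ : Measure B} [IsFiniteMeasure μ] {f : B → ℝ}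

lemma IsCylindrical.lintegral_enorm_fderiv_ne_top {v : B → ℝ} (hv : IsCylindrical v) :
    ∫⁻ x, ‖fderiv ℝ v x‖ₑ ∂μ ≠ ⊤ := by
  obtain ⟨⟨K, hK⟩, -⟩ := hv.isBddLipschitz
  refine ((lintegral_mono fun x => ?_).trans_lt (b := ∫⁻ _, (K : ℝ≥0∞) ∂μ) ?_).ne
  · exact enorm_le_coe.2 (norm_fderiv_le_of_lipschitz ℝ hK)
  · rw [lintegral_const]
    exact ENNReal.mul_lt_top ENNReal.coe_lt_top (measure_lt_top _ _)

lemma IsCylindrical.integral_norm_fderiv {v : B → ℝ} (hv : IsCylindrical v) :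
    ∫ x, ‖fderiv ℝ v x‖ ∂μ = (∫⁻ x, ‖fderiv ℝ v x‖ₑ ∂μ).toReal := by
  simpa using integral_norm_eq_lintegral_enorm (hv.aestronglyMeasurable_norm_fderiv μ)

lemma IsTotalVariation.apply_le_liminf {ν : Measure B} (hν : IsTotalVariation μ f ν)
    {u : ℕ → B → ℝ} (hu : ∀ n, IsCylindrical (u n)) (huf : TendstoLp 1 μ u f) {G : Set B}
    (hG : IsOpen G) : ν G ≤ liminf (fun n => ∫⁻ x in G, ‖fderiv ℝ (u n) x‖ₑ ∂μ) atTop := by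
  have := UniformSpace.secondCountable_of_separable B
  rw [hν.2 G hG]
  refine (variationOn_le_liminf (fun n => (hu n).isBddLipschitz.locallyLipschitzOn_and_memLp G)
    (tendsto_of_tendsto_of_tendsto_of_le_of_le tendsto_const_nhds huf (fun _ => bot_le)
      fun n => eLpNorm_mono_measure _ Measure.restrict_le_self)).trans (le_of_eq ?_)
  simp only [asympSlope_eq_enorm_fderiv (hu _).contDiff]

/-- Cylindrical approximations of almost optimal locally Lipschitz competitors bound the energies
from above. The lower bound is automatic, as cylindrical functions are competitors themselves. -/
theorem IsTotalVariation.exists_cylindrical_tendsto {ν : Measure B} (hν : IsTotalVariation μ f ν)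
    (hf : MemLp f 1 μ) : ∃ u : ℕ → B → ℝ, (∀ n, IsCylindrical (u n)) ∧ TendstoLp 1 μ u f ∧
      Tendsto (fun n => ∫ x, ‖fderiv ℝ (u n) x‖ ∂μ) atTop (𝓝 (ν.real Set.univ)) := by
  have := hν.1
  have hV : variationOn μ f Set.univ = ν Set.univ := (hν.2 _ isOpen_univ).symm
  have key : ∀ n : ℕ, ∃ v : B → ℝ, IsCylindrical v ∧
      eLpNorm (fun x => v x - f x) 1 μ ≤ ((n : ℝ≥0∞) + 1)⁻¹ + ((n : ℝ≥0∞) + 1)⁻¹ ∧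
      ∫⁻ x, ‖fderiv ℝ v x‖ₑ ∂μ ≤ ν Set.univ + ((n : ℝ≥0∞) + 1)⁻¹ + ((n : ℝ≥0∞) + 1)⁻¹ := by
    intro n
    have hn : 0 < ((n : ℝ≥0∞) + 1)⁻¹ := ENNReal.inv_pos.2 (by simp)
    obtain ⟨u, hu, huf, hue⟩ := exists_seq_of_variationOn_lt
      (hV.trans_lt (ENNReal.lt_add_right (measure_ne_top ν _) hn.ne'))
    simp only [Measure.restrict_univ, locallyLipschitzOn_univ] at hu huf hue
    obtain ⟨k, hk⟩ := (huf.eventually_lt_const hn).exists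
    obtain ⟨v, hv, hvu, hve⟩ := exists_cylindrical_energy_le (hu k).1 (hu k).2 hn
    refine ⟨v, hv, ?_, hve.trans (add_le_add (hue k).le le_rfl)⟩
    have e : (fun x => v x - f x) = (fun x => v x - u k x) + fun x => u k x - f x := by
      ext x
      simp
    rw [e]
    exact (eLpNorm_add_le ((hv.aestronglyMeasurable μ).sub (hu k).2.1) ((hu k).2.1.sub hf.1)
      le_rfl).trans (add_le_add hvu hk.le)
  choose v hv hvf hve using key
  have hinv : Tendsto (fun n : ℕ => ((n : ℝ≥0∞) + 1)⁻¹) atTop (𝓝 0) := by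
    simpa using (tendsto_add_atTop_iff_nat 1).2 ENNReal.tendsto_inv_nat_nhds_zero
  have hlp : TendstoLp 1 μ v f := tendsto_of_tendsto_of_tendsto_of_le_of_le tendsto_const_nhds
    (by simpa using hinv.add hinv) (fun _ => bot_le) hvf
  refine ⟨v, hv, hlp, ?_⟩
  simp only [(hv _).integral_norm_fderiv]
  refine (ENNReal.tendsto_toReal (measure_ne_top ν _)).comp ?_
  refine tendsto_of_le_liminf_of_limsup_le ?_ ?_
  · simpa using hν.apply_le_liminf hv hlp isOpen_univ
  · refine (limsup_le_limsup (Eventually.of_forall hve)).trans (le_of_eq ?_)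
    simpa using ((hinv.const_add (ν Set.univ)).add hinv).limsup_eq

theorem IsTotalVariation.tendsto_integral {ν : Measure B} (hν : IsTotalVariation μ f ν)
    {u : ℕ → B → ℝ} (hu : ∀ n, IsCylindrical (u n)) (huf : TendstoLp 1 μ u f)
    (hlim : Tendsto (fun n => ∫ x, ‖fderiv ℝ (u n) x‖ ∂μ) atTop (𝓝 (ν.real Set.univ)))
    (φ : B →ᵇ ℝ) :
    Tendsto (fun n => ∫ x, φ x ∂(μ.withDensity fun y => ‖fderiv ℝ (u n) y‖ₑ)) atTop
      (𝓝 (∫ x, φ x ∂ν)) := by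
  have := hν.1
  have hfin : ∀ n, IsFiniteMeasure (μ.withDensity fun y => ‖fderiv ℝ (u n) y‖ₑ) := fun n =>
    isFiniteMeasure_withDensity (hu n).lintegral_enorm_fderiv_ne_top
  have h := FiniteMeasure.tendsto_of_isOpen_le_liminf (ν := ⟨ν, hν.1⟩)
    (νs := fun n => ⟨μ.withDensity fun y => ‖fderiv ℝ (u n) y‖ₑ, hfin n⟩)
    (fun G hG => by
      simpa [withDensity_apply _ hG.measurableSet] using hν.apply_le_liminf hu huf hG) (by
      simp only [(hu _).integral_norm_fderiv] at hlim
      simpa using (ENNReal.tendsto_toReal_iff (fun n => (hu n).lintegral_enorm_fderiv_ne_top)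
        (measure_ne_top ν _)).1 hlim)
  exact FiniteMeasure.tendsto_iff_forall_integral_tendsto.1 h φ

end DensityBV

end DensityInEnergy

end

theorem mainTheorem2 {B : Type*} [NormedAddCommGroup B] [NormedSpace ℝ B] [CompleteSpace B]
    [TopologicalSpace.SeparableSpace B] [MeasurableSpace B] [BorelSpace B]
    (μ : Measure B) [IsFiniteMeasure μ] :
    (∀ p : ℝ≥0∞, 1 ≤ p → p ≠ ⊤ → ∀ f : B → ℝ, DensityInEnergy.MemSobolev p μ f →
      (∃ G : B → ℝ, DensityInEnergy.IsMinimalRelaxedSlope p μ f G) ∧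
      ∀ G : B → ℝ, DensityInEnergy.IsMinimalRelaxedSlope p μ f G →
        ∃ u : ℕ → B → ℝ, (∀ n, DensityInEnergy.IsCylindrical (u n)) ∧
          DensityInEnergy.TendstoLp p μ u f ∧
          DensityInEnergy.TendstoLp p μ (fun n x => ‖fderiv ℝ (u n) x‖) G) ∧
    (∀ f : B → ℝ, DensityInEnergy.MemBV μ f →
      (∃! ν : Measure B, DensityInEnergy.IsTotalVariation μ f ν) ∧
      ∀ ν : Measure B, DensityInEnergy.IsTotalVariation μ f ν →
        (∃ u : ℕ → B → ℝ, (∀ n, DensityInEnergy.IsCylindrical (u n)) ∧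
          DensityInEnergy.TendstoLp 1 μ u f ∧
          Tendsto (fun n => ∫ x, ‖fderiv ℝ (u n) x‖ ∂μ) atTop (𝓝 (ν.real Set.univ))) ∧
        ∀ u : ℕ → B → ℝ, (∀ n, DensityInEnergy.IsCylindrical (u n)) →
          DensityInEnergy.TendstoLp 1 μ u f →
          Tendsto (fun n => ∫ x, ‖fderiv ℝ (u n) x‖ ∂μ) atTop (𝓝 (ν.real Set.univ)) →
          ∀ φ : B →ᵇ ℝ,
            Tendsto (fun n => ∫ x, φ x ∂(μ.withDensity fun y => ‖fderiv ℝ (u n) y‖ₑ)) atTop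
              (𝓝 (∫ x, φ x ∂ν))) := by
  have := UniformSpace.secondCountable_of_separable B
  exact ⟨fun p hp1 hp f hf => DensityInEnergy.MemSobolev.density_in_energy hp1 hp hf,
    fun f hf => ⟨hf.existsUnique_isTotalVariation, fun ν hν =>
      ⟨hν.exists_cylindrical_tendsto hf.1, fun u hu huf hlim φ => hν.tendsto_integral hu huf hlim φ⟩⟩⟩
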